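/- Let $p,q\in\mathbb C$ with $0<|p|,|q|<1$, put $(z;p)_\infty=\prod_{j\ge0}(1-zp^j)$ and let $$\Gamma(z)=\Gamma_{p,q}(z)=\prod_{j,k\ge 0}\frac{1-z^{-1}p^{j+1}q^{k+1}}{1-zp^jq^k}$$ be the elliptic gamma function, with the conventions $\Gamma(t_1,\dots,t_k)=\prod_i\Gamma(t_i)$, $\Gamma(tz^{\pm})=\Gamma(tz)\Gamma(tz^{-1})$, $\Gamma(z^{\pm2})=\Gamma(z^2)\Gamma(z^{-2})$, $\Gamma(tz^\pm\xi^\pm)=\Gamma(tz\xi)\Gamma(tz\xi^{-1})\Gamma(tz^{-1}\xi)\Gamma(tz^{-1}\xi^{-1})$. Let $\kappa=\frac{(p;p)_\infty(q;q)_\infty}{4\pi i}$, let $\mathbb T$ be the positively oriented unit circle, and for $|t_j|<1$, $\prod_{j=1}^8t_j=(pq)^2$, let $$V(t_1,\dots,t_8)=\kappa\int_{\mathbb T}\frac{\prod_{j=1}^8\Gamma(t_jz^\pm)}{\Gamma(z^{\pm2})}\frac{dz}{z}$$ be the elliptic hypergeometric function. Let $a,b,c,d,s,x\in\mathbb C^*$,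 put $\rho=pq/s^2$, choose any values of the square roots $\sqrt{pq/(ab)}$ and $\sqrt{pq/(cd)}$, and fix the remaining roots by $$\sqrt{\tfrac{ab}{\rho}}=\frac{s}{\sqrt{pq/(ab)}},\qquad \sqrt{\tfrac{\rho}{cd}}=s^{-1}\sqrt{\tfrac{pq}{cd}},$$ $$\sqrt{\tfrac{a\rho}{b}}=\frac as\sqrt{\tfrac{pq}{ab}},\qquad \sqrt{\tfrac{b\rho}{a}}=\frac bs\sqrt{\tfrac{pq}{ab}},\qquad \sqrt{\tfrac{c\rho}{d}}=\frac cs\sqrt{\tfrac{pq}{cd}},\qquad \sqrt{\tfrac{d\rho}{c}}=\frac ds\sqrt{\tfrac{pq}{cd}}.$$ Define the basis vectors $$\phi(w;a,b|\xi;s)=\Gamma\Bigl(sa\xi^\pm,\,sb\xi^\pm,\,\sqrt{\tfrac{pq}{ab}}\,w^\pm\xi^\pm\Bigr),$$ define $\phi(x;c,d|\xi;s)$ by the same formula with $(w,a,b)$ replaced by $(x,c,d)$, and define the kernel, which does not depend on $\xi$, by $$R(c,d,a,b;x,w|s)=\frac{\Gamma\Bigl(ab,\sqrt{\frac{a\r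ho}{b}}w^\pm,\sqrt{\frac{b\rho}{a}}w^\pm\Bigr)}{\Gamma\Bigl(cd,\sqrt{\frac{c\rho}{d}}x^\pm,\sqrt{\frac{d\rho}{c}}x^\pm\Bigr)}\;\frac{1}{\Gamma\bigl(\frac{ab}{\rho},\frac{\rho}{cd},w^{\pm2}\bigr)}\;V\Bigl(c,d,\sqrt{\tfrac{\rho}{cd}}\,x,\sqrt{\tfrac{\rho}{cd}}\,x^{-1},\tfrac{pq}{a},\tfrac{pq}{b},\sqrt{\tfrac{ab}{\rho}}\,w,\sqrt{\tfrac{ab}{\rho}}\,w^{-1}\Bigr).$$ Suppose that $$|c|,\ |d|,\ \Bigl|\sqrt{\tfrac{\rho}{cd}}\,x^{\pm1}\Bigr|,\ \Bigl|\tfrac{pq}{a}\Bigr|,\ \Bigl|\tfrac{pq}{b}\Bigr|,\ \Bigl|\sqrt{\tfrac{ab}{\rho}}\Bigr|,\ \Bigl|\sqrt{\tfrac{a\rho}{b}}\Bigr|,\ \Bigl|\sqrt{\tfrac{b\rho}{a}}\Bigr|<1 .$$ Then for every $\xi\in\mathbb C^*$ with $\bigl|\sqrt{pq/(ab)}\,\xi^{\pm1}\bigr|<1$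 the integrand below is integrable on $\mathbb T$ and $$\phi(x;c,d|\xi;s)=\kappa\int_{\mathbb T}R(c,d,a,b;x,w|s)\,\phi(w;a,b|\xi;s)\,\frac{dw}{w}.$$ -/

import Mathlib

noncomputable section

namespace EllHyp

/-- The infinite product `(z; p)_∞ = ∏_{j ≥ 0} (1 - z p^j)`, for `|p| < 1`. -/
def qPoch (z p : ℂ) : ℂ := ∏' j : ℕ, (1 - z * p ^ j)

/-- The elliptic gamma function
`Γ_{p,q}(z) = ∏_{j,k ≥ 0} (1 - z⁻¹ p^{j+1} q^{k+1}) / (1 - z p^j q^k)`, for `|p|, |q| < 1`.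
At a pole some factor has denominator `0`, so the value here is `0`; in particular `1 / Γ_{p,q}`
takes its correct value `0` there. -/
def eGamma (p q z : ℂ) : ℂ :=
  ∏' jk : ℕ × ℕ, (1 - z⁻¹ * p ^ (jk.1 + 1) * q ^ (jk.2 + 1)) / (1 - z * p ^ jk.1 * q ^ jk.2)

/-- `Γ_{p,q}(t z^±) = Γ_{p,q}(t z) Γ_{p,q}(t z⁻¹)`. -/
def eGammaPM (p q t z : ℂ) : ℂ := eGamma p q (t * z) * eGamma p q (t * z⁻¹)

/-- `κ = (p; p)_∞ (q; q)_∞ / (4 π i)`. -/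
def kappa (p q : ℂ) : ℂ := qPoch p p * qPoch q q / (4 * Real.pi * Complex.I)

/-- The elliptic hypergeometric integral `I^{(m)}(t_1, …, t_{2m+6})` over the unit circle; it is
used for `|t_j| < 1` and `∏ t_j = (pq)^{m+1}`. -/
def ellHypI (p q : ℂ) (m : ℕ) (t : Fin (2 * m + 6) → ℂ) : ℂ :=
  kappa p q * ∮ z in C(0, 1),
    (∏ j, eGammaPM p q (t j) z) / (eGamma p q (z ^ 2) * eGamma p q (z⁻¹ ^ 2)) / z

/-- The elliptic hypergeometric function `V(t_1, …, t_8) = I^{(1)}(t_1, …, t_8)`. -/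
def ellHypV (p q : ℂ) (t : Fin 8 → ℂ) : ℂ := ellHypI p q 1 t

/-- The basis vector
`φ(w; a, b | ξ; s) = Γ_{p,q}(s a ξ^±, s b ξ^±, √(pq/(ab)) w^± ξ^±)`,
where `u` is the chosen value of the square root `√(pq/(ab))`. -/
def phi (p q u w a b ξ s : ℂ) : ℂ :=
  eGammaPM p q (s * a) ξ * eGammaPM p q (s * b) ξ *
    (eGammaPM p q (u * w) ξ * eGammaPM p q (u * w⁻¹) ξ)

/-- The kernel `R(c, d, a, b; x, w | s)`. Here `u` and `v` are the chosen values of `√(pq/(ab))` and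
`√(pq/(cd))`, the same ones as in `phi`; with `ρ = pq/s²` they fix the other roots as
`√(ab/ρ) = s/u`, `√(ρ/(cd)) = v/s`, `√(aρ/b) = a u/s`, `√(bρ/a) = b u/s`,
`√(cρ/d) = c v/s` and `√(dρ/c) = d v/s` (see `sq_roots` below). -/
def kernelR (p q u v c d a b x w s : ℂ) : ℂ :=
  let ρ := p * q / s ^ 2
  (eGamma p q (a * b) * eGammaPM p q (a * u / s) w * eGammaPM p q (b * u / s) w) /
    (eGamma p q (c * d) * eGammaPM p q (c * v / s) x * eGammaPM p q (d * v / s) x) *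
  (1 / (eGamma p q (a * b / ρ) * eGamma p q (ρ / (c * d)) *
    (eGamma p q (w ^ 2) * eGamma p q (w⁻¹ ^ 2)))) *
  ellHypV p q ![c, d, v / s * x, v / s * x⁻¹, p * q / a, p * q / b, s / u * w, s / u * w⁻¹]

/-- The numbers which stand for the square roots in `kernelR` have the right squares. -/
theorem sq_roots {p q a b c d s u v ρ : ℂ} (hp : p ≠ 0) (hq : q ≠ 0) (ha : a ≠ 0) (hb : b ≠ 0)
    (hc : c ≠ 0) (hd : d ≠ 0) (hs : s ≠ 0) (hu : u ^ 2 = p * q / (a * b))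
    (hv : v ^ 2 = p * q / (c * d)) (hρ : ρ = p * q / s ^ 2) :
    (s / u) ^ 2 = a * b / ρ ∧ (v / s) ^ 2 = ρ / (c * d) ∧
    (a * u / s) ^ 2 = a * ρ / b ∧ (b * u / s) ^ 2 = b * ρ / a ∧
    (c * v / s) ^ 2 = c * ρ / d ∧ (d * v / s) ^ 2 = d * ρ / c := by
  subst hρ
  simp only [div_pow, mul_pow, hu, hv]
  refine ⟨?_, ?_, ?_, ?_, ?_, ?_⟩ <;> field_simp

end EllHyp

end

namespace EllHyp

open Complex Filter Topology MeasureTheory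

/-! ### Infinite products `∏ (1 - z u_i)` -/

section Products

variable {ι : Type*} {u : ι → ℂ}

/-! On the unit circle the integrand `R φ / w` is a constant times an integral over `z`, so the
right-hand side is a double integral, continuous on the torus. After exchanging the order, the
`w`-integral is an elliptic beta integral with parameters `au/s, bu/s, (s/u)z^±, uξ^±`, whose
product is `abu² = pq`. Its value contains `Γ(az^±, bz^±)`, which cancels `Γ((pq/a)z^±, (pq/b)z^±)`
by the reflection `Γ(x)Γ(pq/x) = 1`; the factor `Γ(sξ^±z^±)` survives. The `z`-integral is then
again an elliptic beta integral, with parameters `c, d, (v/s)x^±, sξ^±` and product `cdv² = pq`. Its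
value is `φ(x;c,d|ξ;s)` times factors that cancel the prefactor of `R`.

Everything rests on the elliptic beta integral, `kappa_mul_betaInt`. Let `F` be the integral divided
by the conjectured product; it is holomorphic in the parameters. By `theta_six_params`, a
combination of two contiguous integrands is a total difference `G(z/q)/q - G(z)` with no pole
between the two circles, so `F` is unchanged when a factor `q` moves from one parameter to another
(`betaInt_div_betaProd_shift`). In exponential coordinates `F` is doubly periodic on a strip. If
`|t₁t₆| < |q|`, the strip is wider than the period and the maximum principle shows that `F` depends
on `t₁, t₆` only through `t₁t₆`. Two such moves lead to a family containing `±ir`. As `r → 1` poles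
pinch the contour at `±i`, a Poisson kernel appears, and the limit of `F` is explicit. Analytic
continuation removes the restriction on `t₁t₆`.

The theta identities come from the three-term relation, a Plücker relation once `θ(xy)θ(x/y)` is
written as a 2×2 determinant. That form results from splitting a product of two theta series by
parity. The theta product is a constant multiple of the series by the same Liouville argument; the
value of the constant is never needed. -/

theorem differentiable_tprod_one_sub_mul (hu : Summable fun i => ‖u i‖) :
    Differentiable ℂ fun z : ℂ => ∏' i, (1 - z * u i) := by
  have key : ∀ R : ℝ, DifferentiableOn ℂ (fun z : ℂ => ∏' i, (1 + -(z * u i)))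
      (Metric.ball 0 R) := by
    intro R
    refine ((hu.mul_left R).hasProdLocallyUniformlyOn_one_add (f := fun i z => -(z * u i))
      Metric.isOpen_ball (Eventually.of_forall fun i z hz => ?_)
      (fun i => by fun_prop)).differentiableOn
      (Eventually.of_forall fun s => ?_) Metric.isOpen_ball
    · rw [norm_neg, norm_mul]
      have : ‖z‖ < R := by simpa using hz
      gcongr
    · simpa [Finset.prod_fn] using DifferentiableOn.finsetProd (fun _ _ ↦ by fun_prop)
  intro z
  have h := (key (‖z‖ + 1)).differentiableAt (Metric.isOpen_ball.mem_nhds (x := z) (by simp))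
  simpa only [sub_eq_add_neg] using h

theorem multipliable_one_sub_mul (hu : Summable fun i => ‖u i‖) (z : ℂ) :
    Multipliable fun i => 1 - z * u i := by
  simpa only [sub_eq_add_neg] using multipliable_one_add_of_summable
    (f := fun i => -(z * u i)) (by simpa using hu.mul_left ‖z‖)

theorem tprod_one_sub_mul_ne_zero (hu : Summable fun i => ‖u i‖) {z : ℂ}
    (hz : ∀ i, 1 - z * u i ≠ 0) : ∏' i, (1 - z * u i) ≠ 0 := by
  simp only [sub_eq_add_neg] at hz ⊢
  exact tprod_one_add_ne_zero_of_summable hz (by simpa using hu.mul_left ‖z‖)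

end Products

theorem one_sub_ne_zero_of_norm_lt {z : ℂ} (hz : ‖z‖ < 1) : 1 - z ≠ 0 := by
  intro h
  rw [sub_eq_zero] at h
  simp [← h] at hz

/-! ### The product `(z; p)_∞` -/

section qPoch

variable {p : ℂ} (hp : ‖p‖ < 1)

include hp

theorem summable_norm_pow : Summable fun j : ℕ => ‖p ^ j‖ := by
  simpa using summable_geometric_of_lt_one (norm_nonneg p) hp

theorem differentiable_qPoch : Differentiable ℂ fun z => qPoch z p :=
  differentiable_tprod_one_sub_mul (summable_norm_pow hp)

theorem norm_mul_pow_lt {z : ℂ} (hz : ‖z‖ < 1) (j : ℕ) : ‖z * p ^ j‖ < 1 := by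
  rw [norm_mul, norm_pow]
  exact lt_of_le_of_lt (mul_le_of_le_one_right (norm_nonneg z)
    (pow_le_one₀ (norm_nonneg _) hp.le)) hz

theorem qPoch_ne_zero {z : ℂ} (hz : ‖z‖ < 1) : qPoch z p ≠ 0 :=
  tprod_one_sub_mul_ne_zero (summable_norm_pow hp) fun j =>
    one_sub_ne_zero_of_norm_lt (norm_mul_pow_lt hp hz j)

theorem qPoch_eq (z : ℂ) : qPoch z p = (1 - z) * qPoch (p * z) p := by
  rw [qPoch, tprod_eq_zero_mul']
  · simp only [pow_zero, mul_one, qPoch]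
    congr 2
    ext j
    ring
  · refine (multipliable_one_sub_mul (summable_norm_pow hp) (p * z)).congr fun j => ?_
    ring

end qPoch

/-! ### The double product and the elliptic gamma function -/

/-- The double product `∏_{j,k ≥ 0} (1 - z p^j q^k)`. -/
noncomputable def dblPoch (p q z : ℂ) : ℂ := ∏' jk : ℕ × ℕ, (1 - z * (p ^ jk.1 * q ^ jk.2))

theorem dblPoch_comm (p q z : ℂ) : dblPoch p q z = dblPoch q p z := by
  rw [dblPoch, dblPoch, ← (Equiv.prodComm ℕ ℕ).tprod_eq]
  simp [mul_comm]

section dblPoch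

variable {p q : ℂ} (hp : ‖p‖ < 1) (hq : ‖q‖ < 1)

include hp hq

theorem summable_norm_pow_mul_pow : Summable fun jk : ℕ × ℕ => ‖p ^ jk.1 * q ^ jk.2‖ := by
  simpa using (summable_geometric_of_lt_one (norm_nonneg p) hp).mul_of_nonneg
    (summable_geometric_of_lt_one (norm_nonneg q) hq) (fun _ => by positivity)
    (fun _ => by positivity)

theorem differentiable_dblPoch : Differentiable ℂ (dblPoch p q) :=
  differentiable_tprod_one_sub_mul (summable_norm_pow_mul_pow hp hq)

theorem dblPoch_ne_zero {z : ℂ} (hz : ‖z‖ < 1) : dblPoch p q z ≠ 0 :=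
  tprod_one_sub_mul_ne_zero (summable_norm_pow_mul_pow hp hq) fun jk => by
    rw [← mul_assoc]
    exact one_sub_ne_zero_of_norm_lt (norm_mul_pow_lt hq (norm_mul_pow_lt hp hz _) _)

/-- The row `j = 0` of the double product is `qPoch z q`; the other rows form the same product at `p
* z`. -/
theorem dblPoch_eq_left (z : ℂ) : dblPoch p q z = qPoch z q * dblPoch p q (p * z) := by
  have h1 : ∀ z, dblPoch p q z = ∏' j : ℕ, qPoch (z * p ^ j) q := by
    intro z
    have hm := multipliable_one_sub_mul (summable_norm_pow_mul_pow hp hq) z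
    rw [dblPoch, hm.tprod_prod' fun j => ?_]
    · simp only [qPoch, mul_assoc]
    · refine (multipliable_one_sub_mul (summable_norm_pow hq) (z * p ^ j)).congr fun k => ?_
      ring
  have h2 : ∀ z, Multipliable fun j : ℕ => qPoch (z * p ^ j) q := by
    intro z
    have hm := (multipliable_one_sub_mul (summable_norm_pow_mul_pow hp hq) z).hasProd
    have := hm.prod_fiberwise (g := fun j => qPoch (z * p ^ j) q) fun j => by
      have := (multipliable_one_sub_mul (summable_norm_pow hq) (z * p ^ j)).hasProd
      simpa only [qPoch, mul_assoc] using this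
    exact this.multipliable
  rw [h1, h1, tprod_eq_zero_mul']
  · simp only [pow_zero, mul_one]
    congr 2
    ext j
    ring_nf
  · refine (h2 (p * z)).congr fun j => ?_
    ring_nf

theorem dblPoch_eq_right (z : ℂ) : dblPoch p q z = qPoch z p * dblPoch p q (q * z) := by
  rw [dblPoch_comm p q z, dblPoch_eq_left hq hp, dblPoch_comm q p]

/-- Where the denominator is nonzero this is a quotient of convergent products. Where it vanishes,
one of its factors does, so a factor of `eGamma` is `0` by the convention `x / 0 = 0`, and both
sides are `0`. -/
theorem eGamma_eq (z : ℂ) : eGamma p q z = dblPoch p q (p * q / z) / dblPoch p q z := by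
  have hs := summable_norm_pow_mul_pow hp hq
  by_cases h : dblPoch p q z = 0
  · rw [h, div_zero]
    by_contra h0
    refine tprod_one_sub_mul_ne_zero hs (z := z) (fun jk hjk => h0 ?_) h
    exact tprod_of_exists_eq_zero ⟨jk, by rw [← mul_assoc] at hjk; rw [hjk, div_zero]⟩
  · have := ((multipliable_one_sub_mul hs (p * q / z)).hasProd.div₀
      (multipliable_one_sub_mul hs z).hasProd h).tprod_eq
    rw [dblPoch, dblPoch, ← this, eGamma]
    congr 1
    ext jk
    congr 1 <;> ring

theorem differentiableAt_eGamma {z : ℂ} (hz0 : z ≠ 0) (hz : ‖z‖ < 1) :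
    DifferentiableAt ℂ (eGamma p q) z := by
  rw [show eGamma p q = fun z => dblPoch p q (p * q / z) / dblPoch p q z from
    funext (eGamma_eq hp hq)]
  have h := differentiable_dblPoch hp hq
  exact ((h _).comp z ((differentiableAt_const _).div differentiableAt_id hz0)).div (h z)
    (dblPoch_ne_zero hp hq hz)

theorem continuousAt_eGamma {z : ℂ} (hz0 : z ≠ 0) (hz : ‖z‖ < 1) :
    ContinuousAt (eGamma p q) z :=
  (differentiableAt_eGamma hp hq hz0 hz).continuousAt

theorem eGamma_ne_zero {z : ℂ} (hz : ‖z‖ < 1) (hz' : ‖p * q / z‖ < 1) : eGamma p q z ≠ 0 := by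
  rw [eGamma_eq hp hq]
  exact div_ne_zero (dblPoch_ne_zero hp hq hz') (dblPoch_ne_zero hp hq hz)

theorem eGamma_mul_eGamma {x y : ℂ} (hx : ‖x‖ < 1) (hy : ‖y‖ < 1) (hx0 : x ≠ 0) (hy0 : y ≠ 0)
    (h : x * y = p * q) :
    eGamma p q x * eGamma p q y = 1 := by
  rw [eGamma_eq hp hq, eGamma_eq hp hq, ← h, mul_div_cancel_left₀ _ hx0,
    mul_div_cancel_right₀ _ hy0]
  have := dblPoch_ne_zero hp hq hx
  have := dblPoch_ne_zero hp hq hy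
  field_simp

end dblPoch

/-! ### The theta function -/

/-- The theta function `θ(z; p) = (z; p)_∞ (p / z; p)_∞`. -/
noncomputable def theta (p z : ℂ) : ℂ := qPoch z p * qPoch (p / z) p

section theta

variable {p : ℂ} (hp0 : p ≠ 0) (hp : ‖p‖ < 1)

include hp0 in
theorem theta_p_div (z : ℂ) : theta p (p / z) = theta p z := by
  rw [theta, theta, div_div_cancel₀ hp0, mul_comm]

include hp in
theorem theta_inv {z : ℂ} (hz : z ≠ 0) : theta p z⁻¹ = -z⁻¹ * theta p z := by
  rw [theta, theta, qPoch_eq hp z⁻¹, qPoch_eq hp z, div_inv_eq_mul]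
  field_simp
  ring

include hp in
theorem theta_inv_eq {z w : ℂ} (hz : z ≠ 0) (h : w * z = 1) : theta p w = -w * theta p z := by
  rw [eq_inv_of_mul_eq_one_left h, theta_inv hp hz]

include hp0 hp in
theorem theta_p_mul {z : ℂ} (hz : z ≠ 0) : theta p (p * z) = -z⁻¹ * theta p z := by
  rw [← theta_inv hp hz, ← theta_p_div hp0 z⁻¹, div_inv_eq_mul]

include hp in
theorem theta_ne_zero {z : ℂ} (hz : ‖p * z‖ < 1) (hz' : ‖p / z‖ < 1) (h1 : z ≠ 1) :
    theta p z ≠ 0 := by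
  rw [theta, qPoch_eq hp]
  exact mul_ne_zero (mul_ne_zero (sub_ne_zero.2 h1.symm) (qPoch_ne_zero hp hz))
    (qPoch_ne_zero hp hz')

include hp in
theorem differentiableAt_theta {z : ℂ} (hz : z ≠ 0) : DifferentiableAt ℂ (theta p) z := by
  have h := differentiable_qPoch hp
  exact (h z).mul ((h _).comp z ((differentiableAt_const _).div differentiableAt_id hz))

include hp in
theorem continuousAt_theta {z : ℂ} (hz : z ≠ 0) : ContinuousAt (theta p) z :=
  (differentiableAt_theta hp hz).continuousAt

end theta

/-! ### The `q`-shift of the elliptic gamma function and its reflection on the unit circle. -/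

section shift

variable {p q : ℂ} (hp : ‖p‖ < 1) (hq : ‖q‖ < 1)

include hp hq

/-- The bound on `z` matters: at `z = 1` a zero of `theta` meets a pole of the gamma function,
recorded as `0`, while the left side need not vanish. -/
theorem eGamma_q_mul (hq0 : q ≠ 0) {z : ℂ} (hz0 : z ≠ 0) (hz : ‖z‖ < 1) :
    eGamma p q (q * z) = theta p z * eGamma p q z := by
  rw [eGamma_eq hp hq, eGamma_eq hp hq, theta, dblPoch_eq_right hp hq z,
    show p * q / (q * z) = p / z by field_simp, dblPoch_eq_right hp hq (p / z),
    show q * (p / z) = p * q / z by ring]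
  have h1 := qPoch_ne_zero hp hz
  by_cases h2 : dblPoch p q (q * z) = 0
  · simp [h2]
  · field_simp

/-- Stripping one single product in each direction from `dblPoch p q y` leaves `dblPoch p q (p * q *
y)`, the numerator of `eGamma p q y⁻¹`; likewise with `y⁻¹`. The stripped factors assemble into the
thetas. At `y = 1` both sides are `0`, the pole being recorded as `0`. -/
theorem inv_eGamma_mul_eGamma_inv {y : ℂ} (hy : ‖y‖ = 1) :
    (eGamma p q y * eGamma p q y⁻¹)⁻¹ = theta p y * theta q y⁻¹ := by
  have hy0 : y ≠ 0 := by
    rintro rfl; simp at hy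
  have hpq : ‖p * q‖ < 1 := by
    rw [norm_mul]; exact mul_lt_one_of_nonneg_of_lt_one_left (norm_nonneg _) hp hq.le
  have h1 : dblPoch p q (p * q * y) ≠ 0 := dblPoch_ne_zero hp hq (by rwa [norm_mul, hy, mul_one])
  have h2 : dblPoch p q (p * q / y) ≠ 0 := dblPoch_ne_zero hp hq (by rwa [norm_div, hy, div_one])
  rw [eGamma_eq hp hq, eGamma_eq hp hq, theta, theta, dblPoch_eq_right hp hq y,
    dblPoch_eq_left hp hq (q * y), dblPoch_eq_left hp hq y⁻¹, dblPoch_eq_right hp hq (p * y⁻¹),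
    div_inv_eq_mul, div_inv_eq_mul, show p * (q * y) = p * q * y by ring,
    show q * (p * y⁻¹) = p * q / y by ring, show p * y⁻¹ = p / y by ring]
  field_simp

end shift

/-! ### A Liouville theorem for doubly periodic functions on a strip -/

theorem isOpen_strip (A B : ℝ) : IsOpen {σ : ℂ | A < σ.re ∧ σ.re < B} :=
  (isOpen_lt continuous_const continuous_re).inter (isOpen_lt continuous_re continuous_const)

theorem isPreconnected_strip (A B : ℝ) : IsPreconnected {σ : ℂ | A < σ.re ∧ σ.re < B} :=
  ((convex_halfSpace_re_gt A).inter (convex_halfSpace_re_lt B)).isPreconnected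

/-- The strip is wider than `τ.re`, so a compact rectangle represents all values up to periods. The
maximum of `‖f‖` on it is then a local maximum in the open strip, and the maximum principle applies.
-/
theorem eq_of_periodic_of_differentiableOn_strip {A B : ℝ} {f : ℂ → ℂ} {τ : ℂ}
    (hf : DifferentiableOn ℂ f {σ | A < σ.re ∧ σ.re < B})
    (h1 : Function.Periodic f (2 * Real.pi * I)) (hτ : 0 < τ.re) (hAB : A + τ.re < B)
    (h2 : ∀ σ : ℂ, A < σ.re → σ.re + τ.re < B → f (σ + τ) = f σ) {σ σ' : ℂ}
    (hσ : A < σ.re ∧ σ.re < B) (hσ' : A < σ'.re ∧ σ'.re < B) : f σ = f σ' := by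
  set ℓ := τ.re with hℓ
  obtain ⟨A', hA, hB⟩ : ∃ A', A < A' ∧ A' + ℓ < B := ⟨(A + (B - ℓ)) / 2, by linarith, by linarith⟩
  set K : Set ℂ := Set.Icc A' (A' + ℓ) ×ℂ Set.Icc (-Real.pi) Real.pi with hK
  have hKc : IsCompact K := isCompact_Icc.reProdIm isCompact_Icc
  have hK0 : K.Nonempty := ⟨A', by simp [hK, mem_reProdIm, hτ.le, Real.pi_pos.le]⟩
  have hKs : K ⊆ {σ | A < σ.re ∧ σ.re < B} := by
    intro z hz
    rw [hK, mem_reProdIm] at hz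
    exact ⟨hA.trans_le hz.1.1, hz.1.2.trans_lt hB⟩
  obtain ⟨m, hmK, hm⟩ := hKc.exists_isMaxOn hK0 (hf.mono hKs).continuousOn.norm
  have hred : ∀ z : ℂ, A' ≤ z.re ∧ z.re ≤ A' + ℓ → ‖f z‖ ≤ ‖f m‖ := by
    intro z hz
    set n : ℤ := round (z.im / (2 * Real.pi)) with hn
    have hp := h1.sub_int_mul_eq (x := z) n
    rw [← hp]
    refine hm ?_
    rw [hK, mem_reProdIm]
    have hre : (z - n * (2 * Real.pi * I)).re = z.re := by simp
    have him : (z - n * (2 * Real.pi * I)).im = z.im - n * (2 * Real.pi) := by simp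
    rw [hre, him]
    refine ⟨hz, ?_⟩
    have h := abs_sub_round (z.im / (2 * Real.pi))
    rw [← hn] at h
    have h' : |z.im - n * (2 * Real.pi)| ≤ Real.pi := by
      have : z.im - n * (2 * Real.pi) = (z.im / (2 * Real.pi) - n) * (2 * Real.pi) := by
        field_simp
      rw [this, abs_mul, abs_of_pos Real.two_pi_pos]
      nlinarith [Real.pi_pos]
    exact abs_le.1 h'
  -- Within one period on either side of the rectangle, a single shift by `±τ` leads back to it. The
  -- enlarged strip has `m` in its interior even if `m` lies on the boundary of `K`.
  set A₁ := max A (A' - ℓ)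
  set B₁ := min B (A' + ℓ + ℓ)
  set U : Set ℂ := {σ | A₁ < σ.re ∧ σ.re < B₁} with hU
  have hUs : U ⊆ {σ | A < σ.re ∧ σ.re < B} := fun z hz =>
    ⟨(le_max_left _ _).trans_lt hz.1, hz.2.trans_le (min_le_left _ _)⟩
  have hmU : m ∈ U := by
    rw [hK, mem_reProdIm] at hmK
    refine ⟨(max_lt hA (by linarith)).trans_le hmK.1.1, hmK.1.2.trans_lt (lt_min hB (by linarith))⟩
  have hmax : IsMaxOn (norm ∘ f) U m := by
    intro z hz
    have hzs := hUs hz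
    have hz1 : A' - ℓ < z.re := (le_max_right _ _).trans_lt hz.1
    have hz2 : z.re < A' + ℓ + ℓ := hz.2.trans_le (min_le_right _ _)
    rcases lt_or_ge z.re A' with h | h
    · change ‖f z‖ ≤ ‖f m‖
      rw [← h2 z hzs.1 (by linarith)]
      exact hred _ ⟨by simp; linarith, by simp; linarith⟩
    rcases le_or_gt z.re (A' + ℓ) with h' | h'
    · exact hred z ⟨h, h'⟩
    · change ‖f z‖ ≤ ‖f m‖
      have := h2 (z - τ) (by simp; linarith) (by simp; linarith [hzs.2])
      rw [sub_add_cancel] at this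
      rw [this]
      exact hred _ ⟨by simp; linarith, by simp; linarith⟩
  have hconst := Complex.eqOn_of_isPreconnected_of_isMaxOn_norm (isPreconnected_strip A₁ B₁)
    (isOpen_strip A₁ B₁) (hf.mono hUs) hmU hmax
  have hev : f =ᶠ[𝓝 m] fun _ => f m :=
    Filter.eventuallyEq_of_mem ((isOpen_strip A₁ B₁).mem_nhds hmU) hconst
  have han := (hf.analyticOnNhd (isOpen_strip A B)).eqOn_of_preconnected_of_eventuallyEq
    analyticOnNhd_const (isPreconnected_strip A B) (hUs hmU) hev
  rw [han hσ, han hσ']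

/-! ### The theta function as a Laurent series -/

/-- The series `∑ (-1)^n p^{n(n-1)/2} x^n` with `p = exp (2πiT)`, `x = exp σ`. -/
noncomputable def thetaSeries (T σ : ℂ) : ℂ :=
  jacobiTheta₂ (σ / (2 * Real.pi * I) + 1 / 2 - T / 2) T

section thetaSeries

variable {T : ℂ}

theorem two_pi_I_ne : (2 * Real.pi * I : ℂ) ≠ 0 := by
  simp [Real.pi_ne_zero]

theorem thetaSeries_periodic : Function.Periodic (thetaSeries T) (2 * Real.pi * I) := by
  intro σ
  rw [thetaSeries, thetaSeries, add_div, div_self two_pi_I_ne,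
    ← jacobiTheta₂_add_left (σ / (2 * Real.pi * I) + 1 / 2 - T / 2)]
  congr 1
  ring

theorem exp_neg_pi_I : cexp (-(Real.pi * I)) = -1 := by
  rw [Complex.exp_neg, Complex.exp_pi_mul_I]; norm_num

theorem thetaSeries_add (σ : ℂ) :
    thetaSeries T (σ + 2 * Real.pi * I * T) = -cexp (-σ) * thetaSeries T σ := by
  have h := two_pi_I_ne
  rw [thetaSeries, thetaSeries, show (σ + 2 * Real.pi * I * T) / (2 * Real.pi * I) + 1 / 2 - T / 2 =
    (σ / (2 * Real.pi * I) + 1 / 2 - T / 2) + T by field_simp; ring, jacobiTheta₂_add_left']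
  congr 1
  rw [show -Real.pi * I * (T + 2 * (σ / (2 * Real.pi * I) + 1 / 2 - T / 2)) = -σ + -(Real.pi * I) by
    field_simp; ring, Complex.exp_add, exp_neg_pi_I]
  ring

theorem thetaSeries_neg (σ : ℂ) : thetaSeries T (-σ) = -cexp (-σ) * thetaSeries T σ := by
  rw [← thetaSeries_add, thetaSeries, thetaSeries, ← jacobiTheta₂_neg_left, ← jacobiTheta₂_add_left]
  congr 1
  have h := two_pi_I_ne
  field_simp
  ring

theorem thetaSeries_zero : thetaSeries T 0 = 0 := by
  have h := thetaSeries_neg (T := T) 0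
  simp only [neg_zero, Complex.exp_zero] at h
  linear_combination h / 2

variable (hT : 0 < T.im)

include hT

theorem differentiable_thetaSeries : Differentiable ℂ (thetaSeries T) := by
  intro σ
  exact (differentiableAt_jacobiTheta₂_fst _ hT).comp (𝕜 := ℂ) σ
    (f := fun σ => σ / (2 * Real.pi * I) + 1 / 2 - T / 2) (by fun_prop)

/-- Integrating the series over one real period keeps only the term `n = 0`, whose integral is `1`;
an identically zero series would give `0`. -/
theorem exists_thetaSeries_ne_zero : ∃ σ, thetaSeries T σ ≠ 0 := by
  by_contra! h
  have h0 : ∀ x : ℝ, ∑' n : ℤ, jacobiTheta₂_term n x T = 0 := by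
    intro x
    -- The point is chosen so that the argument of `jacobiTheta₂` becomes the real number `x`.
    have := h (2 * Real.pi * I * (x - 1 / 2 + T / 2))
    rw [thetaSeries, mul_div_cancel_left₀ _ two_pi_I_ne] at this
    rw [← this, jacobiTheta₂]
    congr 1
    ext n
    congr 1
    ring
  have hnorm : ∀ (n : ℤ) (x : ℝ), ‖jacobiTheta₂_term n x T‖ = ‖jacobiTheta₂_term n 0 T‖ := by
    intro n x
    rw [norm_jacobiTheta₂_term, norm_jacobiTheta₂_term]
    simp
  have hcont : ∀ n : ℤ, Continuous fun x : ℝ => jacobiTheta₂_term n x T := by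
    intro n
    unfold jacobiTheta₂_term
    fun_prop
  have hs : Summable fun n : ℤ => ‖jacobiTheta₂_term n 0 T‖ :=
    ((summable_jacobiTheta₂_term_iff 0 T).2 hT).norm
  have key := intervalIntegral.hasSum_integral_of_dominated_convergence (μ := MeasureTheory.volume)
    (a := 0) (b := 1) (F := fun (n : ℤ) (x : ℝ) => jacobiTheta₂_term n x T)
    (f := fun _ => (0 : ℂ)) (fun n _ => ‖jacobiTheta₂_term n 0 T‖)
    (fun n => (hcont n).aestronglyMeasurable)
    (fun n => Eventually.of_forall fun x _ => (hnorm n x).le)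
    (Eventually.of_forall fun x _ => hs) (by simp)
    (Eventually.of_forall fun x _ => by
      have := ((summable_jacobiTheta₂_term_iff x T).2 hT).hasSum
      rwa [h0 x] at this)
  simp only [intervalIntegral.integral_zero] at key
  have hval : ∀ n : ℤ, n ≠ 0 → ∫ x : ℝ in (0 : ℝ)..1, jacobiTheta₂_term n x T = 0 := by
    intro n hn
    have : ∀ x : ℝ, jacobiTheta₂_term n x T =
        cexp (Real.pi * I * n ^ 2 * T) * cexp (2 * Real.pi * I * n * x) := by
      intro x
      rw [jacobiTheta₂_term, ← Complex.exp_add]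
      ring_nf
    simp_rw [this]
    rw [intervalIntegral.integral_const_mul, integral_exp_mul_complex
      (mul_ne_zero two_pi_I_ne (by exact_mod_cast hn))]
    have : cexp (2 * Real.pi * I * n * (1 : ℝ)) = 1 := by
      rw [Complex.exp_eq_one_iff]
      exact ⟨n, by push_cast; ring⟩
    rw [this]
    simp
  have h1 := key.unique (hasSum_single 0 fun n hn => hval n hn)
  simp [jacobiTheta₂_term] at h1

end thetaSeries

/-! ### The theta product is a constant multiple of the theta series. -/

section product

variable {p T : ℂ} (hp : ‖p‖ < 1) (hp0 : p ≠ 0) (hT : 0 < T.im) (hpT : cexp (2 * Real.pi * I * T) = p)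

theorem re_two_pi_I_mul (T : ℂ) : (2 * Real.pi * I * T).re = -(2 * Real.pi * T.im) := by
  simp

include hT in
-- The singularities at `2πin` are removable because the series vanishes there and `exp σ - 1` has
-- simple zeros. By periodicity it suffices to look at `0`, where the function is a quotient of two
-- `dslope`s.
theorem differentiable_thetaSeries_div :
    Differentiable ℂ fun σ => if cexp σ = 1 then deriv (thetaSeries T) 0 else
      thetaSeries T σ / (cexp σ - 1) := by
  set f : ℂ → ℂ := fun σ => if cexp σ = 1 then deriv (thetaSeries T) 0 else
      thetaSeries T σ / (cexp σ - 1) with hf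
  have hS := differentiable_thetaSeries hT
  have hper : Function.Periodic f (2 * Real.pi * I) := by
    intro σ
    simp only [hf, Complex.exp_periodic σ, thetaSeries_periodic σ]
  have h0 : DifferentiableAt ℂ f 0 := by
    have e1 : f =ᶠ[𝓝 0] fun σ => dslope (thetaSeries T) 0 σ / dslope cexp 0 σ := by
      have hb : Metric.ball (0 : ℂ) 1 ∈ 𝓝 (0 : ℂ) := Metric.ball_mem_nhds _ one_pos
      filter_upwards [hb] with σ hσ
      by_cases h : σ = 0
      · subst h
        simp [hf, dslope_same]
      · have h1 : cexp σ ≠ 1 := by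
          intro hc
          obtain ⟨n, hn⟩ := Complex.exp_eq_one_iff.1 hc
          have hn0 : n ≠ 0 := by
            rintro rfl
            simp at hn
            exact h hn
          have hlt : ‖σ‖ < 1 := by simpa using hσ
          have h1n : (1 : ℝ) ≤ |(n : ℝ)| := by
            exact_mod_cast Int.one_le_abs hn0
          rw [hn] at hlt
          simp only [norm_mul, Complex.norm_intCast, Complex.norm_ofNat, Complex.norm_real,
            Complex.norm_I, mul_one, Real.norm_eq_abs, abs_of_pos Real.pi_pos] at hlt
          nlinarith [Real.pi_gt_three]
        have h2 : cexp σ - 1 ≠ 0 := sub_ne_zero.2 h1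
        simp only [hf, if_neg h1, dslope_of_ne _ h, slope_def_field, thetaSeries_zero, sub_zero,
          Complex.exp_zero]
        field_simp
    have hd : ∀ g : ℂ → ℂ, Differentiable ℂ g → DifferentiableAt ℂ (dslope g 0) 0 := by
      intro g hg
      have := (differentiableOn_dslope (s := Set.univ) (c := (0 : ℂ)) (f := g) univ_mem).2
        hg.differentiableOn
      exact this.differentiableAt univ_mem
    refine DifferentiableAt.congr_of_eventuallyEq ?_ e1
    refine (hd _ hS).div (hd _ Complex.differentiable_exp) ?_
    simp [dslope_same]
  intro σ
  by_cases h : cexp σ = 1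
  · obtain ⟨n, hn⟩ := Complex.exp_eq_one_iff.1 h
    have hfun : f = fun z => f (z - n * (2 * Real.pi * I)) := by
      ext z
      exact (hper.sub_int_mul_eq n).symm
    rw [hfun]
    refine DifferentiableAt.comp σ (g := f) (f := fun z => z - n * (2 * Real.pi * I)) ?_
      (by fun_prop)
    rw [hn, sub_self]
    exact h0
  · have hev : f =ᶠ[𝓝 σ] fun σ => thetaSeries T σ / (cexp σ - 1) := by
      have : ∀ᶠ z in 𝓝 σ, cexp z ≠ 1 := Complex.continuous_exp.continuousAt.eventually_ne h
      filter_upwards [this] with z hz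
      simp [hf, hz]
    refine DifferentiableAt.congr_of_eventuallyEq ?_ hev
    exact (hS σ).div (by fun_prop) (sub_ne_zero.2 h)

include hp hp0 hT hpT in
-- The zero at `exp σ = 1` is removed from both functions. The cofactor `g` of the product has no
-- zero for `|Re σ| < τ.re = log (1 / |p|)`, a strip twice as wide as the period, and `f / g` is
-- doubly periodic there, hence constant.
theorem exists_theta_exp_eq : ∃ C : ℂ, ∀ σ, theta p (cexp σ) = C * thetaSeries T σ := by
  have hpre : 0 < (-(2 * Real.pi * I * T)).re := by
    rw [neg_re, re_two_pi_I_mul, neg_neg]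
    positivity
  have hnp : ‖p‖ = Real.exp (-(-(2 * Real.pi * I * T)).re) := by
    rw [← hpT, Complex.norm_exp, neg_re, neg_neg]
  set τ : ℂ := -(2 * Real.pi * I * T) with hτ
  have hτp : cexp τ = p⁻¹ := by rw [hτ, Complex.exp_neg, hpT]
  set f : ℂ → ℂ := fun σ => if cexp σ = 1 then deriv (thetaSeries T) 0 else
      thetaSeries T σ / (cexp σ - 1) with hf
  set g : ℂ → ℂ := fun σ => qPoch (p * cexp σ) p * qPoch (p * (cexp σ)⁻¹) p with hg
  have hgθ : ∀ σ, theta p (cexp σ) = (1 - cexp σ) * g σ := by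
    intro σ
    rw [theta, qPoch_eq hp, hg]
    simp only [div_eq_mul_inv]
    ring
  have hSf : ∀ σ, thetaSeries T σ = (cexp σ - 1) * f σ := by
    intro σ
    by_cases h : cexp σ = 1
    · obtain ⟨n, hn⟩ := Complex.exp_eq_one_iff.1 h
      have := (thetaSeries_periodic (T := T)).int_mul n 0
      rw [zero_add, ← hn, thetaSeries_zero] at this
      rw [this, h]
      simp
    · simp only [hf, if_neg h]
      have := sub_ne_zero.2 h
      field_simp
  have hg0 : ∀ σ : ℂ, -τ.re < σ.re ∧ σ.re < τ.re → g σ ≠ 0 := by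
    intro σ hσ
    refine mul_ne_zero (qPoch_ne_zero hp ?_) (qPoch_ne_zero hp ?_)
    · rw [norm_mul, hnp, Complex.norm_exp, ← Real.exp_add, Real.exp_lt_one_iff]
      linarith
    · rw [norm_mul, hnp, norm_inv, Complex.norm_exp, ← Real.exp_neg, ← Real.exp_add,
        Real.exp_lt_one_iff]
      linarith
  have hgd : Differentiable ℂ g := by
    have h := differentiable_qPoch hp
    intro σ
    exact ((h _).comp σ (f := fun σ => p * cexp σ) (by fun_prop)).mul
      ((h _).comp σ (f := fun σ => p * (cexp σ)⁻¹)
        ((differentiableAt_const _).mul (Complex.differentiableAt_exp.inv (Complex.exp_ne_zero _))))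
  have hconst : ∀ σ : ℂ, -τ.re < σ.re ∧ σ.re < τ.re → f σ / g σ = f 0 / g 0 := by
    intro σ hσ
    refine eq_of_periodic_of_differentiableOn_strip (A := -τ.re) (B := τ.re)
      (f := fun σ => f σ / g σ) (τ := τ) ?_ ?_ hpre (by linarith) ?_ hσ (by simpa using hpre)
    · exact (differentiable_thetaSeries_div hT).differentiableOn.div hgd.differentiableOn hg0
    · intro σ
      simp only [hf, hg, Complex.exp_periodic σ, thetaSeries_periodic σ]
    · intro σ h1 h2
      -- When `σ` and `σ + τ` both lie in the strip, they are on opposite sides of the imaginary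
      -- axis, so neither exponential is `1`.
      have hne : ∀ z : ℂ, z.re ≠ 0 → cexp z ≠ 1 := by
        intro z hz h
        have := congrArg norm h
        rw [Complex.norm_exp, norm_one, Real.exp_eq_one_iff] at this
        exact hz this
      have e1 : cexp σ ≠ 1 := hne _ (by linarith)
      have e2 : cexp (σ + τ) ≠ 1 := hne _ (by rw [add_re]; linarith)
      have hg1 := hg0 σ ⟨h1, by linarith⟩
      have hg2 := hg0 (σ + τ) ⟨by rw [add_re]; linarith, by rwa [add_re]⟩
      have t1 : thetaSeries T σ = -cexp (-(σ + τ)) * thetaSeries T (σ + τ) := by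
        rw [← thetaSeries_add]
        congr 1
        rw [hτ]; ring
      have t2 : theta p (cexp σ) = -cexp (-(σ + τ)) * theta p (cexp (σ + τ)) := by
        have := theta_p_mul hp0 hp (Complex.exp_ne_zero (σ + τ))
        rw [Complex.exp_neg, ← this, Complex.exp_add, hτp]
        congr 1
        field_simp
      rw [hSf, hSf (σ + τ)] at t1
      rw [hgθ, hgθ (σ + τ)] at t2
      have e1' := sub_ne_zero.2 e1
      have e2' := sub_ne_zero.2 e2
      have hE := Complex.exp_ne_zero (-(σ + τ))
      rw [div_eq_div_iff hg2 hg1]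
      have hx : (cexp σ - 1) * (-cexp (-(σ + τ)) * (cexp (σ + τ) - 1)) ≠ 0 := by
        refine mul_ne_zero e1' (mul_ne_zero (neg_ne_zero.2 hE) e2')
      apply mul_left_cancel₀ hx
      linear_combination (-(cexp σ - 1) * g σ) * t1 + (-(cexp σ - 1) * f σ) * t2
  set c := f 0 / g 0
  have hS : ∀ σ, thetaSeries T σ = -c * theta p (cexp σ) := by
    have h1 : AnalyticOnNhd ℂ (thetaSeries T) Set.univ :=
      (differentiable_thetaSeries hT).differentiableOn.analyticOnNhd isOpen_univ
    have hθd : Differentiable ℂ fun σ => -c * theta p (cexp σ) := fun σ =>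
      (differentiableAt_const _).mul
        ((differentiableAt_theta hp (Complex.exp_ne_zero σ)).comp σ Complex.differentiableAt_exp)
    have h2 : AnalyticOnNhd ℂ (fun σ => -c * theta p (cexp σ)) Set.univ :=
      hθd.differentiableOn.analyticOnNhd isOpen_univ
    refine fun σ => congrFun (h1.eq_of_eventuallyEq h2 (z₀ := 0) ?_) σ
    filter_upwards [(isOpen_strip (-τ.re) τ.re).mem_nhds (x := 0) (by simpa using hpre)] with σ hσ
    have := hconst σ hσ
    rw [div_eq_iff (hg0 σ hσ)] at this
    rw [hSf, hgθ, this]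
    ring
  have hc : c ≠ 0 := by
    intro h
    obtain ⟨σ, hσ⟩ := exists_thetaSeries_ne_zero hT
    exact hσ (by rw [hS, h]; simp)
  exact ⟨-c⁻¹, fun σ => by rw [hS]; field_simp⟩

end product

/-! ### The addition formula -/

/-- The series `∑ p^{k²} x^{2k}` with `p = exp (2πiT)`, `x = exp σ`. -/
noncomputable def evenSeries (T σ : ℂ) : ℂ :=
  ∑' k : ℤ, cexp (2 * k * σ + 2 * Real.pi * I * T * k ^ 2)

/-- The series `∑ p^{k²-k} x^{2k-1}` with `p = exp (2πiT)`, `x = exp σ`. -/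
noncomputable def oddSeries (T σ : ℂ) : ℂ :=
  ∑' k : ℤ, cexp ((2 * k - 1) * σ + 2 * Real.pi * I * T * (k ^ 2 - k))

section addition

variable {T : ℂ} (hT : 0 < T.im)

include hT

theorem summable_norm_evenSeries (σ : ℂ) :
    Summable fun k : ℤ => ‖cexp (2 * k * σ + 2 * Real.pi * I * T * k ^ 2)‖ := by
  have h := ((summable_jacobiTheta₂_term_iff (2 * σ / (2 * Real.pi * I)) (2 * T)).2
    (by simpa using hT)).norm
  refine h.congr fun k => ?_
  rw [jacobiTheta₂_term]
  congr 2
  have := two_pi_I_ne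
  field_simp

theorem summable_norm_oddSeries (σ : ℂ) :
    Summable fun k : ℤ => ‖cexp ((2 * k - 1) * σ + 2 * Real.pi * I * T * (k ^ 2 - k))‖ := by
  have h := ((summable_jacobiTheta₂_term_iff (2 * σ / (2 * Real.pi * I) - T) (2 * T)).2
    (by simpa using hT)).norm
  refine (h.mul_left ‖cexp (-σ)‖).congr fun k => ?_
  rw [jacobiTheta₂_term, ← norm_mul, ← Complex.exp_add]
  congr 2
  have := two_pi_I_ne
  field_simp
  ring

theorem hasSum_thetaSeries (σ : ℂ) :
    HasSum (fun n : ℤ => cexp (n * σ + Real.pi * I * n + Real.pi * I * T * (n ^ 2 - n)))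
      (thetaSeries T σ) := by
  have h := hasSum_jacobiTheta₂_term (σ / (2 * Real.pi * I) + 1 / 2 - T / 2) hT
  rw [thetaSeries]
  convert h using 2 with n
  rw [jacobiTheta₂_term]
  congr 1
  have := two_pi_I_ne
  field_simp
  ring

/-- The double series over `(m, n)` splits by the parity of `m + n`. Putting `m = k + l` and `n = k
- l`, or `n = k - l + 1`, separates `σ` from `ρ` in the exponent; the odd half carries the sign
`-1`. -/
theorem thetaSeries_mul_thetaSeries (σ ρ : ℂ) :
    cexp (-σ) * (thetaSeries T (σ + ρ) * thetaSeries T (σ - ρ)) =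
      oddSeries T σ * evenSeries T ρ - evenSeries T σ * oddSeries T ρ := by
  have hmul : ∀ {u v : ℤ → ℂ} {a b : ℂ}, HasSum u a → HasSum v b →
      HasSum (fun mn : ℤ × ℤ => u mn.1 * v mn.2) (a * b) := fun hu hv =>
    hu.mul hv (summable_mul_of_summable_norm hu.summable.norm hv.summable.norm)
  set F : ℤ × ℤ → ℂ := fun mn => cexp (-σ) *
    (cexp (mn.1 * (σ + ρ) + Real.pi * I * mn.1 + Real.pi * I * T * (mn.1 ^ 2 - mn.1)) *
      cexp (mn.2 * (σ - ρ) + Real.pi * I * mn.2 + Real.pi * I * T * (mn.2 ^ 2 - mn.2))) with hF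
  have hsum : HasSum F (cexp (-σ) * (thetaSeries T (σ + ρ) * thetaSeries T (σ - ρ))) :=
    (hmul (hasSum_thetaSeries hT (σ + ρ)) (hasSum_thetaSeries hT (σ - ρ))).mul_left _
  set i₁ : ℤ × ℤ → ℤ × ℤ := fun kl => (kl.1 + kl.2, kl.1 - kl.2)
  set i₂ : ℤ × ℤ → ℤ × ℤ := fun kl => (kl.1 + kl.2, kl.1 - kl.2 + 1)
  have hi₁ : Function.Injective i₁ := by
    rintro ⟨a, b⟩ ⟨c, d⟩ h
    simp only [i₁, Prod.mk.injEq] at h ⊢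
    omega
  have hi₂ : Function.Injective i₂ := by
    rintro ⟨a, b⟩ ⟨c, d⟩ h
    simp only [i₂, Prod.mk.injEq] at h ⊢
    omega
  have hcompl : IsCompl (Set.range i₁) (Set.range i₂) := by
    rw [← compl_eq_iff_isCompl]
    ext ⟨m, n⟩
    simp only [Set.mem_compl_iff, Set.mem_range, Prod.exists, i₁, i₂, Prod.mk.injEq]
    constructor
    · intro h
      rcases Int.even_or_odd (m + n) with ⟨k, hk⟩ | ⟨k, hk⟩
      · exact absurd ⟨k, m - k, by omega, by omega⟩ h
      · exact ⟨k, m - k, by omega, by omega⟩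
    · rintro ⟨a, b, h1, h2⟩ ⟨c, d, h3, h4⟩
      omega
  have s₁ : HasSum (F ∘ i₁) (oddSeries T σ * evenSeries T ρ) := by
    have h := hmul (summable_norm_oddSeries hT σ).of_norm.hasSum
      (summable_norm_evenSeries hT ρ).of_norm.hasSum
    refine Eq.subst (motive := fun G => HasSum G _) (funext fun kl => ?_) h
    obtain ⟨k, l⟩ := kl
    simp only [Function.comp, hF, i₁]
    rw [← Complex.exp_add, ← Complex.exp_add, ← Complex.exp_add,
      Complex.exp_eq_exp_iff_exists_int]
    -- The sign is encoded as `exp (πi(m + n))`, here `exp (2πik)`, so the exponents differ by a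
    -- multiple of `2πi`.
    exact ⟨-k, by push_cast; ring⟩
  have s₂ : HasSum (F ∘ i₂) (-(evenSeries T σ * oddSeries T ρ)) := by
    have h := (hmul (summable_norm_evenSeries hT σ).of_norm.hasSum
      (summable_norm_oddSeries hT ρ).of_norm.hasSum).neg
    refine Eq.subst (motive := fun G => HasSum G _) (funext fun kl => ?_) h
    obtain ⟨k, l⟩ := kl
    simp only [Function.comp, hF, i₂]
    rw [neg_eq_neg_one_mul, ← Complex.exp_pi_mul_I, ← Complex.exp_add, ← Complex.exp_add,
      ← Complex.exp_add, ← Complex.exp_add, Complex.exp_eq_exp_iff_exists_int]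
    exact ⟨-k, by push_cast; ring⟩
  have h₁ : HasSum (F ∘ (↑) : Set.range i₁ → ℂ) _ := hi₁.hasSum_range_iff.2 s₁
  have h₂ : HasSum (F ∘ (↑) : Set.range i₂ → ℂ) _ := hi₂.hasSum_range_iff.2 s₂
  rw [hsum.unique (h₁.add_isCompl hcompl h₂), sub_eq_add_neg]

end addition

/-! ### The determinant form of the addition formula and the three-term relation. -/

section identities

variable {p : ℂ} (hp0 : p ≠ 0) (hp : ‖p‖ < 1)

include hp0 hp

theorem exists_theta_addition : ∃ a b : ℂ → ℂ, ∀ σ ρ : ℂ,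
    cexp (-σ) * (theta p (cexp (σ + ρ)) * theta p (cexp (σ - ρ))) = a σ * b ρ - b σ * a ρ := by
  -- Chosen so that `exp (2πiT) = p`; then `|p| < 1` gives `Im T > 0`.
  set T : ℂ := Complex.log p / (2 * Real.pi * I) with hTdef
  have hlog : 2 * Real.pi * I * T = Complex.log p := by
    rw [hTdef, mul_div_cancel₀ _ two_pi_I_ne]
  have hpT : cexp (2 * Real.pi * I * T) = p := by rw [hlog, Complex.exp_log hp0]
  have hT : 0 < T.im := by
    have h1 := re_two_pi_I_mul T
    rw [hlog, Complex.log_re] at h1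
    have h2 := Real.log_neg (norm_pos_iff.2 hp0) hp
    have := Real.pi_pos
    by_contra! h
    nlinarith
  obtain ⟨C, hC⟩ := exists_theta_exp_eq hp hp0 hT hpT
  refine ⟨fun σ => C * oddSeries T σ, fun σ => C * evenSeries T σ, fun σ ρ => ?_⟩
  rw [hC, hC]
  linear_combination C ^ 2 * thetaSeries_mul_thetaSeries hT σ ρ

/-- The three-term relation for the functions `y ↦ θ(s y) θ(t y)` at three points. -/
theorem theta_three_term {s t x y z : ℂ} (hs : s ≠ 0) (ht : t ≠ 0) (hx : x ≠ 0) (hy : y ≠ 0)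
    (hz : z ≠ 0) :
    y * theta p (s * t * x * y) * theta p (x / y) * (theta p (s * z) * theta p (t * z)) +
      z * theta p (s * t * y * z) * theta p (y / z) * (theta p (s * x) * theta p (t * x)) +
      x * theta p (s * t * z * x) * theta p (z / x) * (theta p (s * y) * theta p (t * y)) = 0 := by
  obtain ⟨a, b, hab⟩ := exists_theta_addition hp0 hp
  obtain ⟨s', rfl⟩ : ∃ w, cexp w = s := ⟨_, Complex.exp_log hs⟩
  obtain ⟨t', rfl⟩ : ∃ w, cexp w = t := ⟨_, Complex.exp_log ht⟩
  obtain ⟨x', rfl⟩ : ∃ w, cexp w = x := ⟨_, Complex.exp_log hx⟩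
  obtain ⟨y', rfl⟩ : ∃ w, cexp w = y := ⟨_, Complex.exp_log hy⟩
  obtain ⟨z', rfl⟩ : ∃ w, cexp w = z := ⟨_, Complex.exp_log hz⟩
  -- With `s = exp (μ + ν)` and `t = exp (μ - ν)`, the products `θ(sw)θ(tw)` and `θ(stww')θ(w/w')`
  -- are, up to exponentials, 2×2 determinants of the vectors `(a, b)` at `μ + w`, `μ + w'` and `ν`.
  set μ := (s' + t') / 2 with hμ
  set ν := (s' - t') / 2 with hν
  have e1 : ∀ w, a (μ + w) * b ν - b (μ + w) * a ν =
      cexp (-(μ + w)) * (theta p (cexp s' * cexp w) * theta p (cexp t' * cexp w)) := by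
    intro w
    rw [← hab, ← Complex.exp_add, ← Complex.exp_add]
    congr 4 <;> rw [hμ, hν] <;> ring
  have e2 : ∀ w w', a (μ + w) * b (μ + w') - b (μ + w) * a (μ + w') =
      cexp (-(μ + w)) *
        (theta p (cexp s' * cexp t' * cexp w * cexp w') * theta p (cexp w / cexp w')) := by
    intro w w'
    rw [← hab, ← Complex.exp_add, ← Complex.exp_add, ← Complex.exp_add, ← Complex.exp_sub]
    congr 4 <;> rw [hμ] <;> ring
  -- The Plücker relation for four vectors in the plane.
  have key : (a (μ + x') * b (μ + y') - b (μ + x') * a (μ + y')) *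
        (a (μ + z') * b ν - b (μ + z') * a ν) +
      (a (μ + y') * b (μ + z') - b (μ + y') * a (μ + z')) *
        (a (μ + x') * b ν - b (μ + x') * a ν) +
      (a (μ + z') * b (μ + x') - b (μ + z') * a (μ + x')) *
        (a (μ + y') * b ν - b (μ + y') * a ν) = 0 := by ring
  rw [e1, e1, e1, e2, e2, e2] at key
  simp only [neg_add, Complex.exp_add, Complex.exp_neg] at key
  have h0 := Complex.exp_ne_zero
  have := h0 μ; have := h0 x'; have := h0 y'; have := h0 z'
  field_simp at key ⊢
  linear_combination key

/-- The three-term relation at the points `z`, `z⁻¹`, `s₃`. -/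
theorem theta_four_params {s₁ s₂ s₃ z : ℂ} (h1 : s₁ ≠ 0) (h2 : s₂ ≠ 0) (h3 : s₃ ≠ 0) (hz : z ≠ 0) :
    z ^ 2 * (theta p (s₁ / z) * theta p (s₂ / z) * theta p (s₃ / z) * theta p (s₁ * s₂ * s₃ * z)) -
      theta p (s₁ * z) * theta p (s₂ * z) * theta p (s₃ * z) * theta p (s₁ * s₂ * s₃ / z) =
    -(theta p (z ^ 2) * theta p (s₁ * s₂) * theta p (s₁ * s₃) * theta p (s₂ * s₃)) := by
  have h := theta_three_term hp0 hp h1 h2 hz (inv_ne_zero hz) h3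
  rw [show s₁ * s₂ * z * z⁻¹ = s₁ * s₂ by field_simp, show z / z⁻¹ = z ^ 2 by field_simp,
    show s₁ * s₂ * z⁻¹ * s₃ = s₁ * s₂ * s₃ / z by field_simp,
    theta_inv_eq hp (z := s₃ * z) (w := z⁻¹ / s₃) (by positivity) (by field_simp),
    show s₁ * s₂ * s₃ * z = s₁ * s₂ * s₃ * z by rfl, ← div_eq_mul_inv s₁, ← div_eq_mul_inv s₂] at h
  field_simp at h ⊢
  linear_combination h

end identities

section sixParams

variable {p : ℂ} (hp0 : p ≠ 0) (hp : ‖p‖ < 1)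

include hp0 hp

/-- The theta function identity behind the difference equation of the elliptic beta integral. -/
theorem theta_six_params {t₁ t₂ t₃ t₄ t₅ T z : ℂ} (h1 : t₁ ≠ 0) (h2 : t₂ ≠ 0) (h3 : t₃ ≠ 0)
    (h4 : t₄ ≠ 0) (h5 : t₅ ≠ 0) (hT : T ≠ 0) (hz : z ≠ 0) (hprod : t₁ * t₂ * t₃ * t₄ * t₅ * T = p)
    (hΔ : theta p (T / t₁) ≠ 0) (hm : theta p (t₂ * t₃) ≠ 0)
    (hm' : theta p (t₂ * t₃ * T * t₁) ≠ 0) :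
    t₁ * theta p (T / t₁) *
      (z ^ 3 * (theta p (t₁ / z) * theta p (t₂ / z) * theta p (t₃ / z) * theta p (t₄ / z) *
          theta p (t₅ / z) * theta p (T / z)) -
        z⁻¹ * (theta p (t₁ * z) * theta p (t₂ * z) * theta p (t₃ * z) * theta p (t₄ * z) *
          theta p (t₅ * z) * theta p (T * z))) =
    theta p (z ^ 2) *
      ((theta p (T * t₂) * theta p (T * t₃) * theta p (T * t₄) * theta p (T * t₅)) *
          (theta p (t₁ * z) * theta p (t₁ / z)) -
        (theta p (t₁ * t₂) * theta p (t₁ * t₃) * theta p (t₁ * t₄) * theta p (t₁ * t₅)) *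
          (theta p (T * z) * theta p (T / z))) := by
  set m := t₂ * t₃ with hmdef
  set n := t₄ * t₅ with hndef
  have hm0 : m ≠ 0 := mul_ne_zero h2 h3
  have hn0 : n ≠ 0 := mul_ne_zero h4 h5
  have hmn : m * n * T * t₁ = p := by rw [← hprod, hmdef, hndef]; ring
  -- The three-term relation at `y⁻¹, T, t₁` expands a pair of theta factors in two fixed products.
  -- It is applied to the pairs `t₂, t₃` and `t₄, t₅`, at `z` and at `z⁻¹`.
  have expand : ∀ {s t y : ℂ}, s ≠ 0 → t ≠ 0 → y ≠ 0 →
      t₁ * theta p (s * t * T * t₁) * theta p (T / t₁) * (theta p (s / y) * theta p (t / y)) =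
        y⁻¹ * (theta p (s * t * T / y) * theta p (T * y) * (theta p (s * t₁) * theta p (t * t₁)) -
          theta p (s * t * t₁ / y) * theta p (t₁ * y) * (theta p (s * T) * theta p (t * T))) := by
    intro s t y hs ht hy
    have h := theta_three_term hp0 hp hs ht (inv_ne_zero hy) hT h1
    rw [theta_inv_eq hp (z := T * y) (w := y⁻¹ / T) (by positivity) (by field_simp),
      show s * t * y⁻¹ * T = s * t * T / y by field_simp,
      show s * t * t₁ * y⁻¹ = s * t * t₁ / y by field_simp,
      show t₁ / y⁻¹ = t₁ * y by field_simp, ← div_eq_mul_inv s, ← div_eq_mul_inv t] at h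
    field_simp at h ⊢
    linear_combination h
  have f₁ := expand h2 h3 hz
  have g₁ := expand h4 h5 hz
  have f₂ := expand h2 h3 (inv_ne_zero hz)
  have g₂ := expand h4 h5 (inv_ne_zero hz)
  simp only [div_inv_eq_mul, inv_inv, ← div_eq_mul_inv, ← hmdef, ← hndef] at f₁ g₁ f₂ g₂
  -- The balancing condition with `θ(p/x) = θ(x)` turns the theta values of the second pair into
  -- those of the first.
  have r : ∀ {x y : ℂ}, y ≠ 0 → x * y = p → theta p x = theta p y := by
    intro x y hy h
    rw [← theta_p_div hp0 y, ← h, mul_div_cancel_right₀ _ hy]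
  have r1 : theta p (n * T / z) = theta p (m * t₁ * z) :=
    r (by positivity) (by rw [← hmn]; field_simp)
  have r2 : theta p (n * T * z) = theta p (m * t₁ / z) :=
    r (div_ne_zero (mul_ne_zero hm0 h1) hz) (by rw [← hmn]; field_simp)
  have r3 : theta p (n * t₁ / z) = theta p (m * T * z) :=
    r (by positivity) (by rw [← hmn]; field_simp)
  have r4 : theta p (n * t₁ * z) = theta p (m * T / z) :=
    r (div_ne_zero (mul_ne_zero hm0 hT) hz) (by rw [← hmn]; field_simp)
  have r5 : theta p (n * T * t₁) = theta p m := r hm0 (by rw [← hmn]; ring)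
  rw [r1, r3, r5] at g₁
  rw [r2, r4, r5] at g₂
  have key : z * (theta p (T / z) * theta p (t₁ * z) * theta p (m * t₁ / z) * theta p (m * T * z) -
        theta p (T * z) * theta p (t₁ / z) * theta p (m * T / z) * theta p (m * t₁ * z)) =
      theta p (z ^ 2) * (t₁ * theta p (T / t₁)) * theta p (m * T * t₁) * theta p m := by
    have h := theta_four_params hp0 hp (s₁ := T) (s₂ := m * t₁) (s₃ := t₁⁻¹) (z := z) hT
      (mul_ne_zero hm0 h1) (inv_ne_zero h1) hz
    rw [theta_inv_eq hp (z := t₁ * z) (w := t₁⁻¹ / z) (by positivity) (by field_simp),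
      theta_inv_eq hp (z := t₁ / z) (w := t₁⁻¹ * z) (by positivity) (by field_simp),
      show T * (m * t₁) * t₁⁻¹ = m * T by field_simp, show m * t₁ * t₁⁻¹ = m by field_simp,
      show T * (m * t₁) = m * T * t₁ by ring, show T * t₁⁻¹ = T / t₁ by ring] at h
    generalize theta p (T / t₁) = Δ at *
    generalize theta p (m * T * t₁) = Pm at *
    generalize theta p (m * T * z) = A2 at *
    generalize theta p (m * T / z) = A1 at *
    generalize theta p (m * t₁ / z) = B1 at *
    generalize theta p (m * t₁ * z) = B2 at *
    generalize theta p (t₁ * z) = v at *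
    generalize theta p (t₁ / z) = v' at *
    generalize theta p (T * z) = u at *
    generalize theta p (T / z) = u' at *
    field_simp at h
    linear_combination -h
  have c : theta p m * theta p (m * T * t₁) * (t₁ * theta p (T / t₁)) ≠ 0 :=
    mul_ne_zero (mul_ne_zero hm hm') (mul_ne_zero h1 hΔ)
  apply mul_left_cancel₀ c
  rw [mul_comm T t₂, mul_comm T t₃, mul_comm T t₄, mul_comm T t₅, mul_comm t₁ t₂, mul_comm t₁ t₃,
    mul_comm t₁ t₄, mul_comm t₁ t₅]
  generalize theta p (T / t₁) = Δ at *
  generalize theta p (m * T * t₁) = Pm at *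
  generalize theta p m = Pn at *
  generalize theta p (T * z) = u at *
  generalize theta p (T / z) = u' at *
  generalize theta p (t₁ * z) = v at *
  generalize theta p (t₁ / z) = v' at *
  generalize theta p (m * T / z) = A1 at *
  generalize theta p (m * T * z) = A2 at *
  generalize theta p (m * t₁ / z) = B1 at *
  generalize theta p (m * t₁ * z) = B2 at *
  generalize theta p (z ^ 2) = Z at *
  have e1 := congrArg₂ (· * ·) f₁ g₁
  have e2 := congrArg₂ (· * ·) f₂ g₂
  generalize theta p (t₂ / z) = x1 at *
  generalize theta p (t₃ / z) = x2 at *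
  generalize theta p (t₄ / z) = x3 at *
  generalize theta p (t₅ / z) = x4 at *
  generalize theta p (t₂ * z) = y1 at *
  generalize theta p (t₃ * z) = y2 at *
  generalize theta p (t₄ * z) = y3 at *
  generalize theta p (t₅ * z) = y4 at *
  generalize theta p (t₂ * t₁) = a2 at *
  generalize theta p (t₃ * t₁) = a3 at *
  generalize theta p (t₄ * t₁) = a4 at *
  generalize theta p (t₅ * t₁) = a5 at *
  generalize theta p (t₂ * T) = b2 at *
  generalize theta p (t₃ * T) = b3 at *
  generalize theta p (t₄ * T) = b4 at *
  generalize theta p (t₅ * T) = b5 at *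
  have hzz : z * z⁻¹ = 1 := mul_inv_cancel₀ hz
  -- In the difference of the two products of expansions, the mixed terms `a2 a3 b4 b5` and `b2 b3
  -- a4 a5` cancel, and each of the two pure terms is a multiple of `key`.
  linear_combination z ^ 3 * v' * u' * e1 - z⁻¹ * v * u * e2 +
    (v' * u' * (A1 * u * (a2 * a3) - B1 * v * (b2 * b3)) *
      (B2 * u * (a4 * a5) - A2 * v * (b4 * b5)) * z * (z * z⁻¹ + 1) -
    v * u * (A2 * u' * (a2 * a3) - B2 * v' * (b2 * b3)) *
      (B1 * u' * (a4 * a5) - A1 * v' * (b4 * b5)) * z) * hzz +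
    (b2 * b3 * b4 * b5 * v * v' - a2 * a3 * a4 * a5 * u * u') * key

end sixParams

/-! ### Circle integrals depending on parameters -/

section circle

theorem continuousOn_circleIntegral {X : Type*} [TopologicalSpace X] {f : X → ℂ → ℂ} {s : Set X}
    {c : ℂ} {R : ℝ} (hR : 0 ≤ R)
    (hf : ContinuousOn (Function.uncurry f) (s ×ˢ Metric.sphere c R)) :
    ContinuousOn (fun x => ∮ z in C(c, R), f x z) s := by
  rw [continuousOn_iff_continuous_domRestrict]
  have h : Continuous fun y : s × ℝ => f y.1 (circleMap c R y.2) := by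
    refine hf.comp_continuous (f := fun y : s × ℝ => ((y.1 : X), circleMap c R y.2))
      (by fun_prop) ?_
    rintro ⟨x, θ⟩
    exact ⟨x.2, circleMap_mem_sphere c hR θ⟩
  unfold circleIntegral
  simp only [deriv_circleMap]
  refine intervalIntegral.continuous_parametric_intervalIntegral_of_continuous' ?_ _ _
  exact (by fun_prop : Continuous fun y : s × ℝ => circleMap 0 R y.2 * I).smul h

theorem circleIntegral_swap {f : ℂ → ℂ → ℂ} {c c' : ℂ} {R R' : ℝ} (hR : 0 ≤ R) (hR' : 0 ≤ R')
    (hf : ContinuousOn (Function.uncurry f) (Metric.sphere c R ×ˢ Metric.sphere c' R')) :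
    (∮ z in C(c, R), ∮ w in C(c', R'), f z w) = ∮ w in C(c', R'), ∮ z in C(c, R), f z w := by
  have h : Continuous fun y : ℝ × ℝ => f (circleMap c R y.1) (circleMap c' R' y.2) := by
    refine hf.comp_continuous (f := fun y : ℝ × ℝ => (circleMap c R y.1, circleMap c' R' y.2))
      (by fun_prop) ?_
    rintro ⟨x, θ⟩
    exact ⟨circleMap_mem_sphere c hR x, circleMap_mem_sphere c' hR' θ⟩
  unfold circleIntegral
  simp only [deriv_circleMap, ← intervalIntegral.integral_smul]
  rw [intervalIntegral_intervalIntegral_swap]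
  · exact intervalIntegral.integral_congr fun y _ => intervalIntegral.integral_congr fun x _ =>
      smul_comm _ _ _
  · have hc : Continuous (Function.uncurry fun x y : ℝ => (circleMap 0 R x * I) •
        (circleMap 0 R' y * I) • f (circleMap c R x) (circleMap c' R' y)) :=
      (by fun_prop : Continuous fun y : ℝ × ℝ => circleMap 0 R y.1 * I).smul
        ((by fun_prop : Continuous fun y : ℝ × ℝ => circleMap 0 R' y.2 * I).smul h)
    exact (hc.continuousOn.integrableOn_compact (isCompact_uIcc.prod isCompact_uIcc)).mono_set
      (Set.prod_mono Set.uIoc_subset_uIcc Set.uIoc_subset_uIcc)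

/-- Cauchy's formula in `σ` and an exchange of integrals express the function as the Cauchy integral
of its own continuous boundary values, which is analytic. -/
theorem differentiableOn_circleIntegral {f : ℂ → ℂ → ℂ} {U : Set ℂ} (hU : IsOpen U) {c : ℂ} {R : ℝ}
    (hR : 0 ≤ R) (hf : ContinuousOn (Function.uncurry f) (U ×ˢ Metric.sphere c R))
    (hd : ∀ z ∈ Metric.sphere c R, DifferentiableOn ℂ (fun σ => f σ z) U) :
    DifferentiableOn ℂ (fun σ => ∮ z in C(c, R), f σ z) U := by
  intro σ₀ hσ₀
  obtain ⟨r, hr, hrU⟩ := Metric.nhds_basis_closedBall.mem_iff.1 (hU.mem_nhds hσ₀)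
  have hcont := continuousOn_circleIntegral hR hf
  have hcs : CircleIntegrable (fun σ => ∮ z in C(c, R), f σ z) σ₀ r :=
    (hcont.mono (Metric.sphere_subset_closedBall.trans hrU)).circleIntegrable hr.le
  lift r to NNReal using hr.le
  have hps := hasFPowerSeriesOn_cauchy_integral hcs (by exact_mod_cast hr)
  have hdiff := hps.analyticAt.differentiableAt
  refine (hdiff.congr_of_eventuallyEq ?_).differentiableWithinAt
  filter_upwards [Metric.ball_mem_nhds σ₀ hr] with σ hσ
  have hne : ∀ ζ ∈ Metric.sphere σ₀ (r : ℝ), ζ - σ ≠ 0 := by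
    intro ζ hζ h
    rw [sub_eq_zero] at h
    subst h
    rw [Metric.mem_sphere] at hζ
    rw [Metric.mem_ball] at hσ
    linarith
  have h1 : (∮ ζ in C(σ₀, r), (ζ - σ)⁻¹ • ∮ z in C(c, R), f ζ z) =
      ∮ z in C(c, R), ∮ ζ in C(σ₀, r), (ζ - σ)⁻¹ • f ζ z := by
    rw [← circleIntegral_swap (f := fun ζ z => (ζ - σ)⁻¹ • f ζ z) hr.le hR]
    · refine circleIntegral.integral_congr hr.le fun ζ _ => ?_
      simp only [smul_eq_mul, circleIntegral.integral_const_mul]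
    · refine ContinuousOn.smul (ContinuousOn.inv₀ (by fun_prop) fun y hy => hne _ hy.1)
        (hf.mono (Set.prod_mono (Metric.sphere_subset_closedBall.trans hrU) subset_rfl))
  rw [h1, ← circleIntegral.integral_smul]
  refine circleIntegral.integral_congr hR fun z hz => ?_
  exact (((hd z hz).mono hrU).diffContOnCl_ball
    subset_rfl).two_pi_i_inv_smul_circleIntegral_sub_inv_smul hσ |>.symm

/-- The argument of `a` only translates the angle, which is harmless over a full period. -/
theorem circleIntegral_comp_mul (f : ℂ → ℂ) (a : ℂ) (R : ℝ) :
    (∮ z in C(0, R), f (a * z) * a) = ∮ z in C(0, ‖a‖ * R), f z := by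
  have hmap : ∀ θ : ℝ, a * circleMap 0 R θ = circleMap 0 (‖a‖ * R) (θ + a.arg) := by
    intro θ
    simp only [circleMap, zero_add]
    conv_lhs => rw [← Complex.norm_mul_exp_arg_mul_I a]
    push_cast
    rw [add_mul, Complex.exp_add]
    ring
  unfold circleIntegral
  simp only [deriv_circleMap, smul_eq_mul]
  set F : ℝ → ℂ := fun θ => circleMap 0 (‖a‖ * R) θ * I * f (circleMap 0 (‖a‖ * R) θ) with hF
  have hper : Function.Periodic F (2 * Real.pi) := by
    intro θ
    simp only [hF, periodic_circleMap 0 (‖a‖ * R) θ]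
  have h1 : (fun θ : ℝ => circleMap 0 R θ * I * (f (a * circleMap 0 R θ) * a)) =
      fun θ => F (θ + a.arg) := by
    ext θ
    rw [hF]
    simp only
    rw [← hmap]
    ring
  rw [h1, intervalIntegral.integral_comp_add_right F, zero_add, add_comm,
    hper.intervalIntegral_add_eq a.arg 0, zero_add]

theorem circleIntegral_comp_mul_eq {g : ℂ → ℂ} {a : ℂ} (ha : 1 ≤ ‖a‖)
    (hg : ∀ z : ℂ, 1 ≤ ‖z‖ → ‖z‖ ≤ ‖a‖ → DifferentiableAt ℂ g z) :
    (∮ z in C(0, 1), g (a * z) * a) = ∮ z in C(0, 1), g z := by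
  rw [circleIntegral_comp_mul, mul_one]
  refine circleIntegral_eq_of_differentiable_on_annulus_off_countable one_pos ha
    Set.countable_empty (fun z hz => (hg z ?_ ?_).continuousAt.continuousWithinAt)
    fun z hz => hg z ?_ ?_
  · simpa using hz.2
  · simpa using hz.1
  · have := hz.1.2; simp at this; exact this.le
  · have := hz.1.1; simp at this; exact this.le

end circle

/-! ### The elliptic beta integral: definitions and analyticity -/

theorem norm_mul_lt_one {a b : ℂ} (ha : ‖a‖ < 1) (hb : ‖b‖ < 1) : ‖a * b‖ < 1 := by
  rw [norm_mul]
  exact mul_lt_one_of_nonneg_of_lt_one_left (norm_nonneg a) ha hb.le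

theorem norm_mul_lt_one_of_norm_eq_one {a z : ℂ} (ha : ‖a‖ < 1) (hz : ‖z‖ = 1) : ‖a * z‖ < 1 := by
  rwa [norm_mul, hz, mul_one]

theorem norm_inv_eq_one {z : ℂ} (hz : ‖z‖ = 1) : ‖z⁻¹‖ = 1 := by
  rw [norm_inv, hz, inv_one]

theorem ne_zero_of_norm_eq_one {z : ℂ} (hz : ‖z‖ = 1) : z ≠ 0 :=
  norm_ne_zero_iff.1 (by rw [hz]; exact one_ne_zero)

/-- The factor `1 / Γ(z^{±2})`, for `|z| = 1`. -/
noncomputable def betaKer (p q z : ℂ) : ℂ := theta p (z ^ 2) * theta q (z⁻¹ ^ 2)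

/-- The elliptic beta integral, without the factor `κ`. -/
noncomputable def betaInt (p q : ℂ) (t : Fin 6 → ℂ) : ℂ :=
  ∮ z in C(0, 1), (∏ j, eGammaPM p q (t j) z) * betaKer p q z / z

/-- The product `∏_{j < k} Γ(t_j t_k)`. -/
noncomputable def betaProd (p q : ℂ) (t : Fin 6 → ℂ) : ℂ :=
  ∏ i, ∏ j ∈ Finset.Ioi i, eGamma p q (t i * t j)

/-- The parameter domain of the elliptic beta integral. -/
structure IsBetaParam (p q : ℂ) (t : Fin 6 → ℂ) : Prop where
  ne_zero : ∀ j, t j ≠ 0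
  norm_lt : ∀ j, ‖t j‖ < 1
  prod_eq : ∏ j, t j = p * q

theorem betaProd_vec (p q a b c d e f : ℂ) : betaProd p q ![a, b, c, d, e, f] =
    eGamma p q (a * b) * eGamma p q (a * c) * eGamma p q (a * d) * eGamma p q (a * e) *
      eGamma p q (a * f) * eGamma p q (b * c) * eGamma p q (b * d) * eGamma p q (b * e) *
      eGamma p q (b * f) * eGamma p q (c * d) * eGamma p q (c * e) * eGamma p q (c * f) *
      eGamma p q (d * e) * eGamma p q (d * f) * eGamma p q (e * f) := by
  have h0 : Finset.Ioi (0 : Fin 6) = {1, 2, 3, 4, 5} := by decide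
  have h1 : Finset.Ioi (1 : Fin 6) = {2, 3, 4, 5} := by decide
  have h2 : Finset.Ioi (2 : Fin 6) = {3, 4, 5} := by decide
  have h3 : Finset.Ioi (3 : Fin 6) = {4, 5} := by decide
  have h4 : Finset.Ioi (4 : Fin 6) = {5} := by decide
  have h5 : Finset.Ioi (5 : Fin 6) = ∅ := by decide
  rw [betaProd, Fin.prod_univ_six, h0, h1, h2, h3, h4, h5]
  simp [-mul_eq_mul_left_iff, -mul_eq_mul_right_iff]
  ring

theorem isBetaParam_vec {p q a b c d e f : ℂ} : IsBetaParam p q ![a, b, c, d, e, f] ↔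
    (a ≠ 0 ∧ b ≠ 0 ∧ c ≠ 0 ∧ d ≠ 0 ∧ e ≠ 0 ∧ f ≠ 0) ∧
    (‖a‖ < 1 ∧ ‖b‖ < 1 ∧ ‖c‖ < 1 ∧ ‖d‖ < 1 ∧ ‖e‖ < 1 ∧ ‖f‖ < 1) ∧
    a * b * c * d * e * f = p * q := by
  constructor
  · rintro ⟨h1, h2, h3⟩
    exact ⟨⟨h1 0, h1 1, h1 2, h1 3, h1 4, h1 5⟩, ⟨h2 0, h2 1, h2 2, h2 3, h2 4, h2 5⟩,
      by simpa [Fin.prod_univ_six] using h3⟩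
  · rintro ⟨h1, h2, h3⟩
    refine ⟨?_, ?_, ?_⟩
    · simpa [Fin.forall_fin_succ] using h1
    · simpa [Fin.forall_fin_succ] using h2
    · simpa [Fin.prod_univ_six] using h3

section

variable {p q : ℂ} (hp0 : p ≠ 0) (hp : ‖p‖ < 1) (hq0 : q ≠ 0) (hq : ‖q‖ < 1)

/-- `pq / (tᵢtⱼ)` is the product of the other four parameters. Hence `Γ(tᵢtⱼ)` has no zero on the
parameter domain. -/
theorem IsBetaParam.norm_div_lt {t : Fin 6 → ℂ} (ht : IsBetaParam p q t) {i j : Fin 6}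
    (hij : i ≠ j) : ‖p * q / (t i * t j)‖ < 1 := by
  have hi := ht.ne_zero i
  have hj := ht.ne_zero j
  have h1 : ∏ k, t k = t i * (t j * ∏ k ∈ (Finset.univ.erase i).erase j, t k) := by
    rw [Finset.mul_prod_erase (Finset.univ.erase i) t (by simp [hij.symm]),
      Finset.mul_prod_erase Finset.univ t (by simp)]
  rw [← ht.prod_eq, h1, ← mul_assoc, mul_div_cancel_left₀ _ (mul_ne_zero hi hj), norm_prod]
  obtain ⟨k, hk⟩ : ((Finset.univ.erase i).erase j).Nonempty := by
    rw [← Finset.card_pos, Finset.card_erase_of_mem (by simp [hij.symm]),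
      Finset.card_erase_of_mem (by simp)]
    simp
  rw [← Finset.mul_prod_erase _ _ hk]
  exact mul_lt_one_of_nonneg_of_lt_one_left (norm_nonneg _) (ht.norm_lt k)
    (Finset.prod_le_one (fun _ _ => norm_nonneg _) fun k _ => (ht.norm_lt k).le)

section

include hp hq

theorem betaProd_ne_zero {t : Fin 6 → ℂ} (ht : IsBetaParam p q t) : betaProd p q t ≠ 0 := by
  refine Finset.prod_ne_zero_iff.2 fun i _ => Finset.prod_ne_zero_iff.2 fun j hj => ?_
  exact eGamma_ne_zero hp hq (norm_mul_lt_one (ht.norm_lt i) (ht.norm_lt j))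
    (ht.norm_div_lt (Finset.mem_Ioi.1 hj).ne)

theorem continuousAt_betaKer {z : ℂ} (hz : z ≠ 0) : ContinuousAt (betaKer p q) z := by
  have h1 := continuousAt_theta hp (pow_ne_zero 2 hz)
  have h2 := continuousAt_theta hq (pow_ne_zero 2 (inv_ne_zero hz))
  refine ContinuousAt.mul ?_ ?_
  · exact ContinuousAt.comp (f := fun z : ℂ => z ^ 2) h1 (by fun_prop)
  · exact ContinuousAt.comp (f := fun z : ℂ => z⁻¹ ^ 2) h2 ((continuousAt_inv₀ hz).pow 2)

theorem continuousOn_eGamma_comp {X : Type*} [TopologicalSpace X] {f : X → ℂ} {s : Set X}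
    (hf : ContinuousOn f s) (h0 : ∀ x ∈ s, f x ≠ 0) (h1 : ∀ x ∈ s, ‖f x‖ < 1) :
    ContinuousOn (fun x => eGamma p q (f x)) s := fun x hx =>
  (continuousAt_eGamma hp hq (h0 x hx) (h1 x hx)).comp_continuousWithinAt (hf x hx)

theorem continuousOn_eGammaPM_comp {X : Type*} [TopologicalSpace X] {t z : X → ℂ} {s : Set X}
    (ht : ContinuousOn t s) (hz : ContinuousOn z s) (ht0 : ∀ x ∈ s, t x ≠ 0)
    (ht1 : ∀ x ∈ s, ‖t x‖ < 1) (hz1 : ∀ x ∈ s, ‖z x‖ = 1) :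
    ContinuousOn (fun x => eGammaPM p q (t x) (z x)) s := by
  have hz0 : ∀ x ∈ s, z x ≠ 0 := fun x hx => ne_zero_of_norm_eq_one (hz1 x hx)
  refine ContinuousOn.mul (continuousOn_eGamma_comp hp hq (ht.mul hz) ?_ ?_)
    (continuousOn_eGamma_comp hp hq (ht.mul (hz.inv₀ hz0)) ?_ ?_)
  · exact fun x hx => mul_ne_zero (ht0 x hx) (hz0 x hx)
  · exact fun x hx => norm_mul_lt_one_of_norm_eq_one (ht1 x hx) (hz1 x hx)
  · exact fun x hx => mul_ne_zero (ht0 x hx) (inv_ne_zero (hz0 x hx))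
  · exact fun x hx => norm_mul_lt_one_of_norm_eq_one (ht1 x hx) (norm_inv_eq_one (hz1 x hx))

theorem continuousOn_betaKer_comp {X : Type*} [TopologicalSpace X] {z : X → ℂ} {s : Set X}
    (hz : ContinuousOn z s) (hz1 : ∀ x ∈ s, ‖z x‖ = 1) :
    ContinuousOn (fun x => betaKer p q (z x)) s := fun x hx =>
  (continuousAt_betaKer hp hq (ne_zero_of_norm_eq_one (hz1 x hx))).comp_continuousWithinAt (hz x hx)

theorem differentiableOn_betaInt {U : Set ℂ} (hU : IsOpen U) {t : ℂ → Fin 6 → ℂ}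
    (ht : ∀ j, DifferentiableOn ℂ (fun σ => t σ j) U) (h0 : ∀ σ ∈ U, ∀ j, t σ j ≠ 0)
    (h1 : ∀ σ ∈ U, ∀ j, ‖t σ j‖ < 1) :
    DifferentiableOn ℂ (fun σ => betaInt p q (t σ)) U := by
  refine differentiableOn_circleIntegral hU zero_le_one ?_ fun z hz => ?_
  · have hz1 : ∀ x ∈ U ×ˢ Metric.sphere (0 : ℂ) 1, ‖x.2‖ = 1 := fun x hx => by simpa using hx.2
    refine ContinuousOn.div (ContinuousOn.mul (continuousOn_finsetProd _ fun j _ => ?_) ?_)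
      continuousOn_snd fun x hx => ne_zero_of_norm_eq_one (hz1 x hx)
    · exact continuousOn_eGammaPM_comp hp hq
        ((ht j).continuousOn.comp continuousOn_fst fun x hx => hx.1) continuousOn_snd
        (fun x hx => h0 _ hx.1 j) (fun x hx => h1 _ hx.1 j) hz1
    · exact continuousOn_betaKer_comp hp hq continuousOn_snd hz1
  · have hz1 : ‖z‖ = 1 := by simpa using hz
    have hz0 := ne_zero_of_norm_eq_one hz1
    refine DifferentiableOn.div_const (DifferentiableOn.mul_const
      (DifferentiableOn.fun_finsetProd fun j _ => ?_) _) _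
    intro σ hσ
    refine DifferentiableWithinAt.mul ?_ ?_
    · exact (differentiableAt_eGamma hp hq (mul_ne_zero (h0 σ hσ j) hz0)
        (norm_mul_lt_one_of_norm_eq_one (h1 σ hσ j) hz1)).comp_differentiableWithinAt σ
        ((ht j σ hσ).mul_const z)
    · exact (differentiableAt_eGamma hp hq (mul_ne_zero (h0 σ hσ j) (inv_ne_zero hz0))
        (norm_mul_lt_one_of_norm_eq_one (h1 σ hσ j)
          (norm_inv_eq_one hz1))).comp_differentiableWithinAt σ ((ht j σ hσ).mul_const z⁻¹)

theorem differentiableOn_betaProd {U : Set ℂ} {t : ℂ → Fin 6 → ℂ}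
    (ht : ∀ j, DifferentiableOn ℂ (fun σ => t σ j) U) (h0 : ∀ σ ∈ U, ∀ j, t σ j ≠ 0)
    (h1 : ∀ σ ∈ U, ∀ j, ‖t σ j‖ < 1) :
    DifferentiableOn ℂ (fun σ => betaProd p q (t σ)) U := by
  refine DifferentiableOn.fun_finsetProd fun i _ => DifferentiableOn.fun_finsetProd fun j _ => ?_
  intro σ hσ
  exact (differentiableAt_eGamma hp hq (mul_ne_zero (h0 σ hσ i) (h0 σ hσ j))
    (norm_mul_lt_one (h1 σ hσ i) (h1 σ hσ j))).comp_differentiableWithinAt σ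
    ((ht i σ hσ).mul (ht j σ hσ))

/-- The quotient of the two sides of the elliptic beta integral is holomorphic along holomorphic
families of parameters. -/
theorem differentiableOn_betaInt_div_betaProd {U : Set ℂ} (hU : IsOpen U) {t : ℂ → Fin 6 → ℂ}
    (ht : ∀ j, DifferentiableOn ℂ (fun σ => t σ j) U) (h : ∀ σ ∈ U, IsBetaParam p q (t σ)) :
    DifferentiableOn ℂ (fun σ => betaInt p q (t σ) / betaProd p q (t σ)) U :=
  (differentiableOn_betaInt hp hq hU ht (fun σ hσ => (h σ hσ).ne_zero)
    fun σ hσ => (h σ hσ).norm_lt).div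
    (differentiableOn_betaProd hp hq ht (fun σ hσ => (h σ hσ).ne_zero)
      fun σ hσ => (h σ hσ).norm_lt) fun σ hσ => betaProd_ne_zero hp hq (h σ hσ)

end

end

/-! ### The difference equation -/

section

variable {p q : ℂ} (hp0 : p ≠ 0) (hp : ‖p‖ < 1) (hq0 : q ≠ 0) (hq : ‖q‖ < 1)

include hp in
theorem theta_ne_zero_of_mul_eq {x y : ℂ} (hx0 : x ≠ 0) (hx : ‖x‖ < 1) (hy : ‖y‖ < 1)
    (h : x * y = p) : theta p x ≠ 0 := by
  refine theta_ne_zero hp (norm_mul_lt_one hp hx) ?_ ?_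
  · rwa [← h, mul_div_cancel_left₀ _ hx0]
  · rintro rfl
    simp at hx

theorem continuousOn_betaIntegrand {p q : ℂ} (hp : ‖p‖ < 1) (hq : ‖q‖ < 1) {t : Fin 6 → ℂ}
    (h0 : ∀ j, t j ≠ 0) (h1 : ∀ j, ‖t j‖ < 1) :
    ContinuousOn (fun z => (∏ j, eGammaPM p q (t j) z) * betaKer p q z / z)
      (Metric.sphere 0 1) := by
  have hz1 : ∀ x ∈ Metric.sphere (0 : ℂ) 1, ‖x‖ = 1 := fun x hx => by simpa using hx
  refine ContinuousOn.div (ContinuousOn.mul (continuousOn_finsetProd _ fun j _ => ?_) ?_)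
    continuousOn_id fun x hx => ne_zero_of_norm_eq_one (hz1 x hx)
  · exact continuousOn_eGammaPM_comp hp hq continuousOn_const continuousOn_id
      (fun x _ => h0 j) (fun x _ => h1 j) hz1
  · exact continuousOn_betaKer_comp hp hq continuousOn_id hz1

include hp0 hp hq0 hq

/-- The contiguous relation obtained by integrating a total `q`-difference. -/
theorem betaInt_contiguous {t₁ t₂ t₃ t₄ t₅ T : ℂ}
    (h0 : t₁ ≠ 0 ∧ t₂ ≠ 0 ∧ t₃ ≠ 0 ∧ t₄ ≠ 0 ∧ t₅ ≠ 0 ∧ T ≠ 0)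
    (h1 : ‖t₁‖ < 1 ∧ ‖t₂‖ < 1 ∧ ‖t₃‖ < 1 ∧ ‖t₄‖ < 1 ∧ ‖t₅‖ < 1 ∧ ‖T‖ < 1)
    (hprod : t₁ * t₂ * t₃ * t₄ * t₅ * T = p) :
    (theta p (T * t₂) * theta p (T * t₃) * theta p (T * t₄) * theta p (T * t₅)) *
        betaInt p q ![q * t₁, t₂, t₃, t₄, t₅, T] =
      (theta p (t₁ * t₂) * theta p (t₁ * t₃) * theta p (t₁ * t₄) * theta p (t₁ * t₅)) *
        betaInt p q ![t₁, t₂, t₃, t₄, t₅, q * T] := by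
  obtain ⟨a0, b0, c0, d0, e0, f0⟩ := h0
  obtain ⟨a1, b1, c1, d1, e1, f1⟩ := h1
  have hqn : ∀ {x : ℂ}, ‖x‖ < 1 → ‖q * x‖ < 1 := fun hx => norm_mul_lt_one hq hx
  -- Here the factor `θ(T/t₁)` to be divided out vanishes, but the two sides agree by symmetry of
  -- the integrand.
  by_cases hTt : T = t₁
  · subst hTt
    congr 1
    unfold betaInt
    refine circleIntegral.integral_congr zero_le_one fun z _ => ?_
    simp only [Fin.prod_univ_six, Matrix.cons_val]
    ring
  have hΔ : theta p (T / t₁) ≠ 0 := by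
    refine theta_ne_zero hp ?_ ?_ (fun h => hTt ((div_eq_one_iff_eq a0).1 h))
    · rw [show p * (T / t₁) = t₂ * t₃ * t₄ * t₅ * T * T by rw [← hprod]; field_simp]
      exact norm_mul_lt_one (norm_mul_lt_one (norm_mul_lt_one (norm_mul_lt_one
        (norm_mul_lt_one b1 c1) d1) e1) f1) f1
    · rw [show p / (T / t₁) = t₁ * t₁ * t₂ * t₃ * t₄ * t₅ by rw [← hprod]; field_simp]
      exact norm_mul_lt_one (norm_mul_lt_one (norm_mul_lt_one (norm_mul_lt_one
        (norm_mul_lt_one a1 a1) b1) c1) d1) e1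
  have hm : theta p (t₂ * t₃) ≠ 0 :=
    theta_ne_zero_of_mul_eq hp (mul_ne_zero b0 c0) (norm_mul_lt_one b1 c1)
      (y := t₁ * t₄ * t₅ * T) (norm_mul_lt_one (norm_mul_lt_one (norm_mul_lt_one a1 d1) e1) f1)
      (by rw [← hprod]; ring)
  have hm' : theta p (t₂ * t₃ * T * t₁) ≠ 0 :=
    theta_ne_zero_of_mul_eq hp (by positivity)
      (norm_mul_lt_one (norm_mul_lt_one (norm_mul_lt_one b1 c1) f1) a1)
      (y := t₄ * t₅) (norm_mul_lt_one d1 e1) (by rw [← hprod]; ring)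
  -- The substitution `z ↦ z/q` turns `Γ(qtz)Γ(t/z)` into `Γ(tz)Γ(qt/z)`. For `1 ≤ |z| ≤ 1/|q|` all
  -- gamma arguments stay in the open unit disc, so `G` has no pole there.
  set G : ℂ → ℂ := fun z =>
    (eGamma p q (q * t₁ * z) * eGamma p q (t₁ * z⁻¹)) *
    (eGamma p q (q * t₂ * z) * eGamma p q (t₂ * z⁻¹)) *
    (eGamma p q (q * t₃ * z) * eGamma p q (t₃ * z⁻¹)) *
    (eGamma p q (q * t₄ * z) * eGamma p q (t₄ * z⁻¹)) *
    (eGamma p q (q * t₅ * z) * eGamma p q (t₅ * z⁻¹)) *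
    (eGamma p q (q * T * z) * eGamma p q (T * z⁻¹)) * theta q (z⁻¹ ^ 2) * z⁻¹ ^ 2 with hG
  have hGd : ∀ z : ℂ, 1 ≤ ‖z‖ → ‖z‖ ≤ ‖q⁻¹‖ → DifferentiableAt ℂ G z := by
    intro z hz1 hz2
    have hz0 : z ≠ 0 := norm_pos_iff.1 (one_pos.trans_le hz1)
    have hqz : ‖q * z‖ ≤ 1 := by
      rw [norm_inv] at hz2
      rw [norm_mul]
      calc ‖q‖ * ‖z‖ ≤ ‖q‖ * ‖q‖⁻¹ := by gcongr
        _ = 1 := mul_inv_cancel₀ (norm_ne_zero_iff.2 hq0)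
    have hzi : ‖z⁻¹‖ ≤ 1 := by rw [norm_inv]; exact inv_le_one_of_one_le₀ hz1
    have k1 : ∀ t : ℂ, t ≠ 0 → ‖t‖ < 1 →
        DifferentiableAt ℂ (fun z => eGamma p q (q * t * z) * eGamma p q (t * z⁻¹)) z := by
      intro t ht0 ht1
      refine DifferentiableAt.mul ?_ ?_
      · refine DifferentiableAt.comp z (f := fun z => q * t * z) (g := eGamma p q)
          (differentiableAt_eGamma hp hq (by positivity) ?_) (by fun_prop)
        rw [show q * t * z = t * (q * z) by ring, norm_mul]
        exact mul_lt_one_of_nonneg_of_lt_one_left (norm_nonneg _) ht1 hqz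
      · refine DifferentiableAt.comp z (f := fun z => t * z⁻¹) (g := eGamma p q)
          (differentiableAt_eGamma hp hq (by positivity) ?_)
          ((differentiableAt_inv hz0).const_mul t)
        rw [norm_mul]
        exact mul_lt_one_of_nonneg_of_lt_one_left (norm_nonneg _) ht1 hzi
    have hi : DifferentiableAt ℂ (fun z : ℂ => z⁻¹ ^ 2) z := (differentiableAt_inv hz0).pow 2
    refine (((((((k1 t₁ a0 a1).mul (k1 t₂ b0 b1)).mul (k1 t₃ c0 c1)).mul (k1 t₄ d0 d1)).mul
      (k1 t₅ e0 e1)).mul (k1 T f0 f1)).mul ?_).mul hi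
    exact DifferentiableAt.comp z (f := fun z : ℂ => z⁻¹ ^ 2) (g := theta q)
      (differentiableAt_theta hq (by positivity)) hi
  have hint := circleIntegral_comp_mul_eq (g := G) (a := q⁻¹)
    (by rw [norm_inv]; exact (one_le_inv₀ (norm_pos_iff.2 hq0)).2 hq.le) hGd
  have hI : ∀ t : Fin 6 → ℂ, (∀ j, t j ≠ 0) → (∀ j, ‖t j‖ < 1) →
      CircleIntegrable (fun z => (∏ j, eGammaPM p q (t j) z) * betaKer p q z / z) 0 1 :=
    fun t h0 h1 => (continuousOn_betaIntegrand hp hq h0 h1).circleIntegrable zero_le_one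
  set v₁ : Fin 6 → ℂ := ![q * t₁, t₂, t₃, t₄, t₅, T] with hv₁
  set v₂ : Fin 6 → ℂ := ![t₁, t₂, t₃, t₄, t₅, q * T] with hv₂
  have i₁ := hI v₁ (by simp [Fin.forall_fin_succ, *])
    (by simp only [hv₁, Fin.forall_fin_succ]; exact ⟨hqn a1, b1, c1, d1, e1, f1, fun i => i.elim0⟩)
  have i₂ := hI v₂ (by simp [Fin.forall_fin_succ, *])
    (by simp only [hv₂, Fin.forall_fin_succ]; exact ⟨a1, b1, c1, d1, e1, hqn f1, fun i => i.elim0⟩)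
  set A := theta p (T * t₂) * theta p (T * t₃) * theta p (T * t₄) * theta p (T * t₅) with hA
  set B := theta p (t₁ * t₂) * theta p (t₁ * t₃) * theta p (t₁ * t₄) * theta p (t₁ * t₅) with hB
  -- Up to a common product of gamma functions this is `theta_six_params`, whose factor `θ(z²; p)`
  -- completes `betaKer`.
  have hpt : Set.EqOn (fun z => t₁ * theta p (T / t₁) * (G (q⁻¹ * z) * q⁻¹ - G z))
      (fun z => A * ((∏ j, eGammaPM p q (v₁ j) z) * betaKer p q z / z) -
        B * ((∏ j, eGammaPM p q (v₂ j) z) * betaKer p q z / z)) (Metric.sphere 0 1) := by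
    intro z hz
    have hz1 : ‖z‖ = 1 := by simpa using hz
    have hz0 := ne_zero_of_norm_eq_one hz1
    have hzi := norm_inv_eq_one hz1
    have s1 : ∀ {t : ℂ}, t ≠ 0 → ‖t‖ < 1 →
        eGamma p q (q * t * z) = theta p (t * z) * eGamma p q (t * z) := by
      intro t ht0 ht1
      rw [mul_assoc, eGamma_q_mul hp hq hq0 (by positivity)
        (norm_mul_lt_one_of_norm_eq_one ht1 hz1)]
    have s2 : ∀ {t : ℂ}, t ≠ 0 → ‖t‖ < 1 →
        eGamma p q (q * t * z⁻¹) = theta p (t / z) * eGamma p q (t * z⁻¹) := by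
      intro t ht0 ht1
      rw [mul_assoc, eGamma_q_mul hp hq hq0 (by positivity)
        (norm_mul_lt_one_of_norm_eq_one ht1 hzi), div_eq_mul_inv]
    have s3 : theta q ((q⁻¹ * z)⁻¹ ^ 2) = q⁻¹ * z ^ 4 * theta q (z⁻¹ ^ 2) := by
      rw [show (q⁻¹ * z)⁻¹ ^ 2 = q * (q * z⁻¹ ^ 2) by field_simp,
        theta_p_mul hq0 hq (by positivity), theta_p_mul hq0 hq (by positivity)]
      field_simp
    have s4 : ∀ t : ℂ, eGamma p q (q * t * (q⁻¹ * z)) = eGamma p q (t * z) := by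
      intro t; congr 1; field_simp
    have s5 : ∀ t : ℂ, eGamma p q (t * (q⁻¹ * z)⁻¹) = eGamma p q (q * t * z⁻¹) := by
      intro t; congr 1; field_simp
    have six := theta_six_params hp0 hp a0 b0 c0 d0 e0 f0 hz0 hprod hΔ hm hm'
    rw [← hA, ← hB] at six
    simp only [hG, hv₁, hv₂, s3, s4, s5, Fin.prod_univ_six, Matrix.cons_val, eGammaPM, betaKer]
    rw [s1 a0 a1, s1 b0 b1, s1 c0 c1, s1 d0 d1, s1 e0 e1, s1 f0 f1, s2 a0 a1, s2 b0 b1, s2 c0 c1,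
      s2 d0 d1, s2 e0 e1, s2 f0 f1]
    have hzz : z * z⁻¹ = 1 := mul_inv_cancel₀ hz0
    have hqq : q * q⁻¹ = 1 := mul_inv_cancel₀ hq0
    generalize theta q (z⁻¹ ^ 2) = K at *
    generalize theta p (z ^ 2) = L at *
    generalize theta p (T / t₁) = Δ at *
    generalize eGamma p q (t₁ * z) = g1 at *
    generalize eGamma p q (t₂ * z) = g2 at *
    generalize eGamma p q (t₃ * z) = g3 at *
    generalize eGamma p q (t₄ * z) = g4 at *
    generalize eGamma p q (t₅ * z) = g5 at *
    generalize eGamma p q (T * z) = g6 at *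
    generalize eGamma p q (t₁ * z⁻¹) = k1 at *
    generalize eGamma p q (t₂ * z⁻¹) = k2 at *
    generalize eGamma p q (t₃ * z⁻¹) = k3 at *
    generalize eGamma p q (t₄ * z⁻¹) = k4 at *
    generalize eGamma p q (t₅ * z⁻¹) = k5 at *
    generalize eGamma p q (T * z⁻¹) = k6 at *
    generalize theta p (t₁ * z) = x1 at *
    generalize theta p (t₂ * z) = x2 at *
    generalize theta p (t₃ * z) = x3 at *
    generalize theta p (t₄ * z) = x4 at *
    generalize theta p (t₅ * z) = x5 at *
    generalize theta p (T * z) = x6 at *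
    generalize theta p (t₁ / z) = y1 at *
    generalize theta p (t₂ / z) = y2 at *
    generalize theta p (t₃ / z) = y3 at *
    generalize theta p (t₄ / z) = y4 at *
    generalize theta p (t₅ / z) = y5 at *
    generalize theta p (T / z) = y6 at *
    clear_value A B
    have e : (q⁻¹ * z)⁻¹ ^ 2 * (q⁻¹ * z ^ 4) * q⁻¹ = z ^ 3 * z⁻¹ := by field_simp
    linear_combination (g1 * g2 * g3 * g4 * g5 * g6 * k1 * k2 * k3 * k4 * k5 * k6 * K * z⁻¹) * six +
      (t₁ * Δ * (g1 * g2 * g3 * g4 * g5 * g6 * k1 * k2 * k3 * k4 * k5 * k6 * K) *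
        (y1 * y2 * y3 * y4 * y5 * y6)) * e
  have hGc : CircleIntegrable G 0 1 :=
    ContinuousOn.circleIntegrable zero_le_one fun z hz => by
      have hz1 : ‖z‖ = 1 := by simpa using hz
      refine (hGd z hz1.ge ?_).continuousAt.continuousWithinAt
      rw [hz1, norm_inv]
      exact (one_le_inv₀ (norm_pos_iff.2 hq0)).2 hq.le
  have hGc' : CircleIntegrable (fun z => G (q⁻¹ * z) * q⁻¹) 0 1 := by
    refine ContinuousOn.circleIntegrable zero_le_one fun z hz => ?_
    have hz1 : ‖z‖ = 1 := by simpa using hz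
    have hc : ContinuousAt G (q⁻¹ * z) := by
      refine (hGd _ ?_ ?_).continuousAt
      · rw [norm_mul, hz1, mul_one, norm_inv]
        exact (one_le_inv₀ (norm_pos_iff.2 hq0)).2 hq.le
      · rw [norm_mul, hz1, mul_one]
    exact ((ContinuousAt.comp (f := fun z => q⁻¹ * z) hc (by fun_prop)).mul
      continuousAt_const).continuousWithinAt
  have h1 := circleIntegral.integral_congr zero_le_one hpt
  have j₁ : CircleIntegrable
      (fun z => A * ((∏ j, eGammaPM p q (v₁ j) z) * betaKer p q z / z)) 0 1 := i₁.const_mul A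
  have j₂ : CircleIntegrable
      (fun z => B * ((∏ j, eGammaPM p q (v₂ j) z) * betaKer p q z / z)) 0 1 := i₂.const_mul B
  rw [circleIntegral.integral_const_mul, circleIntegral.integral_sub hGc' hGc, hint, sub_self,
    mul_zero, circleIntegral.integral_sub j₁ j₂,
    circleIntegral.integral_const_mul, circleIntegral.integral_const_mul] at h1
  exact (sub_eq_zero.1 h1.symm)

/-- The shift multiplies `Γ(t₁tⱼ)` or `Γ(Ttⱼ)` by the same thetas that appear in
`betaInt_contiguous`, while `Γ(qt₁T)` occurs on both sides. -/
theorem betaInt_div_betaProd_shift {t₁ t₂ t₃ t₄ t₅ T : ℂ}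
    (h0 : t₁ ≠ 0 ∧ t₂ ≠ 0 ∧ t₃ ≠ 0 ∧ t₄ ≠ 0 ∧ t₅ ≠ 0 ∧ T ≠ 0)
    (h1 : ‖t₁‖ < 1 ∧ ‖t₂‖ < 1 ∧ ‖t₃‖ < 1 ∧ ‖t₄‖ < 1 ∧ ‖t₅‖ < 1 ∧ ‖T‖ < 1)
    (hprod : t₁ * t₂ * t₃ * t₄ * t₅ * T = p) :
    betaInt p q ![q * t₁, t₂, t₃, t₄, t₅, T] / betaProd p q ![q * t₁, t₂, t₃, t₄, t₅, T] =
      betaInt p q ![t₁, t₂, t₃, t₄, t₅, q * T] / betaProd p q ![t₁, t₂, t₃, t₄, t₅, q * T] := by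
  have h := betaInt_contiguous hp0 hp hq0 hq h0 h1 hprod
  obtain ⟨a0, b0, c0, d0, e0, f0⟩ := h0
  obtain ⟨a1, b1, c1, d1, e1, f1⟩ := h1
  have hqn : ∀ {x : ℂ}, ‖x‖ < 1 → ‖q * x‖ < 1 := fun hx => norm_mul_lt_one hq hx
  have n1 := betaProd_ne_zero hp hq (t := ![q * t₁, t₂, t₃, t₄, t₅, T]) (isBetaParam_vec.2
    ⟨⟨mul_ne_zero hq0 a0, b0, c0, d0, e0, f0⟩, ⟨hqn a1, b1, c1, d1, e1, f1⟩,
      by rw [← hprod]; ring⟩)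
  have n2 := betaProd_ne_zero hp hq (t := ![t₁, t₂, t₃, t₄, t₅, q * T]) (isBetaParam_vec.2
    ⟨⟨a0, b0, c0, d0, e0, mul_ne_zero hq0 f0⟩, ⟨a1, b1, c1, d1, e1, hqn f1⟩,
      by rw [← hprod]; ring⟩)
  have s : ∀ {x y : ℂ}, x ≠ 0 → y ≠ 0 → ‖x‖ < 1 → ‖y‖ < 1 →
      eGamma p q (q * x * y) = theta p (x * y) * eGamma p q (x * y) := by
    intro x y hx hy hx1 hy1
    rw [mul_assoc, eGamma_q_mul hp hq hq0 (mul_ne_zero hx hy) (norm_mul_lt_one hx1 hy1)]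
  rw [div_eq_div_iff n1 n2]
  rw [betaProd_vec] at n1 n2 ⊢
  rw [betaProd_vec]
  rw [mul_comm t₂ (q * T), mul_comm t₃ (q * T), mul_comm t₄ (q * T), mul_comm t₅ (q * T),
    s a0 b0 a1 b1, s a0 c0 a1 c1, s a0 d0 a1 d1, s a0 e0 a1 e1,
    s f0 b0 f1 b1, s f0 c0 f1 c1, s f0 d0 f1 d1, s f0 e0 f1 e1, mul_comm t₁ (q * T),
    mul_comm t₂ T, mul_comm t₃ T, mul_comm t₄ T, mul_comm t₅ T,
    show q * T * t₁ = q * t₁ * T by ring]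
  linear_combination (eGamma p q (t₁ * t₂) * eGamma p q (t₁ * t₃) * eGamma p q (t₁ * t₄) *
    eGamma p q (t₁ * t₅) * eGamma p q (q * t₁ * T) * eGamma p q (t₂ * t₃) * eGamma p q (t₂ * t₄) *
    eGamma p q (t₂ * t₅) * eGamma p q (T * t₂) * eGamma p q (t₃ * t₄) * eGamma p q (t₃ * t₅) *
    eGamma p q (T * t₃) * eGamma p q (t₄ * t₅) * eGamma p q (T * t₄) * eGamma p q (T * t₅)) * h

/-- If `|t₁ t₆| < |q|`, the quotient depends on `t₁, t₆` only through `t₁ t₆`. -/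
theorem betaInt_div_betaProd_eq {t₁ t₂ t₃ t₄ t₅ t₆ t₁' t₆' : ℂ}
    (ht : IsBetaParam p q ![t₁, t₂, t₃, t₄, t₅, t₆])
    (ht' : IsBetaParam p q ![t₁', t₂, t₃, t₄, t₅, t₆']) (hlt : ‖t₁ * t₆‖ < ‖q‖) :
    betaInt p q ![t₁, t₂, t₃, t₄, t₅, t₆] / betaProd p q ![t₁, t₂, t₃, t₄, t₅, t₆] =
      betaInt p q ![t₁', t₂, t₃, t₄, t₅, t₆'] / betaProd p q ![t₁', t₂, t₃, t₄, t₅, t₆'] := by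
  rw [isBetaParam_vec] at ht ht'
  obtain ⟨⟨a0, b0, c0, d0, e0, f0⟩, ⟨a1, b1, c1, d1, e1, f1⟩, hprod⟩ := ht
  obtain ⟨⟨a0', -, -, -, -, f0'⟩, ⟨a1', -, -, -, -, f1'⟩, hprod'⟩ := ht'
  have heq : t₁' * t₆' = t₁ * t₆ := by
    have : t₂ * t₃ * t₄ * t₅ ≠ 0 := by positivity
    apply mul_left_cancel₀ this
    linear_combination hprod' - hprod
  -- The product of the two moving parameters stays fixed; both lie in the unit disc exactly on a
  -- strip of width `log (1 / |t₁t₆|)`.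
  set v : ℂ → Fin 6 → ℂ := fun σ => ![t₁ * cexp σ, t₂, t₃, t₄, t₅, t₆ * cexp (-σ)] with hv
  have hlog : ∀ {x : ℂ} {r : ℝ}, x ≠ 0 → (‖x‖ * Real.exp r < 1 ↔ r < -Real.log ‖x‖) := by
    intro x r hx
    have : 0 < ‖x‖ := norm_pos_iff.2 hx
    rw [← Real.log_inv, Real.lt_log_iff_exp_lt (by positivity), lt_inv_comm₀ (Real.exp_pos r) this,
      ← one_div, lt_div_iff₀ (Real.exp_pos r)]
  have hvp : ∀ σ : ℂ, Real.log ‖t₆‖ < σ.re → σ.re < -Real.log ‖t₁‖ → IsBetaParam p q (v σ) := by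
    intro σ h1 h2
    refine isBetaParam_vec.2 ⟨⟨mul_ne_zero a0 (Complex.exp_ne_zero _), b0, c0, d0, e0,
      mul_ne_zero f0 (Complex.exp_ne_zero _)⟩, ⟨?_, b1, c1, d1, e1, ?_⟩, ?_⟩
    · rwa [norm_mul, Complex.norm_exp, hlog a0]
    · rw [norm_mul, Complex.norm_exp, hlog f0, neg_re]
      linarith
    · rw [Complex.exp_neg, ← hprod]
      have := Complex.exp_ne_zero σ
      field_simp
  set F : ℂ → ℂ := fun σ => betaInt p q (v σ) / betaProd p q (v σ) with hF
  have hFd : DifferentiableOn ℂ F {σ | Real.log ‖t₆‖ < σ.re ∧ σ.re < -Real.log ‖t₁‖} := by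
    refine differentiableOn_betaInt_div_betaProd hp hq (isOpen_strip _ _) ?_
      fun σ hσ => hvp σ hσ.1 hσ.2
    simp only [hv, Fin.forall_fin_succ]
    refine ⟨?_, ?_, ?_, ?_, ?_, ?_, fun i => i.elim0⟩
    · exact (by fun_prop : Differentiable ℂ fun σ => t₁ * cexp σ).differentiableOn
    · exact differentiableOn_const _
    · exact differentiableOn_const _
    · exact differentiableOn_const _
    · exact differentiableOn_const _
    · exact (by fun_prop : Differentiable ℂ fun σ => t₆ * cexp (-σ)).differentiableOn
  have hper : Function.Periodic F (2 * Real.pi * I) := by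
    intro σ
    simp only [hF, hv, neg_add, Complex.exp_add, Complex.exp_neg (2 * Real.pi * I),
      Complex.exp_two_pi_mul_I, inv_one, mul_one]
  -- Translating `σ` by `-log q` replaces `t₁` by `t₁/q` and `t₆` by `qt₆`, which is the move of the
  -- difference equation.
  have hτ : cexp (-Complex.log q) = q⁻¹ := by rw [Complex.exp_neg, Complex.exp_log hq0]
  have hshift : ∀ σ : ℂ, Real.log ‖t₆‖ < σ.re → σ.re + (-Complex.log q).re < -Real.log ‖t₁‖ →
      F (σ + -Complex.log q) = F σ := by
    intro σ h1 h2
    have h := betaInt_div_betaProd_shift hp0 hp hq0 hq (t₁ := t₁ * cexp (σ + -Complex.log q))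
      (t₂ := t₂) (t₃ := t₃) (t₄ := t₄) (t₅ := t₅) (T := t₆ * cexp (-σ))
      ⟨mul_ne_zero a0 (Complex.exp_ne_zero _), b0, c0, d0, e0,
        mul_ne_zero f0 (Complex.exp_ne_zero _)⟩ ⟨?_, b1, c1, d1, e1, ?_⟩ ?_
    · rw [show q * (t₁ * cexp (σ + -Complex.log q)) = t₁ * cexp σ by
        rw [Complex.exp_add, hτ]; field_simp] at h
      rw [show q * (t₆ * cexp (-σ)) = t₆ * cexp (-(σ + -Complex.log q)) by
        rw [neg_add, Complex.exp_add, neg_neg, Complex.exp_log hq0]; ring] at h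
      exact h.symm
    · rwa [norm_mul, Complex.norm_exp, hlog a0, add_re]
    · rw [norm_mul, Complex.norm_exp, hlog f0, neg_re]
      linarith
    · rw [Complex.exp_add, hτ, Complex.exp_neg]
      have := Complex.exp_ne_zero σ
      apply mul_left_cancel₀ hq0
      rw [mul_comm q p, ← hprod]
      field_simp
  have hre : (-Complex.log q).re = -Real.log ‖q‖ := by rw [neg_re, Complex.log_re]
  set δ := Complex.log (t₁' / t₁) with hδ
  have hδe : cexp δ = t₁' / t₁ := Complex.exp_log (div_ne_zero a0' a0)
  have hδ1 : t₁ * cexp δ = t₁' := by rw [hδe]; field_simp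
  have hδ2 : t₆ * cexp (-δ) = t₆' := by
    rw [Complex.exp_neg, hδe]
    field_simp
    linear_combination -heq
  -- The hypothesis `|t₁t₆| < |q|` says that the strip is wider than the period `log (1 / |q|)`. The
  -- points `0` and `δ` give the two parameter sets.
  have key := eq_of_periodic_of_differentiableOn_strip (f := F) (σ := 0) (σ' := δ) hFd hper
    (τ := -Complex.log q) ?_ ?_ hshift ?_ ?_
  · simp only [hF, hv, hδ1, hδ2, neg_zero, Complex.exp_zero, mul_one] at key
    exact key
  · rw [hre]
    linarith [Real.log_neg (norm_pos_iff.2 hq0) hq]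
  · rw [hre]
    have := Real.log_lt_log (norm_pos_iff.2 (mul_ne_zero a0 f0)) hlt
    rw [norm_mul, Real.log_mul (norm_ne_zero_iff.2 a0) (norm_ne_zero_iff.2 f0)] at this
    linarith
  · rw [zero_re]
    exact ⟨Real.log_neg (norm_pos_iff.2 f0) f1, by linarith [Real.log_neg (norm_pos_iff.2 a0) a1]⟩
  · constructor
    · have : -δ.re < -Real.log ‖t₆‖ := by
        rw [← hlog f0, ← neg_re, ← Complex.norm_exp, ← norm_mul, hδ2]
        exact f1'
      linarith
    · rw [← hlog a0, ← Complex.norm_exp, ← norm_mul, hδ1]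
      exact a1'

end

/-! ### A Poisson kernel limit -/

/-- The kernel `(1 + r² z²)(1 + r² z⁻²)`. -/
noncomputable def peakKer (r : ℝ) (z : ℂ) : ℂ := (1 + r ^ 2 * z ^ 2) * (1 + r ^ 2 * z⁻¹ ^ 2)

theorem conj_eq_inv_of_norm_eq_one {z : ℂ} (hz : ‖z‖ = 1) : (starRingEnd ℂ) z = z⁻¹ := by
  rw [Complex.inv_def, Complex.normSq_eq_norm_sq, hz]
  simp

theorem peakKer_eq {r : ℝ} {z : ℂ} (hz : ‖z‖ = 1) :
    peakKer r z = ((‖1 + (r : ℂ) ^ 2 * z ^ 2‖ ^ 2 : ℝ) : ℂ) := by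
  rw [← Complex.normSq_eq_norm_sq, Complex.normSq_eq_conj_mul_self, peakKer, mul_comm]
  congr 1
  simp [conj_eq_inv_of_norm_eq_one hz]

theorem one_sub_sq_le_norm {r : ℝ} {z : ℂ} (hz : ‖z‖ = 1) :
    1 - r ^ 2 ≤ ‖1 + (r : ℂ) ^ 2 * z ^ 2‖ := by
  have h := norm_sub_norm_le (1 : ℂ) (-((r : ℂ) ^ 2 * z ^ 2))
  simpa [hz] using h

theorem circleIntegral_peakKer {r : ℝ} (h0 : 0 < r) (h1 : r < 1) :
    (∮ z in C(0, 1), (1 - r ^ 4 : ℂ) / peakKer r z / z) = 2 * Real.pi * I := by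
  have hr2 : r ^ 2 < 1 := by nlinarith
  have hn : ∀ z : ℂ, ‖z‖ ≤ 1 → 1 + (r : ℂ) ^ 2 * z ^ 2 ≠ 0 := by
    intro z hz h
    have : ‖(r : ℂ) ^ 2 * z ^ 2‖ < 1 := by
      rw [norm_mul, norm_pow, norm_pow, Complex.norm_real, Real.norm_eq_abs, sq_abs]
      calc r ^ 2 * ‖z‖ ^ 2 ≤ r ^ 2 * 1 := by
            gcongr
            exact pow_le_one₀ (norm_nonneg _) hz
        _ < 1 := by linarith
    exact one_sub_ne_zero_of_norm_lt (z := -((r : ℂ) ^ 2 * z ^ 2)) (by rwa [norm_neg])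
      (by rw [sub_neg_eq_add]; exact h)
  have hrn : ‖I * (r : ℂ)‖ < 1 := by
    rw [norm_mul, Complex.norm_I, one_mul, Complex.norm_real, Real.norm_eq_abs, abs_of_pos h0]
    exact h1
  have hc1 : ∀ a : ℂ, ‖a‖ < 1 → CircleIntegrable (fun z => (z - a)⁻¹) 0 1 := by
    intro a ha
    refine ContinuousOn.circleIntegrable zero_le_one
      (ContinuousOn.inv₀ (by fun_prop) fun z hz h => ?_)
    rw [sub_eq_zero] at h
    subst h
    simp at hz
    linarith
  have hd : DifferentiableOn ℂ (fun z : ℂ => (r : ℂ) ^ 2 * z / (1 + (r : ℂ) ^ 2 * z ^ 2))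
      (Metric.closedBall 0 1) :=
    DifferentiableOn.div (by fun_prop) (by fun_prop) fun z hz => hn z (by simpa using hz)
  -- Partial fractions: simple poles at `±ir` inside the disc with residue `1/2` each, and a
  -- remainder holomorphic on the closed disc.
  have hpt : Set.EqOn (fun z => (1 - r ^ 4 : ℂ) / peakKer r z / z)
      (fun z => (1 / 2 : ℂ) * ((z - I * r)⁻¹ + (z - -(I * r))⁻¹) -
        (r : ℂ) ^ 2 * z / (1 + (r : ℂ) ^ 2 * z ^ 2)) (Metric.sphere 0 1) := by
    intro z hz
    have hz1 : ‖z‖ = 1 := by simpa using hz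
    have hz0 := ne_zero_of_norm_eq_one hz1
    have e1 := hn z hz1.le
    have e2 := hn z⁻¹ (norm_inv_eq_one hz1).le
    have e3 : z ^ 2 + (r : ℂ) ^ 2 ≠ 0 := by
      intro h
      apply e2
      field_simp
      rw [h, mul_zero]
    have hI : I ^ 2 = -1 := Complex.I_sq
    have e4 : (z - I * r) * (z - -(I * r)) = z ^ 2 + (r : ℂ) ^ 2 := by
      linear_combination -(r : ℂ) ^ 2 * hI
    have e5 : (z - I * r) ≠ 0 := fun h => e3 (by rw [← e4, h, zero_mul])
    have e6 : (z - -(I * r)) ≠ 0 := fun h => e3 (by rw [← e4, h, mul_zero])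
    have e7 : (1 / 2 : ℂ) * ((z - I * r)⁻¹ + (z - -(I * r))⁻¹) = z / (z ^ 2 + (r : ℂ) ^ 2) := by
      rw [← e4]
      field_simp
      ring
    have e8 : peakKer r z * z = (1 + (r : ℂ) ^ 2 * z ^ 2) * (z ^ 2 + r ^ 2) / z := by
      rw [peakKer]
      field_simp
    simp only
    rw [e7, div_div, e8]
    field_simp
    ring
  rw [circleIntegral.integral_congr zero_le_one hpt, circleIntegral.integral_sub,
    circleIntegral.integral_const_mul, circleIntegral.integral_add (hc1 _ hrn)
      (hc1 _ (by rwa [norm_neg])), circleIntegral.integral_sub_inv_of_mem_ball (by simpa using hrn),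
    circleIntegral.integral_sub_inv_of_mem_ball (by simpa using hrn),
    (hd.diffContOnCl_ball subset_rfl).circleIntegral_eq_zero zero_le_one]
  · ring
  · have h : CircleIntegrable (fun z => (1 / 2 : ℂ) * ((z - I * r)⁻¹ + (z - -(I * r))⁻¹)) 0 1 :=
      ((hc1 _ hrn).add (hc1 _ (by rwa [norm_neg]))).const_mul _
    exact h
  · exact (hd.continuousOn.mono Metric.sphere_subset_closedBall).circleIntegrable zero_le_one

theorem integral_peakKer {r : ℝ} (h0 : 0 < r) (h1 : r < 1) :
    ∫ θ in (0 : ℝ)..2 * Real.pi,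
      (1 - r ^ 4) / ‖1 + (r : ℂ) ^ 2 * (circleMap 0 1 θ) ^ 2‖ ^ 2 = 2 * Real.pi := by
  have h := circleIntegral_peakKer h0 h1
  unfold circleIntegral at h
  have e : ∀ θ : ℝ, deriv (circleMap 0 1) θ • ((1 - (r : ℂ) ^ 4) / peakKer r (circleMap 0 1 θ) /
      circleMap 0 1 θ) =
      I * (((1 - r ^ 4) / ‖1 + (r : ℂ) ^ 2 * (circleMap 0 1 θ) ^ 2‖ ^ 2 : ℝ) : ℂ) := by
    intro θ
    have hz1 : ‖circleMap 0 1 θ‖ = 1 := by simp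
    have := ne_zero_of_norm_eq_one hz1
    rw [deriv_circleMap, peakKer_eq hz1, smul_eq_mul]
    push_cast
    field_simp
  simp_rw [e] at h
  rw [intervalIntegral.integral_const_mul, intervalIntegral.integral_ofReal] at h
  have h2 : ((∫ θ in (0 : ℝ)..2 * Real.pi,
      (1 - r ^ 4) / ‖1 + (r : ℂ) ^ 2 * (circleMap 0 1 θ) ^ 2‖ ^ 2 : ℝ) : ℂ) = 2 * Real.pi :=
    mul_left_cancel₀ Complex.I_ne_zero (by rw [h]; ring)
  exact_mod_cast h2

/-- On the compact set where `‖f‖ ≥ ε`, the function `φ` has a positive minimum, so a large multiple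
of `φ` dominates `f`. This replaces a modulus of continuity in the limit below. -/
theorem exists_norm_sub_le_of_continuousOn {X : Type*} [TopologicalSpace X] {K : Set X}
    (hK : IsCompact K) {f : X → ℂ} {φ : X → ℝ} (hf : ContinuousOn f K) (hφ : ContinuousOn φ K)
    (hφ0 : ∀ x ∈ K, 0 ≤ φ x) (h : ∀ x ∈ K, φ x = 0 → f x = 0) {ε : ℝ} (hε : 0 < ε) :
    ∃ C, 0 ≤ C ∧ ∀ x ∈ K, ‖f x‖ ≤ ε + C * φ x := by
  obtain ⟨M, hM⟩ := (hK.bddAbove_image hf.norm)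
  set K' := K ∩ {x | ε ≤ ‖f x‖} with hK'
  have hK'c : IsCompact K' := by
    obtain ⟨u, hu, hu'⟩ := continuousOn_iff_isClosed.1 hf.norm (Set.Ici ε) isClosed_Ici
    have : K' = K ∩ u := by
      rw [Set.inter_comm K u, ← hu', hK', Set.inter_comm]
      rfl
    rw [this]
    exact hK.inter_right hu
  rcases K'.eq_empty_or_nonempty with he | hne
  · refine ⟨0, le_rfl, fun x hx => ?_⟩
    by_contra! hc
    have : x ∈ K' := ⟨hx, by simp at hc; exact hc.le⟩
    simp [he] at this
  · obtain ⟨m, hm, hmin⟩ := hK'c.exists_isMinOn hne (hφ.mono Set.inter_subset_left)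
    have hm0 : 0 < φ m := by
      refine lt_of_le_of_ne (hφ0 m hm.1) fun h0 => ?_
      have := hm.2
      rw [Set.mem_ofPred_eq, h m hm.1 h0.symm, norm_zero] at this
      linarith
    have hM0 : 0 ≤ M := (norm_nonneg (f m)).trans (hM ⟨m, hm.1, rfl⟩)
    refine ⟨M / φ m, by positivity, fun x hx => ?_⟩
    by_cases hx' : ε ≤ ‖f x‖
    · have h1 : φ m ≤ φ x := hmin ⟨hx, hx'⟩
      have h2 : ‖f x‖ ≤ M := hM ⟨x, hx, rfl⟩
      have : M ≤ M / φ m * φ x := by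
        rw [div_mul_eq_mul_div, le_div_iff₀ hm0]
        gcongr
      linarith
    · have := mul_nonneg (div_nonneg hM0 hm0.le) (hφ0 x hx)
      push Not at hx'
      linarith

/-- On the circle `(1 - r⁴) / peakKer r z` is a Poisson kernel in the variable `z²`: positive, of
total mass `2π`, and concentrating at `z² = -1` as `r → 1`. -/
theorem tendsto_circleIntegral_peakKer {H : ℝ → ℂ → ℂ} {r₀ : ℝ} (hr₀ : 0 < r₀) (hr₁ : r₀ < 1)
    (hH : ContinuousOn (Function.uncurry H) (Set.Icc r₀ 1 ×ˢ Metric.sphere 0 1)) {L : ℂ}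
    (hL : H 1 I = L) (hL' : H 1 (-I) = L) :
    Tendsto (fun r : ℝ => (1 - r ^ 4 : ℂ) * ∮ z in C(0, 1), H r z / peakKer r z / z) (𝓝[<] 1)
      (𝓝 (2 * Real.pi * I * L)) := by
  rw [Metric.tendsto_nhds]
  intro ε hε
  -- Against the total mass `2π` this contributes `ε/4`, which leaves room for the `ε/2` supplied by
  -- `hlim`.
  set ε' := ε / (8 * Real.pi) with hε'
  have hε'0 : 0 < ε' := by positivity
  set K : Set (ℝ × ℂ) := Set.Icc r₀ 1 ×ˢ Metric.sphere (0 : ℂ) 1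
  have hK : IsCompact K := isCompact_Icc.prod (isCompact_sphere 0 1)
  -- The comparison function vanishes only at `r = 1`, `z = ±i`, where `H = L`.
  obtain ⟨C, hC0, hC⟩ := exists_norm_sub_le_of_continuousOn hK
    (f := fun x => Function.uncurry H x - L) (φ := fun x => ‖1 + x.2 ^ 2‖ ^ 2 + (1 - x.1))
    (hH.sub continuousOn_const) (by fun_prop)
    (fun x hx => add_nonneg (by positivity) (by linarith [hx.1.2]))
    (fun x hx h0 => by
      have h1 : 0 ≤ 1 - x.1 := by linarith [hx.1.2]
      have h2 : (0 : ℝ) ≤ ‖1 + x.2 ^ 2‖ ^ 2 := by positivity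
      have h3 : x.1 = 1 := by linarith
      have h4 : ‖1 + x.2 ^ 2‖ ^ 2 = 0 := by linarith
      have h5 : 1 + x.2 ^ 2 = 0 := by
        rw [← norm_eq_zero]; exact pow_eq_zero_iff two_ne_zero |>.1 h4
      have h6 : (x.2 - I) * (x.2 + I) = 0 := by
        linear_combination h5 - Complex.I_sq
      obtain ⟨r, z⟩ := x
      simp only at h3 h6
      subst h3
      rcases mul_eq_zero.1 h6 with h | h
      · rw [sub_eq_zero] at h
        subst h
        simp [Function.uncurry, hL]
      · rw [add_eq_zero_iff_eq_neg] at h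
        subst h
        simp [Function.uncurry, hL']) hε'0
  have hlim : Tendsto (fun r : ℝ => 2 * Real.pi * (C * (1 - r)) + 2 * Real.pi *
      (4 * C * (1 - r ^ 4))) (𝓝[<] 1) (𝓝 0) := by
    have : Continuous fun r : ℝ => 2 * Real.pi * (C * (1 - r)) + 2 * Real.pi *
      (4 * C * (1 - r ^ 4)) := by fun_prop
    have h := (this.tendsto 1).mono_left (nhdsWithin_le_nhds (s := Set.Iio 1))
    simpa using h
  have hev := hlim.eventually (gt_mem_nhds (half_pos hε))
  filter_upwards [hev, Ioo_mem_nhdsLT hr₁] with r hr hrI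
  have hr0 : 0 < r := hr₀.trans hrI.1
  have hr1 : r < 1 := hrI.2
  have hr2 : r ^ 2 < 1 := by nlinarith
  have hr4 : 0 < 1 - r ^ 4 := by nlinarith [sq_nonneg r]
  have hpos : ∀ z : ℂ, ‖z‖ = 1 → 0 < ‖1 + (r : ℂ) ^ 2 * z ^ 2‖ := fun z hz =>
    (by linarith : 0 < 1 - r ^ 2).trans_le (one_sub_sq_le_norm hz)
  have hker0 : ∀ z : ℂ, ‖z‖ = 1 → peakKer r z ≠ 0 := fun z hz => by
    rw [peakKer_eq hz]
    exact_mod_cast (pow_pos (hpos z hz) 2).ne'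
  have hkerc : ContinuousOn (peakKer r) (Metric.sphere 0 1) := by
    unfold peakKer
    have : ContinuousOn (fun z : ℂ => z⁻¹) (Metric.sphere 0 1) :=
      continuousOn_inv₀.mono fun z hz => ne_zero_of_norm_eq_one (by simpa using hz)
    fun_prop
  have hHr : ContinuousOn (H r) (Metric.sphere 0 1) :=
    hH.comp (f := fun z => (r, z)) (by fun_prop) fun z hz => ⟨⟨hrI.1.le, hr1.le⟩, hz⟩
  have hc : ∀ f : ℂ → ℂ, ContinuousOn f (Metric.sphere 0 1) →
      CircleIntegrable (fun z => f z / peakKer r z / z) 0 1 := fun f hf =>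
    ((hf.div hkerc fun z hz => hker0 z (by simpa using hz)).div continuousOn_id
      fun z hz => ne_zero_of_norm_eq_one (by simpa using hz)).circleIntegrable zero_le_one
  have hLint : 2 * Real.pi * I * L = (1 - r ^ 4 : ℂ) * ∮ z in C(0, 1), L / peakKer r z / z := by
    rw [← circleIntegral_peakKer hr0 hr1, mul_comm, ← circleIntegral.integral_const_mul,
      ← circleIntegral.integral_const_mul]
    refine circleIntegral.integral_congr zero_le_one fun z _ => ?_
    ring
  rw [dist_eq_norm, hLint, ← mul_sub, ← circleIntegral.integral_sub (hc _ hHr)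
    (hc _ continuousOn_const), ← circleIntegral.integral_const_mul]
  have hbound : ∀ θ : ℝ, ‖deriv (circleMap 0 1) θ • ((1 - (r : ℂ) ^ 4) *
      (H r (circleMap 0 1 θ) / peakKer r (circleMap 0 1 θ) / circleMap 0 1 θ -
        L / peakKer r (circleMap 0 1 θ) / circleMap 0 1 θ))‖ ≤
      (ε' + C * (1 - r)) * ((1 - r ^ 4) / ‖1 + (r : ℂ) ^ 2 * (circleMap 0 1 θ) ^ 2‖ ^ 2) +
        4 * C * (1 - r ^ 4) := by
    intro θ
    have hz1 : ‖circleMap 0 1 θ‖ = 1 := by simp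
    set z := circleMap 0 1 θ with hz
    have e1 : (1 - (r : ℂ) ^ 4) * (H r z / peakKer r z / z - L / peakKer r z / z) =
      ((1 - r ^ 4 : ℝ) : ℂ) * (H r z - L) / peakKer r z / z := by push_cast; ring
    rw [e1, deriv_circleMap, peakKer_eq hz1, norm_smul, norm_div, norm_div, norm_mul, norm_mul,
      Complex.norm_I, Complex.norm_real, Complex.norm_real, hz1, Real.norm_eq_abs,
      Real.norm_eq_abs, abs_of_pos hr4, abs_of_pos (pow_pos (hpos z hz1) 2)]
    rw [mul_one, one_mul, div_one]
    have h1 := hC (r, z) ⟨⟨hrI.1.le, hr1.le⟩, by simpa using hz1⟩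
    simp only [Function.uncurry] at h1
    set N := ‖1 + (r : ℂ) ^ 2 * z ^ 2‖ with hN
    have hN0 : 0 < N := hpos z hz1
    -- This lets the term `‖1 + z²‖²` cancel the denominator `N²` of the kernel, leaving a multiple
    -- of `1 - r⁴`.
    have h2 : ‖1 + z ^ 2‖ ≤ 2 * N := by
      have hA : 1 - r ^ 2 ≤ N := one_sub_sq_le_norm hz1
      have hB : ‖1 + z ^ 2‖ ≤ N + (1 - r ^ 2) := by
        have : 1 + z ^ 2 = (1 + (r : ℂ) ^ 2 * z ^ 2) + ((1 - r ^ 2 : ℝ) : ℂ) * z ^ 2 := by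
          push_cast; ring
        rw [this]
        refine (norm_add_le _ _).trans ?_
        rw [norm_mul, norm_pow, hz1, Complex.norm_real, Real.norm_eq_abs,
          abs_of_pos (by linarith)]
        simp [hN]
      linarith
    have h3 : ‖1 + z ^ 2‖ ^ 2 ≤ 4 * N ^ 2 := by
      have := pow_le_pow_left₀ (norm_nonneg _) h2 2
      linarith [this, (by ring : (2 * N) ^ 2 = 4 * N ^ 2)]
    have h4 : ‖H r z - L‖ ≤ (ε' + C * (1 - r)) + 4 * C * N ^ 2 := by
      nlinarith [mul_le_mul_of_nonneg_left h3 hC0]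
    calc (1 - r ^ 4) * ‖H r z - L‖ / N ^ 2
        ≤ (1 - r ^ 4) * ((ε' + C * (1 - r)) + 4 * C * N ^ 2) / N ^ 2 := by gcongr
      _ = _ := by field_simp
  have hcontK : Continuous fun θ : ℝ =>
      (1 - r ^ 4) / ‖1 + (r : ℂ) ^ 2 * (circleMap 0 1 θ) ^ 2‖ ^ 2 :=
    Continuous.div (by fun_prop) (by fun_prop) fun θ =>
      (pow_pos (hpos _ (by simp)) 2).ne'
  calc _ ≤ ∫ θ in (0 : ℝ)..2 * Real.pi, ((ε' + C * (1 - r)) *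
        ((1 - r ^ 4) / ‖1 + (r : ℂ) ^ 2 * (circleMap 0 1 θ) ^ 2‖ ^ 2) + 4 * C * (1 - r ^ 4)) := by
        refine intervalIntegral.norm_integral_le_of_norm_le Real.two_pi_pos.le
          (Eventually.of_forall fun θ _ => hbound θ) ?_
        exact (Continuous.intervalIntegrable (by fun_prop) _ _)
    _ = (ε' + C * (1 - r)) * (2 * Real.pi) + 2 * Real.pi * (4 * C * (1 - r ^ 4)) := by
        rw [intervalIntegral.integral_add (Continuous.intervalIntegrable (by fun_prop) _ _)
          (Continuous.intervalIntegrable (by fun_prop) _ _), intervalIntegral.integral_const_mul,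
          integral_peakKer hr0 hr1, intervalIntegral.integral_const]
        simp
    _ < ε := by
        have : ε' * (2 * Real.pi) = ε / 4 := by
          rw [hε']
          field_simp
          norm_num
        nlinarith

/-! ### Evaluation of the elliptic beta integral -/

/-- The elliptic gamma function with its pole at `z = 1` removed: `(1 - z) Γ(z)`. -/
noncomputable def regGamma (p q z : ℂ) : ℂ :=
  dblPoch p q (p * q / z) / (qPoch (p * z) p * qPoch (q * z) q * dblPoch p q (p * q * z))

/-- A degenerating family of parameters of the elliptic beta integral. -/
noncomputable def pinchVec (m c d e : ℂ) (r : ℝ) : Fin 6 → ℂ :=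
  ![m / (r : ℂ) ^ 2, -(I * r), c, d, e, I * r]

section

variable {p q : ℂ} (hp0 : p ≠ 0) (hp : ‖p‖ < 1) (hq0 : q ≠ 0) (hq : ‖q‖ < 1)

section

include hp hq

theorem eGamma_eq_regGamma_div (z : ℂ) : eGamma p q z = regGamma p q z / (1 - z) := by
  rw [eGamma_eq hp hq, regGamma, dblPoch_eq_right hp hq z, dblPoch_eq_left hp hq (q * z),
    qPoch_eq hp z, div_div, show p * (q * z) = p * q * z by ring]
  congr 1
  ring

/-- The source of `(p;p)_∞ (q;q)_∞` in `kappa`. -/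
theorem regGamma_one : regGamma p q 1 = (qPoch p p * qPoch q q)⁻¹ := by
  have h := dblPoch_ne_zero hp hq (norm_mul_lt_one hp hq)
  rw [regGamma]
  simp only [mul_one, div_one]
  field_simp

theorem continuousAt_regGamma {z : ℂ} (hz0 : z ≠ 0) (hz : ‖z‖ ≤ 1) :
    ContinuousAt (regGamma p q) z := by
  have h1 := (differentiable_dblPoch hp hq).continuous
  have h2 := (differentiable_qPoch hp).continuous
  have h3 := (differentiable_qPoch hq).continuous
  have hb : ∀ {a : ℂ}, ‖a‖ < 1 → ‖a * z‖ < 1 := fun ha => by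
    rw [norm_mul]
    exact mul_lt_one_of_nonneg_of_lt_one_left (norm_nonneg _) ha hz
  refine ContinuousAt.div ?_ ?_ ?_
  · exact h1.continuousAt.comp (f := fun z => p * q / z)
      (continuousAt_const.div continuousAt_id hz0)
  · exact ((h2.comp (continuous_const_mul p)).mul (h3.comp (continuous_const_mul q))).mul
      (h1.comp (continuous_const_mul (p * q))) |>.continuousAt
  · exact mul_ne_zero (mul_ne_zero (qPoch_ne_zero hp (hb hp)) (qPoch_ne_zero hq (hb hq)))
      (dblPoch_ne_zero hp hq (hb (norm_mul_lt_one hp hq)))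

theorem continuousOn_regGamma_comp {X : Type*} [TopologicalSpace X] {f : X → ℂ} {s : Set X}
    (hf : ContinuousOn f s) (h0 : ∀ x ∈ s, f x ≠ 0) (h1 : ∀ x ∈ s, ‖f x‖ ≤ 1) :
    ContinuousOn (fun x => regGamma p q (f x)) s := fun x hx =>
  (continuousAt_regGamma hp hq (h0 x hx) (h1 x hx)).comp_continuousWithinAt (hf x hx)

end

/-- The integrand for `pinchVec`, up to the factor `peakKer`. -/
noncomputable def pinchFun (p q m c d e : ℂ) (r : ℝ) (z : ℂ) : ℂ :=
  eGammaPM p q (m / (r : ℂ) ^ 2) z * eGammaPM p q c z * eGammaPM p q d z * eGammaPM p q e z *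
    (regGamma p q (I * r * z) * regGamma p q (I * r * z⁻¹) *
      (regGamma p q (-(I * r) * z) * regGamma p q (-(I * r) * z⁻¹))) * betaKer p q z

section

include hp hq

theorem betaInt_pinchVec (m c d e : ℂ) (r : ℝ) : betaInt p q (pinchVec m c d e r) =
    ∮ z in C(0, 1), pinchFun p q m c d e r z / peakKer r z / z := by
  refine circleIntegral.integral_congr zero_le_one fun z _ => ?_
  have hk : peakKer r z = (1 - I * r * z) * (1 - -(I * r) * z) *
      ((1 - I * r * z⁻¹) * (1 - -(I * r) * z⁻¹)) := by
    rw [peakKer]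
    have hI := Complex.I_sq
    linear_combination (r ^ 2 * z ^ 2 * (1 - I ^ 2 * r ^ 2 * z⁻¹ ^ 2) + r ^ 2 * z⁻¹ ^ 2 *
      (1 + r ^ 2 * z ^ 2)) * hI
  simp only [pinchVec, Fin.prod_univ_six, Matrix.cons_val, pinchFun]
  rw [eGammaPM, eGammaPM, eGammaPM, eGammaPM, eGammaPM, eGammaPM, hk,
    eGamma_eq_regGamma_div hp hq (I * r * z), eGamma_eq_regGamma_div hp hq (I * r * z⁻¹),
    eGamma_eq_regGamma_div hp hq (-(I * r) * z), eGamma_eq_regGamma_div hp hq (-(I * r) * z⁻¹)]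
  simp only [div_eq_mul_inv, mul_inv]
  ring

theorem continuousOn_pinchFun {m c d e : ℂ} {r₀ : ℝ} (hr₀ : 0 < r₀) (hm : ‖m‖ < r₀ ^ 2)
    (h0 : m ≠ 0 ∧ c ≠ 0 ∧ d ≠ 0 ∧ e ≠ 0) (h1 : ‖c‖ < 1 ∧ ‖d‖ < 1 ∧ ‖e‖ < 1) :
    ContinuousOn (Function.uncurry (pinchFun p q m c d e))
      (Set.Icc r₀ 1 ×ˢ Metric.sphere 0 1) := by
  obtain ⟨m0, c0, d0, e0⟩ := h0
  obtain ⟨c1, d1, e1⟩ := h1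
  set S : Set (ℝ × ℂ) := Set.Icc r₀ 1 ×ˢ Metric.sphere 0 1
  have hz : ∀ x ∈ S, ‖x.2‖ = 1 := fun x hx => by simpa using hx.2
  have hr : ∀ x ∈ S, (x.1 : ℂ) ≠ 0 := fun x hx => by
    have := hr₀.trans_le hx.1.1
    exact_mod_cast this.ne'
  have hzc : ContinuousOn (fun x : ℝ × ℂ => x.2) S := continuousOn_snd
  have hzi : ContinuousOn (fun x : ℝ × ℂ => x.2⁻¹) S :=
    hzc.inv₀ fun x hx => ne_zero_of_norm_eq_one (hz x hx)
  have hrc : ContinuousOn (fun x : ℝ × ℂ => (x.1 : ℂ)) S := by fun_prop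
  have hconst : ∀ t : ℂ, t ≠ 0 → ‖t‖ < 1 → ContinuousOn (fun x : ℝ × ℂ => eGammaPM p q t x.2) S :=
    fun t t0 t1 => continuousOn_eGammaPM_comp hp hq continuousOn_const hzc (fun _ _ => t0)
      (fun _ _ => t1) hz
  have hreg : ∀ {a : ℂ} {f : ℝ × ℂ → ℂ}, ‖a‖ = 1 → ContinuousOn f S → (∀ x ∈ S, ‖f x‖ = 1) →
      ContinuousOn (fun x : ℝ × ℂ => regGamma p q (a * x.1 * f x)) S := by
    intro a f ha hf hf1
    refine continuousOn_regGamma_comp hp hq (by fun_prop) (fun x hx => ?_) fun x hx => ?_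
    · exact mul_ne_zero (mul_ne_zero (ne_zero_of_norm_eq_one ha) (hr x hx))
        (ne_zero_of_norm_eq_one (hf1 x hx))
    · rw [norm_mul, norm_mul, ha, hf1 x hx, one_mul, mul_one, Complex.norm_real, Real.norm_eq_abs,
        abs_of_pos (hr₀.trans_le hx.1.1)]
      exact hx.1.2
  have hi : ∀ x ∈ S, ‖x.2⁻¹‖ = 1 := fun x hx => norm_inv_eq_one (hz x hx)
  have hmI : ‖-I‖ = 1 := by simp
  refine ((((ContinuousOn.mul ?_ (hconst c c0 c1)).mul (hconst d d0 d1)).mul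
    (hconst e e0 e1)).mul (((hreg Complex.norm_I hzc hz).mul (hreg Complex.norm_I hzi hi)).mul
      ((?_ : ContinuousOn (fun x : ℝ × ℂ => regGamma p q (-(I * x.1) * x.2)) S).mul
        (?_ : ContinuousOn (fun x : ℝ × ℂ => regGamma p q (-(I * x.1) * x.2⁻¹)) S)))).mul
    (continuousOn_betaKer_comp hp hq hzc hz)
  · refine continuousOn_eGammaPM_comp hp hq (continuousOn_const.div (hrc.pow 2) ?_) hzc ?_ ?_ hz
    · exact fun x hx => pow_ne_zero 2 (hr x hx)
    · exact fun x hx => div_ne_zero m0 (pow_ne_zero 2 (hr x hx))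
    · intro x hx
      have hx0 : 0 < x.1 := hr₀.trans_le hx.1.1
      rw [norm_div, norm_pow, Complex.norm_real, Real.norm_eq_abs, sq_abs,
        div_lt_one (by positivity)]
      exact hm.trans_le (pow_le_pow_left₀ hr₀.le hx.1.1 2)
  · simpa only [neg_mul] using hreg hmI hzc hz
  · simpa only [neg_mul] using hreg hmI hzi hi

/-- At `z = ±i` two of the regularized gammas are taken at `1` and two at `-1`. The latter equal
`2Γ(-1)` each, and `betaKer` is `Γ(-1)⁻²` there, which leaves the factor `4`. -/
theorem tendsto_betaInt_pinchVec {m c d e : ℂ} (h0 : m ≠ 0 ∧ c ≠ 0 ∧ d ≠ 0 ∧ e ≠ 0)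
    (h1 : ‖m‖ < 1 ∧ ‖c‖ < 1 ∧ ‖d‖ < 1 ∧ ‖e‖ < 1) :
    Tendsto (fun r : ℝ => (1 - r ^ 4 : ℂ) * betaInt p q (pinchVec m c d e r)) (𝓝[<] 1)
      (𝓝 (2 * Real.pi * I * (eGammaPM p q m I * eGammaPM p q c I * eGammaPM p q d I *
        eGammaPM p q e I * (4 * regGamma p q 1 ^ 2)))) := by
  obtain ⟨r₀, hr₀, hr₁, hm⟩ : ∃ r₀ : ℝ, 0 < r₀ ∧ r₀ < 1 ∧ ‖m‖ < r₀ ^ 2 := by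
    obtain ⟨y, hy1, hy2⟩ := exists_between h1.1
    have hy0 : 0 < y := (norm_nonneg _).trans_lt hy1
    refine ⟨Real.sqrt y, Real.sqrt_pos.2 hy0, ?_, ?_⟩
    · rw [Real.sqrt_lt' one_pos]; simpa using hy2
    · rwa [Real.sq_sqrt hy0.le]
  simp_rw [betaInt_pinchVec hp hq]
  have hθ : eGamma p q (-1) ≠ 0 := by
    have hn1 : ‖(-1 : ℂ)‖ = 1 := by simp
    have h := inv_eGamma_mul_eGamma_inv hp hq hn1
    have t1 : theta p (-1) ≠ 0 :=
      theta_ne_zero hp (by simpa using hp) (by simpa using hp) (by norm_num)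
    have t2 : theta q (-1)⁻¹ ≠ 0 :=
      theta_ne_zero hq (by simpa using hq) (by simpa using hq) (by norm_num)
    intro h0
    rw [h0, zero_mul, inv_zero] at h
    exact mul_ne_zero t1 t2 h.symm
  have hker : betaKer p q I = (eGamma p q (-1) * eGamma p q (-1))⁻¹ := by
    have h := inv_eGamma_mul_eGamma_inv hp hq (y := -1) (by simp)
    rw [betaKer, inv_pow, Complex.I_sq, ← h]
    norm_num
  have hker' : betaKer p q (-I) = betaKer p q I := by
    rw [betaKer, betaKer]
    congr 2
    · ring
    · rw [inv_neg]; ring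
  have hreg : regGamma p q (-1) = 2 * eGamma p q (-1) := by
    rw [eGamma_eq_regGamma_div hp hq (-1)]; norm_num
    ring
  have hII : I * I = -1 := Complex.I_mul_I
  refine tendsto_circleIntegral_peakKer hr₀ hr₁
    (continuousOn_pinchFun hp hq hr₀ hm h0 ⟨h1.2.1, h1.2.2.1, h1.2.2.2⟩) ?_ ?_
  · simp only [pinchFun, ofReal_one, one_pow, div_one, mul_one, hker, hII, Complex.inv_I, mul_neg,
      neg_mul, neg_neg, hreg]
    field_simp
    ring
  · simp only [pinchFun, ofReal_one, one_pow, div_one, mul_one, hker', hker, hII, Complex.inv_I,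
      mul_neg, neg_mul, neg_neg, hreg, inv_neg, eGammaPM]
    field_simp
    ring

/-- The product for `pinchVec`, without the factor that degenerates as `r → 1`. -/
noncomputable def pinchProd (p q m c d e : ℂ) (r : ℝ) : ℂ :=
  (eGamma p q (m / (r : ℂ) ^ 2 * -(I * r)) * eGamma p q (m / (r : ℂ) ^ 2 * (I * r))) *
  ((eGamma p q (m / (r : ℂ) ^ 2 * c) * eGamma p q (d * e)) *
  (eGamma p q (m / (r : ℂ) ^ 2 * d) * eGamma p q (c * e)) *
  (eGamma p q (m / (r : ℂ) ^ 2 * e) * eGamma p q (c * d))) *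
  ((eGamma p q (-(I * r) * c) * eGamma p q (c * (I * r))) *
  (eGamma p q (-(I * r) * d) * eGamma p q (d * (I * r))) *
  (eGamma p q (-(I * r) * e) * eGamma p q (e * (I * r))))

theorem continuousAt_pinchProd {m c d e : ℂ} (h0 : m ≠ 0 ∧ c ≠ 0 ∧ d ≠ 0 ∧ e ≠ 0)
    (h1 : ‖m‖ < 1 ∧ ‖c‖ < 1 ∧ ‖d‖ < 1 ∧ ‖e‖ < 1) : ContinuousAt (pinchProd p q m c d e) 1 := by
  obtain ⟨m0, c0, d0, e0⟩ := h0
  obtain ⟨m1, c1, d1, e1⟩ := h1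
  have hr : ContinuousAt (fun r : ℝ => (r : ℂ)) 1 := by fun_prop
  have hmr : ContinuousAt (fun r : ℝ => m / (r : ℂ) ^ 2) 1 :=
    continuousAt_const.div (hr.pow 2) (by simp)
  have hIr : ContinuousAt (fun r : ℝ => I * (r : ℂ)) 1 := by fun_prop
  have hg : ∀ {g : ℝ → ℂ}, ContinuousAt g 1 → g 1 ≠ 0 → ‖g 1‖ < 1 →
      ContinuousAt (fun r => eGamma p q (g r)) 1 := fun hg h0 h1 =>
    ContinuousAt.comp (continuousAt_eGamma hp hq h0 h1) hg
  have hmi : ContinuousAt (fun r : ℝ => eGamma p q (m / (r : ℂ) ^ 2 * -(I * r))) 1 :=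
    hg (hmr.mul hIr.neg) (by simpa using m0) (by simpa using m1)
  have hmi' : ContinuousAt (fun r : ℝ => eGamma p q (m / (r : ℂ) ^ 2 * (I * r))) 1 :=
    hg (hmr.mul hIr) (by simpa using m0) (by simpa using m1)
  have hm : ∀ x y : ℂ, x ≠ 0 → ‖x‖ < 1 →
      ContinuousAt (fun r : ℝ => eGamma p q (m / (r : ℂ) ^ 2 * x) * eGamma p q y) 1 :=
    fun x y x0 x1 => (hg (hmr.mul continuousAt_const) (by simpa using ⟨m0, x0⟩)
      (by simpa using norm_mul_lt_one m1 x1)).mul continuousAt_const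
  have hi : ∀ x : ℂ, x ≠ 0 → ‖x‖ < 1 → ContinuousAt
      (fun r : ℝ => eGamma p q (-(I * r) * x) * eGamma p q (x * (I * r))) 1 :=
    fun x x0 x1 => (hg (hIr.neg.mul continuousAt_const) (by simpa using x0)
      (by simpa using x1)).mul (hg (continuousAt_const.mul hIr) (by simpa using x0)
      (by simpa using x1))
  exact ((hmi.mul hmi').mul (((hm c (d * e) c0 c1).mul (hm d (c * e) d0 d1)).mul
    (hm e (c * d) e0 e1))).mul (((hi c c0 c1).mul (hi d d0 d1)).mul (hi e e0 e1))

/-- Since `mcde = pq`, the factors not involving `±i` cancel in pairs by reflection. -/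
theorem pinchProd_one {m c d e : ℂ} (h0 : m ≠ 0 ∧ c ≠ 0 ∧ d ≠ 0 ∧ e ≠ 0)
    (h1 : ‖m‖ < 1 ∧ ‖c‖ < 1 ∧ ‖d‖ < 1 ∧ ‖e‖ < 1) (hprod : m * c * d * e = p * q) :
    pinchProd p q m c d e 1 = eGammaPM p q m I * eGammaPM p q c I * eGammaPM p q d I *
        eGammaPM p q e I := by
  obtain ⟨m0, c0, d0, e0⟩ := h0
  obtain ⟨m1, c1, d1, e1⟩ := h1
  have k1 : eGamma p q (m * c) * eGamma p q (d * e) = 1 :=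
    eGamma_mul_eGamma hp hq (norm_mul_lt_one m1 c1) (norm_mul_lt_one d1 e1)
      (mul_ne_zero m0 c0) (mul_ne_zero d0 e0) (by rw [← hprod]; ring)
  have k2 : eGamma p q (m * d) * eGamma p q (c * e) = 1 :=
    eGamma_mul_eGamma hp hq (norm_mul_lt_one m1 d1) (norm_mul_lt_one c1 e1)
      (mul_ne_zero m0 d0) (mul_ne_zero c0 e0) (by rw [← hprod]; ring)
  have k3 : eGamma p q (m * e) * eGamma p q (c * d) = 1 :=
    eGamma_mul_eGamma hp hq (norm_mul_lt_one m1 e1) (norm_mul_lt_one c1 d1)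
      (mul_ne_zero m0 e0) (mul_ne_zero c0 d0) (by rw [← hprod]; ring)
  rw [pinchProd]
  simp only [ofReal_one, one_pow, div_one, mul_one, eGammaPM, Complex.inv_I]
  rw [k1, k2, k3, mul_comm (-I) c, mul_comm (-I) d, mul_comm (-I) e]
  ring

/-- The only singular factor is `Γ(r²)`, from `-(ir)(ir) = r²`, and `(1 - r⁴)Γ(r²) = (1 + r²)
regGamma(r²)`. -/
theorem tendsto_betaProd_pinchVec {m c d e : ℂ} (h0 : m ≠ 0 ∧ c ≠ 0 ∧ d ≠ 0 ∧ e ≠ 0)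
    (h1 : ‖m‖ < 1 ∧ ‖c‖ < 1 ∧ ‖d‖ < 1 ∧ ‖e‖ < 1) (hprod : m * c * d * e = p * q) :
    Tendsto (fun r : ℝ => (1 - r ^ 4 : ℂ) * betaProd p q (pinchVec m c d e r)) (𝓝[<] 1)
      (𝓝 (2 * regGamma p q 1 * (eGammaPM p q m I * eGammaPM p q c I * eGammaPM p q d I *
        eGammaPM p q e I))) := by
  have hfc : ContinuousAt (fun r : ℝ => (1 + (r : ℂ) ^ 2) * regGamma p q ((r : ℂ) ^ 2) *
      pinchProd p q m c d e r) 1 := by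
    refine ContinuousAt.mul (ContinuousAt.mul (by fun_prop) ?_) (continuousAt_pinchProd hp hq h0 h1)
    exact ContinuousAt.comp (f := fun r : ℝ => (r : ℂ) ^ 2)
      (continuousAt_regGamma hp hq (by simp) (by simp)) (by fun_prop)
  have ht := hfc.tendsto.mono_left (nhdsWithin_le_nhds (s := Set.Iio 1))
  simp only [pinchProd_one hp hq h0 h1 hprod, ofReal_one, one_pow, one_add_one_eq_two] at ht
  refine ht.congr' ?_
  filter_upwards [Ioo_mem_nhdsLT (zero_lt_one' ℝ)] with r hr
  have hr2 : (1 - (r : ℂ) ^ 2) ≠ 0 := by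
    have : 1 - r ^ 2 ≠ 0 := by nlinarith [hr.1, hr.2]
    exact_mod_cast this
  have hbf : -(I * (r : ℂ)) * (I * r) = (r : ℂ) ^ 2 := by
    linear_combination -(r : ℂ) ^ 2 * Complex.I_sq
  rw [pinchVec, betaProd_vec, hbf, eGamma_eq_regGamma_div hp hq ((r : ℂ) ^ 2), pinchProd]
  generalize regGamma p q ((r : ℂ) ^ 2) = g
  rw [show (1 - (r : ℂ) ^ 4) = (1 - (r : ℂ) ^ 2) * (1 + (r : ℂ) ^ 2) by ring]
  have hg : (1 - (r : ℂ) ^ 2) * (g / (1 - (r : ℂ) ^ 2)) = g := mul_div_cancel₀ _ hr2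
  generalize g / (1 - (r : ℂ) ^ 2) = g' at hg
  rw [← hg]
  ring

theorem tendsto_betaInt_div_betaProd_pinchVec {m c d e : ℂ}
    (h0 : m ≠ 0 ∧ c ≠ 0 ∧ d ≠ 0 ∧ e ≠ 0) (h1 : ‖m‖ < 1 ∧ ‖c‖ < 1 ∧ ‖d‖ < 1 ∧ ‖e‖ < 1)
    (hprod : m * c * d * e = p * q) :
    Tendsto (fun r : ℝ => betaInt p q (pinchVec m c d e r) / betaProd p q (pinchVec m c d e r))
      (𝓝[<] 1) (𝓝 (4 * Real.pi * I / (qPoch p p * qPoch q q))) := by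
  have hA := tendsto_betaInt_pinchVec hp hq h0 h1
  have hB := tendsto_betaProd_pinchVec hp hq h0 h1 hprod
  obtain ⟨m0, c0, d0, e0⟩ := h0
  obtain ⟨m1, c1, d1, e1⟩ := h1
  have hreg : regGamma p q 1 ≠ 0 := by
    rw [regGamma_one hp hq]
    exact inv_ne_zero (mul_ne_zero (qPoch_ne_zero hp hp) (qPoch_ne_zero hq hq))
  have hne : ∀ {x y z w : ℂ}, x ≠ 0 → ‖x‖ < 1 → ‖y‖ < 1 → ‖z‖ < 1 → ‖w‖ < 1 →
      x * (y * z * w) = p * q → eGammaPM p q x I ≠ 0 := by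
    intro x y z w x0 x1 y1 z1 w1 h
    have hI : ∀ i : ℂ, ‖i‖ = 1 → eGamma p q (x * i) ≠ 0 := fun i hi => by
      refine eGamma_ne_zero hp hq (norm_mul_lt_one_of_norm_eq_one x1 hi) ?_
      rw [← h, mul_div_mul_left _ _ x0, norm_div, hi, div_one]
      exact norm_mul_lt_one (norm_mul_lt_one y1 z1) w1
    exact mul_ne_zero (hI I Complex.norm_I) (hI I⁻¹ (norm_inv_eq_one Complex.norm_I))
  have n1 := hne m0 m1 c1 d1 e1 (by rw [← hprod]; ring)
  have n2 := hne c0 c1 m1 d1 e1 (by rw [← hprod]; ring)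
  have n3 := hne d0 d1 m1 c1 e1 (by rw [← hprod]; ring)
  have n4 := hne e0 e1 m1 c1 d1 (by rw [← hprod]; ring)
  have hP := mul_ne_zero (mul_ne_zero (mul_ne_zero n1 n2) n3) n4
  have h := hA.div hB (mul_ne_zero (mul_ne_zero two_ne_zero hreg) hP)
  have hval : ∀ P R : ℂ, P ≠ 0 → R ≠ 0 →
      2 * Real.pi * I * (P * (4 * R ^ 2)) / (2 * R * P) = 4 * Real.pi * I * R := by
    intro P R hP hR
    field_simp
  rw [hval _ _ hP hreg, regGamma_one hp hq, ← div_eq_mul_inv] at h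
  refine h.congr' ?_
  filter_upwards [Ioo_mem_nhdsLT (zero_lt_one' ℝ)] with r hr
  have hr4 : (1 - (r : ℂ) ^ 4) ≠ 0 := by
    have : 1 - r ^ 4 ≠ 0 := (sub_pos.2 (pow_lt_one₀ hr.1.le hr.2 four_ne_zero)).ne'
    exact_mod_cast this
  simp only [Pi.div_apply]
  exact mul_div_mul_left _ _ hr4

end

end

/-! ### The value of the elliptic beta integral for all admissible parameters. -/

section

variable {p q : ℂ} (hp0 : p ≠ 0) (hp : ‖p‖ < 1) (hq0 : q ≠ 0) (hq : ‖q‖ < 1)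

theorem betaInt_div_betaProd_swap (p q a b c d e f : ℂ) :
    betaInt p q ![a, b, c, d, e, f] / betaProd p q ![a, b, c, d, e, f] =
      betaInt p q ![a, f, c, d, e, b] / betaProd p q ![a, f, c, d, e, b] := by
  have h1 : betaInt p q ![a, b, c, d, e, f] = betaInt p q ![a, f, c, d, e, b] := by
    refine circleIntegral.integral_congr zero_le_one fun z _ => ?_
    simp only [Fin.prod_univ_six, Matrix.cons_val]
    ring
  have h2 : betaProd p q ![a, b, c, d, e, f] = betaProd p q ![a, f, c, d, e, b] := by
    rw [betaProd_vec, betaProd_vec, mul_comm f c, mul_comm f d, mul_comm f e, mul_comm f b,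
      mul_comm c b, mul_comm d b, mul_comm e b]
    ring
  rw [h1, h2]

include hp0 hp hq0 hq

/-- Two moves preserving the product of a pair reach `pinchVec`: first `(t₁, t₆)` becomes `(X,
-ir)`, then `(X, t₂)` becomes `(m/r², ir)` with `m = t₁t₆t₂`. The quotient is therefore equal to its
limit as `r → 1`. -/
theorem betaInt_div_betaProd_of_norm_mul_lt {t₁ t₂ t₃ t₄ t₅ t₆ : ℂ}
    (ht : IsBetaParam p q ![t₁, t₂, t₃, t₄, t₅, t₆]) (hlt : ‖t₁ * t₆‖ < ‖q‖) :
    betaInt p q ![t₁, t₂, t₃, t₄, t₅, t₆] / betaProd p q ![t₁, t₂, t₃, t₄, t₅, t₆] =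
      4 * Real.pi * I / (qPoch p p * qPoch q q) := by
  have ht' := ht
  rw [isBetaParam_vec] at ht'
  obtain ⟨⟨n1, n2, n3, n4, n5, n6⟩, ⟨l1, l2, l3, l4, l5, l6⟩, hprod⟩ := ht'
  have hm0 : t₁ * t₆ * t₂ ≠ 0 := mul_ne_zero (mul_ne_zero n1 n6) n2
  have hm1 : ‖t₁ * t₆ * t₂‖ < 1 := norm_mul_lt_one (norm_mul_lt_one l1 l6) l2
  have hT := tendsto_betaInt_div_betaProd_pinchVec hp hq ⟨hm0, n3, n4, n5⟩ ⟨hm1, l3, l4, l5⟩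
    (by rw [← hprod]; ring)
  refine tendsto_nhds_unique (tendsto_const_nhds.congr' ?_) hT
  -- Ensures `|X| < |q|`, so that the second move is allowed as well.
  have e1 : ∀ᶠ r : ℝ in 𝓝[<] 1, ‖t₁ * t₆‖ < ‖q‖ * r :=
    nhdsWithin_le_nhds ((continuous_const.mul continuous_id).continuousAt.eventually_const_lt
      (by simpa using hlt))
  have e2 : ∀ᶠ r : ℝ in 𝓝[<] 1, ‖t₁ * t₆ * t₂‖ < r ^ 2 :=
    nhdsWithin_le_nhds ((continuous_id.pow 2).continuousAt.eventually_const_lt (by simpa using hm1))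
  filter_upwards [e1, e2, Ioo_mem_nhdsLT (zero_lt_one' ℝ)] with r h1 h2 hr
  have hr0 : (r : ℂ) ≠ 0 := by exact_mod_cast hr.1.ne'
  have hI0 : I * r ≠ 0 := mul_ne_zero I_ne_zero hr0
  have hIn : ‖I * r‖ = r := by simp [abs_of_pos hr.1]
  have hIl : ‖I * r‖ < 1 := hIn.trans_lt hr.2
  have hII : -(I * (r : ℂ)) * (I * r) = (r : ℂ) ^ 2 := by
    linear_combination -(r : ℂ) ^ 2 * Complex.I_sq
  set X := t₁ * t₆ / -(I * r) with hX
  have hX0 : X ≠ 0 := div_ne_zero (mul_ne_zero n1 n6) (neg_ne_zero.2 hI0)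
  have hXm : X * -(I * r) = t₁ * t₆ := div_mul_cancel₀ _ (neg_ne_zero.2 hI0)
  have hXq : ‖X‖ < ‖q‖ := by
    rwa [hX, norm_div, norm_neg, hIn, div_lt_iff₀ hr.1]
  have hX1 : ‖X‖ < 1 := hXq.trans hq
  have hmr : t₁ * t₆ * t₂ / (r : ℂ) ^ 2 * (I * r) = X * t₂ := by
    rw [← hXm, ← hII]
    field_simp
  have hmr1 : ‖t₁ * t₆ * t₂ / (r : ℂ) ^ 2‖ < 1 := by
    rw [norm_div, norm_pow, norm_real, Real.norm_eq_abs, sq_abs, div_lt_one (pow_pos hr.1 2)]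
    exact h2
  have hA : IsBetaParam p q ![X, t₂, t₃, t₄, t₅, -(I * r)] := by
    rw [isBetaParam_vec]
    refine ⟨⟨hX0, n2, n3, n4, n5, neg_ne_zero.2 hI0⟩, ⟨hX1, l2, l3, l4, l5, ?_⟩, ?_⟩
    · rwa [norm_neg]
    · linear_combination hprod + t₂ * t₃ * t₄ * t₅ * hXm
  have hB : IsBetaParam p q ![X, -(I * r), t₃, t₄, t₅, t₂] := by
    rw [isBetaParam_vec] at hA ⊢
    refine ⟨⟨hX0, hA.1.2.2.2.2.2, n3, n4, n5, n2⟩, ⟨hX1, hA.2.1.2.2.2.2.2, l3, l4, l5, l2⟩, ?_⟩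
    rw [← hA.2.2]
    ring
  have hC : IsBetaParam p q ![t₁ * t₆ * t₂ / (r : ℂ) ^ 2, -(I * r), t₃, t₄, t₅, I * r] := by
    rw [isBetaParam_vec] at hB ⊢
    refine ⟨⟨div_ne_zero hm0 (pow_ne_zero 2 hr0), hB.1.2.1, n3, n4, n5, hI0⟩,
      ⟨hmr1, hB.2.1.2.1, l3, l4, l5, hIl⟩, ?_⟩
    rw [← hB.2.2]
    linear_combination -(I * r) * t₃ * t₄ * t₅ * hmr
  rw [pinchVec, betaInt_div_betaProd_eq hp0 hp hq0 hq ht hA hlt, betaInt_div_betaProd_swap,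
    betaInt_div_betaProd_eq hp0 hp hq0 hq hB hC]
  rw [norm_mul]
  exact (mul_le_of_le_one_right (norm_nonneg X) l2.le).trans_lt hXq

theorem betaInt_div_betaProd {t₁ t₂ t₃ t₄ t₅ t₆ : ℂ}
    (ht : IsBetaParam p q ![t₁, t₂, t₃, t₄, t₅, t₆]) :
    betaInt p q ![t₁, t₂, t₃, t₄, t₅, t₆] / betaProd p q ![t₁, t₂, t₃, t₄, t₅, t₆] =
      4 * Real.pi * I / (qPoch p p * qPoch q q) := by
  have ht' := ht
  rw [isBetaParam_vec] at ht'
  obtain ⟨⟨n1, n2, n3, n4, n5, n6⟩, ⟨l1, l2, l3, l4, l5, l6⟩, hprod⟩ := ht'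
  have hlog : ∀ {x : ℂ}, x ≠ 0 → ‖x‖ < 1 → Real.log ‖x‖ < 0 := fun h0 h1 =>
    Real.log_neg (norm_pos_iff.2 h0) h1
  have g1 := hlog n1 l1
  have g2 := hlog n2 l2
  have g3 := hlog n3 l3
  have g4 := hlog n4 l4
  have g5 := hlog n5 l5
  have g6 := hlog n6 l6
  set S : ℝ := Real.log ‖t₂‖ + Real.log ‖t₃‖ + Real.log ‖t₄‖ + Real.log ‖t₅‖ with hS
  have hS0 : S < 0 := by linarith
  -- The bound on `Re σ` that keeps `|t₁ exp (Sσ)| < 1`.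
  set A : ℝ := -(Real.log ‖t₁‖ / S) with hA
  have hA0 : A < 0 := neg_lt_zero.2 (div_pos_of_neg_of_neg g1 hS0)
  have hnorm : ∀ {x : ℂ} (L : ℝ) (σ : ℂ), x ≠ 0 →
      ‖x * exp (L * σ)‖ = Real.exp (Real.log ‖x‖ + L * σ.re) := by
    intro x L σ hx
    rw [norm_mul, Complex.norm_exp, Real.exp_add, Real.exp_log (norm_pos_iff.2 hx)]
    simp
  have hn0 : ∀ {x : ℂ} (L : ℝ) (σ : ℂ), x ≠ 0 → x * exp (L * σ) ≠ 0 := fun L σ hx =>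
    mul_ne_zero hx (exp_ne_zero _)
  -- The product is fixed. As `Re σ → 1` the moduli of the four middle parameters tend to `1`, so
  -- `|t₁t₆|` tends to `|pq| < |q|` and the restricted case applies.
  set v : ℂ → Fin 6 → ℂ := fun σ => ![t₁ * exp ((S : ℝ) * σ),
    t₂ * exp ((-Real.log ‖t₂‖ : ℝ) * σ), t₃ * exp ((-Real.log ‖t₃‖ : ℝ) * σ),
    t₄ * exp ((-Real.log ‖t₄‖ : ℝ) * σ), t₅ * exp ((-Real.log ‖t₅‖ : ℝ) * σ), t₆] with hv
  set U : Set ℂ := {σ : ℂ | A < σ.re ∧ σ.re < 1} with hU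
  have hUo : IsOpen U := isOpen_strip A 1
  have hvU : ∀ σ ∈ U, IsBetaParam p q (v σ) := by
    intro σ hσ
    have hj : ∀ {x : ℂ}, x ≠ 0 → ‖x‖ < 1 → ‖x * exp ((-Real.log ‖x‖ : ℝ) * σ)‖ < 1 := by
      intro x x0 x1
      rw [hnorm _ _ x0, Real.exp_lt_one_iff]
      have := hlog x0 x1
      nlinarith [hσ.2]
    simp only [hv]
    rw [isBetaParam_vec]
    refine ⟨⟨hn0 _ _ n1, hn0 _ _ n2, hn0 _ _ n3, hn0 _ _ n4, hn0 _ _ n5, n6⟩,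
      ⟨?_, hj n2 l2, hj n3 l3, hj n4 l4, hj n5 l5, l6⟩, ?_⟩
    · rw [hnorm _ _ n1, Real.exp_lt_one_iff]
      have h1 := hσ.1
      rw [hA, neg_lt, lt_div_iff_of_neg hS0] at h1
      linarith
    · have he : exp ((S : ℝ) * σ) * exp ((-Real.log ‖t₂‖ : ℝ) * σ) *
          exp ((-Real.log ‖t₃‖ : ℝ) * σ) * exp ((-Real.log ‖t₄‖ : ℝ) * σ) *
          exp ((-Real.log ‖t₅‖ : ℝ) * σ) = 1 := by
        rw [← exp_add, ← exp_add, ← exp_add, ← exp_add, ← exp_zero, hS]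
        congr 1
        push_cast
        ring
      linear_combination hprod + t₁ * t₂ * t₃ * t₄ * t₅ * t₆ * he
  have hd : DifferentiableOn ℂ (fun σ => betaInt p q (v σ) / betaProd p q (v σ)) U := by
    refine differentiableOn_betaInt_div_betaProd hp hq hUo (fun j => ?_) hvU
    fin_cases j <;> simp only [hv] <;> simp <;> fun_prop
  -- The value of `Re σ` at which the product of the first and last parameters has modulus `|q|`; `B
  -- < 1` amounts to `|p| < 1`.
  set B : ℝ := (Real.log ‖q‖ - Real.log ‖t₁ * t₆‖) / S with hB
  have h16 : t₁ * t₆ ≠ 0 := mul_ne_zero n1 n6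
  have hB1 : B < 1 := by
    have h : Real.log ‖t₁ * t₆‖ + S = Real.log ‖p‖ + Real.log ‖q‖ := by
      have h2 : Real.log ‖p * q‖ = Real.log ‖t₁ * t₂ * t₃ * t₄ * t₅ * t₆‖ := by rw [hprod]
      simp only [norm_mul] at h2 ⊢
      have z := fun {x : ℂ} (h : x ≠ 0) => norm_ne_zero_iff.2 h
      rw [Real.log_mul (z hp0) (z hq0), Real.log_mul (by simp [*]) (z n6),
        Real.log_mul (by simp [*]) (z n5), Real.log_mul (by simp [*]) (z n4),
        Real.log_mul (by simp [*]) (z n3), Real.log_mul (z n1) (z n2)] at h2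
      rw [Real.log_mul (z n1) (z n6)]
      linarith
    rw [hB, div_lt_one_of_neg hS0]
    linarith [hlog hp0 hp]
  have hbase : ∀ σ ∈ U, B < σ.re → betaInt p q (v σ) / betaProd p q (v σ) =
      4 * Real.pi * I / (qPoch p p * qPoch q q) := by
    intro σ hσ hσB
    refine betaInt_div_betaProd_of_norm_mul_lt hp0 hp hq0 hq (hvU σ hσ) ?_
    rw [mul_right_comm, hnorm _ _ h16, ← Real.exp_log (norm_pos_iff.2 hq0), Real.exp_lt_exp]
    rw [hB, div_lt_iff_of_neg hS0] at hσB
    linarith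
  obtain ⟨y, hy1, hy2⟩ := exists_between (max_lt hB1 (hA0.trans one_pos))
  have hyU : (y : ℂ) ∈ U := ⟨by simpa using (le_max_right _ _).trans_lt hy1, by simpa using hy2⟩
  have hyB : {σ : ℂ | B < σ.re} ∈ 𝓝 (y : ℂ) :=
    (isOpen_lt continuous_const Complex.continuous_re).mem_nhds
      (by simpa using (le_max_left _ _).trans_lt hy1)
  have hev : (fun σ => betaInt p q (v σ) / betaProd p q (v σ)) =ᶠ[𝓝 (y : ℂ)]
      fun _ => 4 * Real.pi * I / (qPoch p p * qPoch q q) := by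
    filter_upwards [hUo.mem_nhds hyU, hyB] with σ h1 h2 using hbase σ h1 h2
  have h0U : (0 : ℂ) ∈ U := ⟨by simpa using hA0, by simp⟩
  have h := (hd.analyticOnNhd hUo).eqOn_of_preconnected_of_eventuallyEq
    (analyticOnNhd_const (v := 4 * Real.pi * I / (qPoch p p * qPoch q q)))
    (isPreconnected_strip A 1) hyU hev h0U
  simpa [hv] using h

/-- **The elliptic beta integral.** -/
theorem kappa_mul_betaInt {t₁ t₂ t₃ t₄ t₅ t₆ : ℂ}
    (ht : IsBetaParam p q ![t₁, t₂, t₃, t₄, t₅, t₆]) :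
    kappa p q * betaInt p q ![t₁, t₂, t₃, t₄, t₅, t₆] =
      betaProd p q ![t₁, t₂, t₃, t₄, t₅, t₆] := by
  have h := betaInt_div_betaProd hp0 hp hq0 hq ht
  rw [div_eq_iff (betaProd_ne_zero hp hq ht)] at h
  have h1 := qPoch_ne_zero hp hp
  have h2 := qPoch_ne_zero hq hq
  have h3 : (Real.pi : ℂ) ≠ 0 := by exact_mod_cast Real.pi_ne_zero
  rw [h, kappa]
  field_simp [I_ne_zero]

end

/-! ### The integral transform of the basis vectors -/

section

variable {p q : ℂ} (hp0 : p ≠ 0) (hp : ‖p‖ < 1) (hq0 : q ≠ 0) (hq : ‖q‖ < 1)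

theorem eGammaPM_mul_comm (p q t w z : ℂ) :
    eGammaPM p q (t * w) z * eGammaPM p q (t * w⁻¹) z =
      eGammaPM p q (t * z) w * eGammaPM p q (t * z⁻¹) w := by
  simp only [eGammaPM, mul_right_comm t w, mul_right_comm t w⁻¹]
  ring

include hp hq

/-- Reflection pairs `xz` with `y/z` and `x/z` with `yz`. -/
theorem eGammaPM_mul_eGammaPM {x y z : ℂ} (hx : ‖x * z‖ < 1) (hx' : ‖x * z⁻¹‖ < 1)
    (hy : ‖y * z‖ < 1) (hy' : ‖y * z⁻¹‖ < 1) (hx0 : x ≠ 0) (hy0 : y ≠ 0) (hz0 : z ≠ 0)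
    (h : x * y = p * q) : eGammaPM p q x z * eGammaPM p q y z = 1 := by
  have hi := inv_ne_zero hz0
  have e1 := eGamma_mul_eGamma hp hq hx hy' (mul_ne_zero hx0 hz0) (mul_ne_zero hy0 hi)
    (by rw [mul_mul_mul_comm, mul_inv_cancel₀ hz0, mul_one, h])
  have e2 := eGamma_mul_eGamma hp hq hx' hy (mul_ne_zero hx0 hi) (mul_ne_zero hy0 hz0)
    (by rw [mul_mul_mul_comm, inv_mul_cancel₀ hz0, mul_one, h])
  rw [eGammaPM, eGammaPM]
  linear_combination e1 * (eGamma p q (x * z⁻¹) * eGamma p q (y * z)) + e2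

/-- The value of the inner beta integral, times the factors it cancels. -/
theorem betaProd_left_mul {a b s u ξ z : ℂ} (ha0 : a ≠ 0) (hb0 : b ≠ 0) (hs0 : s ≠ 0)
    (hu0 : u ≠ 0) (hξ0 : ξ ≠ 0) (hu : a * b * u ^ 2 = p * q) (hξ : ‖u * ξ‖ < 1)
    (hξ' : ‖u * ξ⁻¹‖ < 1) (ha : ‖p * q / a‖ < 1) (hb : ‖p * q / b‖ < 1) (hsu : ‖s / u‖ < 1)
    (hau : ‖a * u / s‖ < 1) (hbu : ‖b * u / s‖ < 1) (hz : ‖z‖ = 1) :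
    betaProd p q ![a * u / s, b * u / s, s / u * z, s / u * z⁻¹, u * ξ, u * ξ⁻¹] *
      (eGammaPM p q (p * q / a) z * eGammaPM p q (p * q / b) z) *
      (eGammaPM p q (s * a) ξ * eGammaPM p q (s * b) ξ) =
    eGamma p q (p * q / s ^ 2) * eGamma p q (s ^ 2 / u ^ 2) * eGamma p q (u ^ 2) *
      (eGammaPM p q (s * ξ) z * eGammaPM p q (s * ξ⁻¹) z) := by
  have hz0 := ne_zero_of_norm_eq_one hz
  have hz' := norm_inv_eq_one hz
  -- The bounds on `a` and `b` come from `a = (au/s)(s/u)` and its analogue for `b`.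
  have na : ‖a‖ < 1 := by
    have := norm_mul_lt_one hau hsu
    rwa [show a * u / s * (s / u) = a by field_simp] at this
  have nb : ‖b‖ < 1 := by
    have := norm_mul_lt_one hbu hsu
    rwa [show b * u / s * (s / u) = b by field_simp] at this
  have hs : ∀ y : ℂ, ‖u * y‖ < 1 → ‖s * y‖ < 1 := fun y hy => by
    have := norm_mul_lt_one hsu hy
    rwa [show s / u * (u * y) = s * y by field_simp] at this
  have hsa : ∀ t y : ℂ, ‖t‖ < 1 → ‖u * y‖ < 1 → ‖s * t * y‖ < 1 := fun t y ht hy => by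
    have := norm_mul_lt_one ht (hs y hy)
    rwa [show t * (s * y) = s * t * y by ring] at this
  have hap : ∀ t y : ℂ, ‖t * u / s‖ < 1 → ‖u * y‖ < 1 → ‖t * u ^ 2 / s * y‖ < 1 :=
    fun t y ht hy => by
      have := norm_mul_lt_one ht hy
      rwa [show t * u / s * (u * y) = t * u ^ 2 / s * y by ring] at this
  have hpq : p * q ≠ 0 := hu ▸ mul_ne_zero (mul_ne_zero ha0 hb0) (pow_ne_zero 2 hu0)
  have k1 : eGammaPM p q a z * eGammaPM p q (p * q / a) z = 1 :=
    eGammaPM_mul_eGammaPM hp hq (norm_mul_lt_one_of_norm_eq_one na hz)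
      (norm_mul_lt_one_of_norm_eq_one na hz') (norm_mul_lt_one_of_norm_eq_one ha hz)
      (norm_mul_lt_one_of_norm_eq_one ha hz') ha0 (div_ne_zero hpq ha0) hz0
      (mul_div_cancel₀ _ ha0)
  have k2 : eGammaPM p q b z * eGammaPM p q (p * q / b) z = 1 :=
    eGammaPM_mul_eGammaPM hp hq (norm_mul_lt_one_of_norm_eq_one nb hz)
      (norm_mul_lt_one_of_norm_eq_one nb hz') (norm_mul_lt_one_of_norm_eq_one hb hz)
      (norm_mul_lt_one_of_norm_eq_one hb hz') hb0 (div_ne_zero hpq hb0) hz0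
      (mul_div_cancel₀ _ hb0)
  -- The products of `au/s` with `uξ^±` cancel the factors of the basis vector that contain `b`,
  -- since `(au²/s)(sb) = pq`; `k4` is the same with `a` and `b` exchanged.
  have k3 : eGammaPM p q (a * u ^ 2 / s) ξ * eGammaPM p q (s * b) ξ = 1 :=
    eGammaPM_mul_eGammaPM hp hq (hap _ _ hau hξ) (hap _ _ hau hξ') (hsa _ _ nb hξ) (hsa _ _ nb hξ')
      (div_ne_zero (mul_ne_zero ha0 (pow_ne_zero 2 hu0)) hs0) (mul_ne_zero hs0 hb0) hξ0
      (by rw [← hu]; field_simp)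
  have k4 : eGammaPM p q (b * u ^ 2 / s) ξ * eGammaPM p q (s * a) ξ = 1 :=
    eGammaPM_mul_eGammaPM hp hq (hap _ _ hbu hξ) (hap _ _ hbu hξ') (hsa _ _ na hξ) (hsa _ _ na hξ')
      (div_ne_zero (mul_ne_zero hb0 (pow_ne_zero 2 hu0)) hs0) (mul_ne_zero hs0 ha0) hξ0
      (by rw [← hu]; field_simp)
  rw [betaProd_vec, show a * u / s * (b * u / s) = p * q / s ^ 2 by rw [← hu]; field_simp,
    show a * u / s * (s / u * z) = a * z by field_simp,
    show a * u / s * (s / u * z⁻¹) = a * z⁻¹ by field_simp,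
    show b * u / s * (s / u * z) = b * z by field_simp,
    show b * u / s * (s / u * z⁻¹) = b * z⁻¹ by field_simp,
    show a * u / s * (u * ξ) = a * u ^ 2 / s * ξ by ring,
    show a * u / s * (u * ξ⁻¹) = a * u ^ 2 / s * ξ⁻¹ by ring,
    show b * u / s * (u * ξ) = b * u ^ 2 / s * ξ by ring,
    show b * u / s * (u * ξ⁻¹) = b * u ^ 2 / s * ξ⁻¹ by ring,
    show s / u * z * (s / u * z⁻¹) = s ^ 2 / u ^ 2 by field_simp,
    show s / u * z * (u * ξ) = s * ξ * z by field_simp,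
    show s / u * z * (u * ξ⁻¹) = s * ξ⁻¹ * z by field_simp,
    show s / u * z⁻¹ * (u * ξ) = s * ξ * z⁻¹ by field_simp,
    show s / u * z⁻¹ * (u * ξ⁻¹) = s * ξ⁻¹ * z⁻¹ by field_simp,
    show u * ξ * (u * ξ⁻¹) = u ^ 2 by field_simp]
  calc _ = eGamma p q (p * q / s ^ 2) * eGamma p q (s ^ 2 / u ^ 2) * eGamma p q (u ^ 2) *
      (eGammaPM p q (s * ξ) z * eGammaPM p q (s * ξ⁻¹) z) *
      ((eGammaPM p q a z * eGammaPM p q (p * q / a) z) *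
        (eGammaPM p q b z * eGammaPM p q (p * q / b) z) *
        (eGammaPM p q (a * u ^ 2 / s) ξ * eGammaPM p q (s * b) ξ) *
        (eGammaPM p q (b * u ^ 2 / s) ξ * eGammaPM p q (s * a) ξ)) := by
        simp only [eGammaPM]; ring
    _ = _ := by rw [k1, k2, k3, k4]; ring

omit hp hq in
theorem betaProd_right (p q : ℂ) {c d s v x ξ : ℂ} (hs0 : s ≠ 0) (hx0 : x ≠ 0) (hξ0 : ξ ≠ 0) :
    betaProd p q ![c, d, v / s * x, v / s * x⁻¹, s * ξ, s * ξ⁻¹] =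
      eGamma p q (c * d) * eGammaPM p q (c * v / s) x * eGammaPM p q (d * v / s) x *
        eGamma p q (v ^ 2 / s ^ 2) * eGamma p q (s ^ 2) * phi p q v x c d ξ s := by
  rw [betaProd_vec, phi, show v / s * x * (v / s * x⁻¹) = v ^ 2 / s ^ 2 by field_simp,
    show c * (v / s * x) = c * v / s * x by ring,
    show c * (v / s * x⁻¹) = c * v / s * x⁻¹ by ring,
    show d * (v / s * x) = d * v / s * x by ring,
    show d * (v / s * x⁻¹) = d * v / s * x⁻¹ by ring,
    show c * (s * ξ) = s * c * ξ by ring, show c * (s * ξ⁻¹) = s * c * ξ⁻¹ by ring,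
    show d * (s * ξ) = s * d * ξ by ring, show d * (s * ξ⁻¹) = s * d * ξ⁻¹ by ring,
    show v / s * x * (s * ξ) = v * x * ξ by field_simp,
    show v / s * x * (s * ξ⁻¹) = v * x * ξ⁻¹ by field_simp,
    show v / s * x⁻¹ * (s * ξ) = v * x⁻¹ * ξ by field_simp,
    show v / s * x⁻¹ * (s * ξ⁻¹) = v * x⁻¹ * ξ⁻¹ by field_simp,
    show s * ξ * (s * ξ⁻¹) = s ^ 2 by field_simp]
  simp only [eGammaPM]
  ring

theorem inv_eGamma_sq_mul_eGamma_inv_sq {z : ℂ} (hz : ‖z‖ = 1) :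
    (eGamma p q (z ^ 2) * eGamma p q (z⁻¹ ^ 2))⁻¹ = betaKer p q z := by
  rw [betaKer, inv_pow]
  exact inv_eGamma_mul_eGamma_inv hp hq (by rw [norm_pow, hz, one_pow])

theorem ellHypV_vec (a b c d e f g h : ℂ) : ellHypV p q ![a, b, c, d, e, f, g, h] =
    kappa p q * ∮ z in C(0, 1), (eGammaPM p q a z * eGammaPM p q b z * eGammaPM p q c z *
      eGammaPM p q d z * eGammaPM p q e z * eGammaPM p q f z * eGammaPM p q g z *
      eGammaPM p q h z) * betaKer p q z / z := by
  rw [ellHypV, ellHypI]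
  congr 1
  refine circleIntegral.integral_congr zero_le_one fun z hz => ?_
  rw [← inv_eGamma_sq_mul_eGamma_inv_sq hp hq (by simpa using hz), ← div_eq_mul_inv]
  exact congrArg (fun y => y / _ / z) (Fin.prod_univ_eight _)

end

/-- The factor of the integrand of `kernelR * phi` which depends on `w` alone. -/
noncomputable def outerFactor (p q a b s u ξ w : ℂ) : ℂ :=
  eGammaPM p q (a * u / s) w * eGammaPM p q (b * u / s) w *
    (eGammaPM p q (u * ξ) w * eGammaPM p q (u * ξ⁻¹) w) * betaKer p q w / w

/-- The factor of the integrand of `kernelR * phi` which depends on `z` alone. -/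
noncomputable def innerFactor (p q a b c d s v x z : ℂ) : ℂ :=
  eGammaPM p q c z * eGammaPM p q d z * eGammaPM p q (v / s * x) z * eGammaPM p q (v / s * x⁻¹) z *
    (eGammaPM p q (p * q / a) z * eGammaPM p q (p * q / b) z) * betaKer p q z / z

/-- The double integrand obtained from `kernelR * phi`. -/
noncomputable def doubleFactor (p q a b c d s u v x ξ w z : ℂ) : ℂ :=
  outerFactor p q a b s u ξ w * (innerFactor p q a b c d s v x z *
    (eGammaPM p q (s / u * w) z * eGammaPM p q (s / u * w⁻¹) z))

/-- The constant factor of `kernelR * phi`. -/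
noncomputable def constFactor (p q a b c d s v x ξ : ℂ) : ℂ :=
  eGamma p q (a * b) / (eGamma p q (c * d) * eGammaPM p q (c * v / s) x *
    eGammaPM p q (d * v / s) x) /
    (eGamma p q (a * b / (p * q / s ^ 2)) * eGamma p q (p * q / s ^ 2 / (c * d))) *
    (eGammaPM p q (s * a) ξ * eGammaPM p q (s * b) ξ)

section

variable {p q : ℂ} (hp : ‖p‖ < 1) (hq : ‖q‖ < 1)

include hp hq

/-- Regrouping turns `Γ(uw^±ξ^±)` into beta factors in `w`. At `w = ±1` the reciprocal of
`Γ(w^{±2})` is `0`, in agreement with `betaKer`. -/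
theorem kernelR_mul_phi_div {a b c d s u v x ξ w : ℂ} (hw : ‖w‖ = 1) :
    kernelR p q u v c d a b x w s * phi p q u w a b ξ s / w =
      constFactor p q a b c d s v x ξ * kappa p q *
        ∮ z in C(0, 1), doubleFactor p q a b c d s u v x ξ w z := by
  have h1 : (∮ z in C(0, 1), doubleFactor p q a b c d s u v x ξ w z) =
      outerFactor p q a b s u ξ w * ∮ z in C(0, 1), (eGammaPM p q c z * eGammaPM p q d z *
        eGammaPM p q (v / s * x) z * eGammaPM p q (v / s * x⁻¹) z * eGammaPM p q (p * q / a) z *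
        eGammaPM p q (p * q / b) z * eGammaPM p q (s / u * w) z *
        eGammaPM p q (s / u * w⁻¹) z) * betaKer p q z / z := by
    rw [← circleIntegral.integral_const_mul]
    refine circleIntegral.integral_congr zero_le_one fun z _ => ?_
    simp only [doubleFactor, innerFactor]
    ring
  rw [h1, kernelR, phi, ellHypV_vec hp hq, outerFactor, constFactor, eGammaPM_mul_comm p q u w ξ,
    ← inv_eGamma_sq_mul_eGamma_inv_sq hp hq hw]
  simp only [div_eq_mul_inv, mul_inv, one_mul]
  ring

theorem continuousOn_doubleFactor {a b c d s u v x ξ : ℂ} (hp0 : p ≠ 0) (hq0 : q ≠ 0)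
    (ha0 : a ≠ 0) (hb0 : b ≠ 0) (hc0 : c ≠ 0) (hd0 : d ≠ 0) (hs0 : s ≠ 0) (hx0 : x ≠ 0)
    (hu0 : u ≠ 0) (hv0 : v ≠ 0) (hξ0 : ξ ≠ 0) (hc : ‖c‖ < 1) (hd : ‖d‖ < 1)
    (hx : ‖v / s * x‖ < 1) (hx' : ‖v / s * x⁻¹‖ < 1) (ha : ‖p * q / a‖ < 1) (hb : ‖p * q / b‖ < 1)
    (hsu : ‖s / u‖ < 1) (hau : ‖a * u / s‖ < 1) (hbu : ‖b * u / s‖ < 1)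
    (hξ : ‖u * ξ‖ < 1) (hξ' : ‖u * ξ⁻¹‖ < 1) :
    ContinuousOn (Function.uncurry (doubleFactor p q a b c d s u v x ξ))
      (Metric.sphere 0 1 ×ˢ Metric.sphere 0 1) := by
  set S : Set (ℂ × ℂ) := Metric.sphere 0 1 ×ˢ Metric.sphere 0 1
  have hw1 : ∀ y ∈ S, ‖y.1‖ = 1 := fun y hy => by simpa using hy.1
  have hz1 : ∀ y ∈ S, ‖y.2‖ = 1 := fun y hy => by simpa using hy.2
  have hw0 : ∀ y ∈ S, y.1 ≠ 0 := fun y hy => ne_zero_of_norm_eq_one (hw1 y hy)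
  have hwc : ContinuousOn (fun y : ℂ × ℂ => y.1) S := continuousOn_fst
  have hzc : ContinuousOn (fun y : ℂ × ℂ => y.2) S := continuousOn_snd
  have hW : ∀ t : ℂ, t ≠ 0 → ‖t‖ < 1 → ContinuousOn (fun y : ℂ × ℂ => eGammaPM p q t y.1) S :=
    fun t t0 t1 => continuousOn_eGammaPM_comp hp hq continuousOn_const hwc (fun _ _ => t0)
      (fun _ _ => t1) hw1
  have hZ : ∀ t : ℂ, t ≠ 0 → ‖t‖ < 1 → ContinuousOn (fun y : ℂ × ℂ => eGammaPM p q t y.2) S :=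
    fun t t0 t1 => continuousOn_eGammaPM_comp hp hq continuousOn_const hzc (fun _ _ => t0)
      (fun _ _ => t1) hz1
  have hsu0 := div_ne_zero hs0 hu0
  have hvs0 := div_ne_zero hv0 hs0
  have hpq0 := mul_ne_zero hp0 hq0
  refine ContinuousOn.mul (ContinuousOn.div ?_ hwc hw0) (ContinuousOn.mul (ContinuousOn.div ?_ hzc
    fun y hy => ne_zero_of_norm_eq_one (hz1 y hy)) ?_)
  · exact ((((hW _ (div_ne_zero (mul_ne_zero ha0 hu0) hs0) hau).mul
      (hW _ (div_ne_zero (mul_ne_zero hb0 hu0) hs0) hbu)).mul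
      ((hW _ (mul_ne_zero hu0 hξ0) hξ).mul (hW _ (mul_ne_zero hu0 (inv_ne_zero hξ0)) hξ'))).mul
      (continuousOn_betaKer_comp hp hq hwc hw1))
  · exact ((((((hZ _ hc0 hc).mul (hZ _ hd0 hd)).mul (hZ _ (mul_ne_zero hvs0 hx0) hx)).mul
      (hZ _ (mul_ne_zero hvs0 (inv_ne_zero hx0)) hx')).mul
      ((hZ _ (div_ne_zero hpq0 ha0) ha).mul (hZ _ (div_ne_zero hpq0 hb0) hb))).mul
      (continuousOn_betaKer_comp hp hq hzc hz1))
  · refine ContinuousOn.mul ?_ ?_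
    · exact continuousOn_eGammaPM_comp hp hq (continuousOn_const.mul hwc) hzc
        (fun y hy => mul_ne_zero hsu0 (hw0 y hy))
        (fun y hy => norm_mul_lt_one_of_norm_eq_one hsu (hw1 y hy)) hz1
    · exact continuousOn_eGammaPM_comp hp hq (continuousOn_const.mul (hwc.inv₀ hw0)) hzc
        (fun y hy => mul_ne_zero hsu0 (inv_ne_zero (hw0 y hy)))
        (fun y hy => norm_mul_lt_one_of_norm_eq_one hsu (norm_inv_eq_one (hw1 y hy))) hz1

omit hp hq in
theorem circleIntegral_doubleFactor_left (p q a b c d s u v x ξ z : ℂ) :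
    (∮ w in C(0, 1), doubleFactor p q a b c d s u v x ξ w z) =
      innerFactor p q a b c d s v x z *
        betaInt p q ![a * u / s, b * u / s, s / u * z, s / u * z⁻¹, u * ξ, u * ξ⁻¹] := by
  rw [betaInt, ← circleIntegral.integral_const_mul]
  refine circleIntegral.integral_congr zero_le_one fun w _ => ?_
  simp only [doubleFactor, outerFactor, Fin.prod_univ_six, Matrix.cons_val]
  rw [eGammaPM_mul_comm p q (s / u) w z]
  ring

end

end EllHyp

theorem mainTheorem1 (p q a b c d s u v x : ℂ)
    (hp0 : p ≠ 0) (hp : ‖p‖ < 1) (hq0 : q ≠ 0) (hq : ‖q‖ < 1)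
    (ha0 : a ≠ 0) (hb0 : b ≠ 0) (hc0 : c ≠ 0) (hd0 : d ≠ 0) (hs0 : s ≠ 0) (hx0 : x ≠ 0)
    (hu : u ^ 2 = p * q / (a * b)) (hv : v ^ 2 = p * q / (c * d))
    (hc : ‖c‖ < 1) (hd : ‖d‖ < 1)
    (hx : ‖v / s * x‖ < 1) (hx' : ‖v / s * x⁻¹‖ < 1)
    (ha : ‖p * q / a‖ < 1) (hb : ‖p * q / b‖ < 1)
    (hsu : ‖s / u‖ < 1)
    (hau : ‖a * u / s‖ < 1) (hbu : ‖b * u / s‖ < 1) :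
    ∀ ξ : ℂ, ξ ≠ 0 → ‖u * ξ‖ < 1 → ‖u * ξ⁻¹‖ < 1 →
      CircleIntegrable
        (fun w => EllHyp.kernelR p q u v c d a b x w s * EllHyp.phi p q u w a b ξ s / w) 0 1 ∧
      EllHyp.phi p q v x c d ξ s =
        EllHyp.kappa p q * ∮ w in C(0, 1),
          EllHyp.kernelR p q u v c d a b x w s * EllHyp.phi p q u w a b ξ s / w := by
  intro ξ hξ0 hξ hξ'
  have hab0 := mul_ne_zero ha0 hb0
  have hcd0 := mul_ne_zero hc0 hd0
  have hpq0 := mul_ne_zero hp0 hq0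
  have hu0 : u ≠ 0 := fun h => div_ne_zero hpq0 hab0 (by rw [← hu, h]; simp)
  have hv0 : v ≠ 0 := fun h => div_ne_zero hpq0 hcd0 (by rw [← hv, h]; simp)
  have hu' : a * b * u ^ 2 = p * q := by rw [hu, mul_div_cancel₀ _ hab0]
  have hv' : c * d * v ^ 2 = p * q := by rw [hv, mul_div_cancel₀ _ hcd0]
  have hcont := EllHyp.continuousOn_doubleFactor hp hq hp0 hq0 ha0 hb0 hc0 hd0 hs0 hx0 hu0 hv0 hξ0
    hc hd hx hx' ha hb hsu hau hbu hξ hξ'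
  have hEq : Set.EqOn
      (fun w => EllHyp.kernelR p q u v c d a b x w s * EllHyp.phi p q u w a b ξ s / w)
      (fun w => EllHyp.constFactor p q a b c d s v x ξ * EllHyp.kappa p q *
        ∮ z in C(0, 1), EllHyp.doubleFactor p q a b c d s u v x ξ w z) (Metric.sphere 0 1) :=
    fun w hw => EllHyp.kernelR_mul_phi_div hp hq (by simpa using hw)
  -- The integrand equals a continuous function on the circle, which gives its integrability.
  have hint := (EllHyp.continuousOn_circleIntegral zero_le_one hcont).const_mul
    (EllHyp.constFactor p q a b c d s v x ξ * EllHyp.kappa p q)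
  refine ⟨(hint.congr hEq).circleIntegrable zero_le_one, ?_⟩
  rw [circleIntegral.integral_congr zero_le_one hEq, circleIntegral.integral_const_mul,
    EllHyp.circleIntegral_swap zero_le_one zero_le_one hcont]
  have hsξ : ∀ y : ℂ, ‖u * y‖ < 1 → ‖s * y‖ < 1 := fun y hy => by
    have := EllHyp.norm_mul_lt_one hsu hy
    rwa [show s / u * (u * y) = s * y by field_simp] at this
  have hleft : ∀ z : ℂ, ‖z‖ = 1 → EllHyp.IsBetaParam p q
      ![a * u / s, b * u / s, s / u * z, s / u * z⁻¹, u * ξ, u * ξ⁻¹] := by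
    intro z hz
    have hz0 := EllHyp.ne_zero_of_norm_eq_one hz
    rw [EllHyp.isBetaParam_vec]
    refine ⟨by simp [*], ⟨hau, hbu, ?_, ?_, hξ, hξ'⟩, ?_⟩
    · exact EllHyp.norm_mul_lt_one_of_norm_eq_one hsu hz
    · exact EllHyp.norm_mul_lt_one_of_norm_eq_one hsu (EllHyp.norm_inv_eq_one hz)
    · rw [← hu']; field_simp
  have hright : EllHyp.IsBetaParam p q ![c, d, v / s * x, v / s * x⁻¹, s * ξ, s * ξ⁻¹] := by
    rw [EllHyp.isBetaParam_vec]
    refine ⟨by simp [*], ⟨hc, hd, hx, hx', hsξ _ hξ, hsξ _ hξ'⟩, ?_⟩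
    rw [← hv']; field_simp
  have hR := EllHyp.betaProd_ne_zero hp hq hright
  have hRv := EllHyp.kappa_mul_betaInt hp0 hp hq0 hq hright
  rw [EllHyp.betaProd_right p q hs0 hx0 hξ0] at hR hRv
  have hs2 : ‖s ^ 2‖ < 1 := by
    have := EllHyp.norm_mul_lt_one (hsξ _ hξ) (hsξ _ hξ')
    rwa [show s * ξ * (s * ξ⁻¹) = s ^ 2 by field_simp] at this
  have hu2 : ‖u ^ 2‖ < 1 := by
    have := EllHyp.norm_mul_lt_one hξ hξ'
    rwa [show u * ξ * (u * ξ⁻¹) = u ^ 2 by field_simp] at this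
  have hsu2 : ‖s ^ 2 / u ^ 2‖ < 1 := by
    have := EllHyp.norm_mul_lt_one hsu hsu
    rwa [show s / u * (s / u) = s ^ 2 / u ^ 2 by ring] at this
  have hρ : ‖p * q / s ^ 2‖ < 1 := by
    have := EllHyp.norm_mul_lt_one hau hbu
    rwa [show a * u / s * (b * u / s) = p * q / s ^ 2 by rw [← hu']; ring] at this
  have hab : ‖a * b‖ < 1 := by
    have := EllHyp.norm_mul_lt_one hρ hsu2
    rwa [show p * q / s ^ 2 * (s ^ 2 / u ^ 2) = a * b by rw [← hu']; field_simp] at this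
  -- Among the constants left by the two beta integrals, `Γ(u²)` and `Γ(pq/s²)` are inverse to
  -- `Γ(ab)` and `Γ(s²)`.
  have k1 : EllHyp.eGamma p q (a * b) * EllHyp.eGamma p q (u ^ 2) = 1 :=
    EllHyp.eGamma_mul_eGamma hp hq hab hu2 hab0 (pow_ne_zero 2 hu0) hu'
  have k2 : EllHyp.eGamma p q (s ^ 2) * EllHyp.eGamma p q (p * q / s ^ 2) = 1 :=
    EllHyp.eGamma_mul_eGamma hp hq hs2 hρ (pow_ne_zero 2 hs0) (div_ne_zero hpq0 (pow_ne_zero 2 hs0))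
      (mul_div_cancel₀ _ (pow_ne_zero 2 hs0))
  have k3 : EllHyp.eGamma p q (s ^ 2 / u ^ 2) ≠ 0 := by
    refine EllHyp.eGamma_ne_zero hp hq hsu2 ?_
    have := EllHyp.norm_mul_lt_one hρ hu2
    rwa [show p * q / s ^ 2 * u ^ 2 = p * q / (s ^ 2 / u ^ 2) by field_simp] at this
  -- Evaluating the `w`-integral for each `z` leaves the integrand of the second beta integral; the
  -- remaining `kappa` is used for that one.
  have hinner : EllHyp.kappa p q * (EllHyp.eGammaPM p q (s * a) ξ * EllHyp.eGammaPM p q (s * b) ξ) *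
      (∮ z in C(0, 1), ∮ w in C(0, 1), EllHyp.doubleFactor p q a b c d s u v x ξ w z) =
      EllHyp.eGamma p q (p * q / s ^ 2) * EllHyp.eGamma p q (s ^ 2 / u ^ 2) *
        EllHyp.eGamma p q (u ^ 2) *
        EllHyp.betaInt p q ![c, d, v / s * x, v / s * x⁻¹, s * ξ, s * ξ⁻¹] := by
    rw [EllHyp.betaInt, ← circleIntegral.integral_const_mul, ← circleIntegral.integral_const_mul]
    refine circleIntegral.integral_congr zero_le_one fun z hz => ?_
    have hz1 : ‖z‖ = 1 := by simpa using hz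
    have h1 := EllHyp.kappa_mul_betaInt hp0 hp hq0 hq (hleft z hz1)
    have h2 := EllHyp.betaProd_left_mul hp hq ha0 hb0 hs0 hu0 hξ0 hu' hξ hξ' ha hb hsu hau hbu hz1
    rw [← h1] at h2
    simp only [EllHyp.circleIntegral_doubleFactor_left, EllHyp.innerFactor, Fin.prod_univ_six,
      Matrix.cons_val]
    linear_combination (EllHyp.eGammaPM p q c z * EllHyp.eGammaPM p q d z *
      EllHyp.eGammaPM p q (v / s * x) z * EllHyp.eGammaPM p q (v / s * x⁻¹) z *
      EllHyp.betaKer p q z / z) * h2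
  rw [EllHyp.constFactor,
    show a * b / (p * q / s ^ 2) = s ^ 2 / u ^ 2 by rw [← hu']; field_simp,
    show p * q / s ^ 2 / (c * d) = v ^ 2 / s ^ 2 by rw [← hv']; field_simp]
  set N := EllHyp.eGamma p q (c * d) * EllHyp.eGammaPM p q (c * v / s) x *
    EllHyp.eGammaPM p q (d * v / s) x
  -- `N` and `V` are factors of the nonvanishing second beta product, so the denominators of the
  -- kernel can be cancelled.
  have hN : N ≠ 0 := fun h => hR (by rw [h]; ring)
  have hV : EllHyp.eGamma p q (v ^ 2 / s ^ 2) ≠ 0 := fun h => hR (by rw [h]; ring)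
  set J := ∮ z in C(0, 1), ∮ w in C(0, 1), EllHyp.doubleFactor p q a b c d s u v x ξ w z
  set E := EllHyp.eGammaPM p q (s * a) ξ * EllHyp.eGammaPM p q (s * b) ξ
  set V := EllHyp.eGamma p q (v ^ 2 / s ^ 2)
  set U := EllHyp.eGamma p q (s ^ 2 / u ^ 2)
  set Φ := EllHyp.phi p q v x c d ξ s
  calc Φ = (EllHyp.eGamma p q (a * b) * EllHyp.eGamma p q (u ^ 2)) *
      (EllHyp.eGamma p q (s ^ 2) * EllHyp.eGamma p q (p * q / s ^ 2)) * Φ := by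
        rw [k1, k2, one_mul, one_mul]
    _ = EllHyp.eGamma p q (a * b) / N / (U * V) * (EllHyp.eGamma p q (p * q / s ^ 2) * U *
        EllHyp.eGamma p q (u ^ 2) * (N * V * EllHyp.eGamma p q (s ^ 2) * Φ)) := by
        field_simp
    _ = EllHyp.eGamma p q (a * b) / N / (U * V) * (EllHyp.kappa p q *
        (EllHyp.kappa p q * E * J)) := by
        rw [← hRv, hinner]; ring
    _ = _ := by ring
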